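/- **Conventions.** Graphs are simple. A graph with a labeled partition is a structure over the signature $\{E,U_1,\dots,U_\ell\}$, with $E$ the edge relation and $U_1,\dots,U_\ell$ the parts (possibly empty, pairwise disjoint, covering all vertices). For structures over a common signature, $\mathscr A\equiv^{\mathrm{MSO}}_q\mathscr B$ means that Duplicator can survive $q$ rounds of the MSO Ehrenfeucht–Fraïssé game: in each round Spoiler plays an element or a subset of one structure and Duplicator answers with an element, respectively a subset, of the other one; at the end the played elements must induce isomorphic substructures of the structures expanded by $=$ and by the played sets. For a partition $\mathcal P$ of the vertex set of a finite graph $G$, two distinct parts form a *black edge* of $G/\mathcal P$ if all edges between them are present, and a *red edge* if some but not all are present. A *red component* is a connected component of the graph of red edges on $\mathcal P$. Let the parts be labeled by $1,\dots,d$ so that parts in the same red component have distinct labels. The *local MSO rank-$q$ partitioned type* of a red component with vertex set $C\subseteq V(G)$ is the set of MSO sentences over $\{E,U_1,\dots,U_d\}$ of quantifier rank at most $q$ that hold in $G[C]$, where $U_i$ is the part with label $i$ in the component (empty if there is none). A *partition sequence* of an $n$-vertex graph $G$ ($n\ge 1$) is a sequence $\mathcal P_n,\dots,\mathcal P_1$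 of partitions of $V(G)$, where $\mathcal P_n$ consists of singletons, $\mathcal P_1=\{V(G)\}$, and $\mathcal P_i$ arises from $\mathcal P_{i+1}$ by merging two parts. It has *component twin-width at most $d$* if for each $i$ every red component of $G/\mathcal P_i$ has at most $d$ parts. **Theorem.** 1. Let $(G^j,(X^j_1,\dots,X^j_{\ell_j}))$ and $(H^j,(Y^j_1,\dots,Y^j_{\ell_j}))$, $j\in[k]$, be graphs with labeled partitions such that $(G^j,(X^j_h)_h)\equiv^{\mathrm{MSO}}_q(H^j,(Y^j_h)_h)$ for every $j$. Let $B$ be a graph on the set of pairs $(j,h)$ with $j\in[k]$, $h\in[\ell_j]$. Let $G$ be obtained from the disjoint union of the $G^j$ by adding all edges between $X^j_h$ and $X^{j'}_{h'}$ whenever $(j,h)(j',h')\in E(B)$, with the labeled partition $\mathcal P^o=(X^j_h)_{j,h}$; let $(H,\mathcal Q^o)$ be obtained in the same way from the $H^j$ and $B$. Let $X,X'$ be two parts of $\mathcal P^o$ and $Y,Y'$ the parts of $\mathcal Q^o$ with the same indices. Then $(G,\mathcal P^o,X,X')\equiv^{\mathrm{MSO}}_q(H,\mathcal Q^o,Y,Y')$.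 2. Let $\mathcal P'$ arise from a partition $\mathcal P$ of $V(G)$ by merging two distinct parts $X,X'$, and let $C'$ be the red component of $G/\mathcal P'$ containing $X\cup X'$. The local MSO rank-$q$ partitioned type of $C'$ is determined by the following data on the parts of $\mathcal P$ that end up in $C'$: their grouping into red components of $G/\mathcal P$, the local MSO rank-$q$ partitioned types of these components, the labels before and after the merge, the black edges between parts in distinct components, and the contracted pair $(X,X')$. That is, if two such situations (possibly on different graphs, with the same $d$) admit a bijection between the involved parts that preserves these data, then the two new types are equal. 3. There are a single program for a unit-cost random access machine (with addition, truncated subtraction, indirect addressing and random access to a read-only input) and a function $f:\mathbb N^2\to\mathbb N$ such that the following holds. Let $\varphi$ be an MSO$_1$ sentence (MSO over $\{E\}$), $d\ge 0$, $n\ge1$, and $G$ a graph on $n$ vertices with a partition sequence of component twin-width at most $d$. The input consists of $d$, $n$, $\varphi$, the adjacency matrix of $G$, and the sequence of quotient trigraphs $G/\mathcal P_n,\dots,G/\mathcal P_1$, given by the contracted pair of each step together with the red neighbors of the new part. On this input the program decides whether $G\models\varphi$ in at most $f(|\varphi|,d)\cdot n$ steps, using only numbers of size at most $f(|\varphi|,d)\cdot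 n^2$ in its memory. -/

import Mathlib

universe u v

/-! ### Monadic second-order logic on vertex-labeled graphs -/

/-- A relational structure over the signature `{E} ∪ {U_c : c ∈ κ}` with `E` interpreted as the
edge relation of a simple graph and every `U_c` as a set of vertices. -/
structure LabeledGraph (κ : Type*) (V : Type*) where
  graph : SimpleGraph V
  label : κ → Set V

/-- MSO formulas over the signature `{E} ∪ {U_c : c ∈ κ}` with equality, having `e` free
first-order variables and `s` free set variables (de Bruijn indices: a quantifier binds the
variable `0` of its kind). The other connectives and the universal quantifiers are the usual
abbreviations. -/
inductive MSO (κ : Type*) : ℕ → ℕ → Type _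
  | falsum {e s : ℕ} : MSO κ e s
  | eq {e s : ℕ} (x y : Fin e) : MSO κ e s
  | edge {e s : ℕ} (x y : Fin e) : MSO κ e s
  | lab {e s : ℕ} (c : κ) (x : Fin e) : MSO κ e s
  | mem {e s : ℕ} (x : Fin e) (S : Fin s) : MSO κ e s
  | neg {e s : ℕ} (φ : MSO κ e s) : MSO κ e s
  | conj {e s : ℕ} (φ ψ : MSO κ e s) : MSO κ e s
  | exVertex {e s : ℕ} (φ : MSO κ (e + 1) s) : MSO κ e s
  | exSet {e s : ℕ} (φ : MSO κ e (s + 1)) : MSO κ e s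

namespace MSO

/-- Satisfaction, for an assignment `a` of the first-order variables and `S` of the set
variables. -/
def Sat {κ V : Type*} (A : LabeledGraph κ V) :
    {e s : ℕ} → MSO κ e s → (Fin e → V) → (Fin s → Set V) → Prop
  | _, _, falsum, _, _ => False
  | _, _, eq x y, a, _ => a x = a y
  | _, _, edge x y, a, _ => A.graph.Adj (a x) (a y)
  | _, _, lab c x, a, _ => a x ∈ A.label c
  | _, _, mem x X, a, S => a x ∈ S X
  | _, _, neg φ, a, S => ¬ Sat A φ a S
  | _, _, conj φ ψ, a, S => Sat A φ a S ∧ Sat A ψ a S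
  | _, _, exVertex φ, a, S => ∃ v : V, Sat A φ (Fin.cons v a) S
  | _, _, exSet φ, a, S => ∃ X : Set V, Sat A φ a (Fin.cons X S)

/-- Quantifier rank: the largest number of nested quantifiers. -/
def rank {κ : Type*} : {e s : ℕ} → MSO κ e s → ℕ
  | _, _, falsum => 0
  | _, _, eq _ _ => 0
  | _, _, edge _ _ => 0
  | _, _, lab _ _ => 0
  | _, _, mem _ _ => 0
  | _, _, neg φ => rank φ
  | _, _, conj φ ψ => max (rank φ) (rank ψ)
  | _, _, exVertex φ => rank φ + 1
  | _, _, exSet φ => rank φ + 1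

/-- The symbol sequence of an MSO₁ formula in prefix notation. -/
def encode : {e s : ℕ} → MSO Empty e s → List ℕ
  | _, _, falsum => [0]
  | _, _, eq x y => [1, x, y]
  | _, _, edge x y => [2, x, y]
  | _, _, mem x X => [3, x, X]
  | _, _, neg φ => 4 :: encode φ
  | _, _, conj φ ψ => 5 :: (encode φ ++ encode ψ)
  | _, _, exVertex φ => 6 :: encode φ
  | _, _, exSet φ => 7 :: encode φ

/-- `|φ|`: the number of symbols of an MSO₁ formula. -/
def size {e s : ℕ} (φ : MSO Empty e s) : ℕ := φ.encode.length

end MSO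

/-- `A ⊨ φ` for a sentence `φ`. -/
def LabeledGraph.Models {κ V : Type*} (A : LabeledGraph κ V) (φ : MSO κ 0 0) : Prop :=
  φ.Sat A Fin.elim0 Fin.elim0

/-- A graph as a structure over the signature `{E}`. -/
def SimpleGraph.toStructure {V : Type*} (G : SimpleGraph V) : LabeledGraph Empty V where
  graph := G
  label := fun c => c.elim

/-- The rank-`q` MSO type: all sentences of quantifier rank at most `q` that hold. -/
def LabeledGraph.rankType {κ V : Type*} (q : ℕ) (A : LabeledGraph κ V) : Set (MSO κ 0 0) :=
  {φ | φ.rank ≤ q ∧ A.Models φ}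

/-! ### The MSO Ehrenfeucht-Fraïssé game -/

/-- `a_i ↦ b_i` is an isomorphism between the substructures of `(A, =, S_1, …, S_s)` and
`(B, =, T_1, …, T_s)` induced by the played elements. -/
def PartialIso {κ V W : Type*} (A : LabeledGraph κ V) (B : LabeledGraph κ W) {e s : ℕ}
    (a : Fin e → V) (S : Fin s → Set V) (b : Fin e → W) (T : Fin s → Set W) : Prop :=
  (∀ i j, a i = a j ↔ b i = b j) ∧
  (∀ i j, A.graph.Adj (a i) (a j) ↔ B.graph.Adj (b i) (b j)) ∧
  (∀ c i, a i ∈ A.label c ↔ b i ∈ B.label c) ∧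
  (∀ X i, a i ∈ S X ↔ b i ∈ T X)

/-- Duplicator can survive `q` more rounds of the MSO-EF game from the position in which the
elements `a, b` and the sets `S, T` have been played. In each round Spoiler plays an element or a
set in one of the two structures, and Duplicator answers in the other one. -/
def DuplicatorSurvives {κ V W : Type*} (A : LabeledGraph κ V) (B : LabeledGraph κ W) :
    (q : ℕ) → {e s : ℕ} → (Fin e → V) → (Fin s → Set V) → (Fin e → W) → (Fin s → Set W) → Prop
  | 0, _, _, a, S, b, T => PartialIso A B a S b T
  | q + 1, _, _, a, S, b, T =>
      (∀ v : V, ∃ w : W, DuplicatorSurvives A B q (Fin.cons v a) S (Fin.cons w b) T) ∧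
      (∀ w : W, ∃ v : V, DuplicatorSurvives A B q (Fin.cons v a) S (Fin.cons w b) T) ∧
      (∀ X : Set V, ∃ Y : Set W,
        DuplicatorSurvives A B q a (Fin.cons X S) b (Fin.cons Y T)) ∧
      (∀ Y : Set W, ∃ X : Set V,
        DuplicatorSurvives A B q a (Fin.cons X S) b (Fin.cons Y T))

/-- `A ≡_q^MSO B`. -/
def MSOEquiv {κ V W : Type*} (q : ℕ) (A : LabeledGraph κ V) (B : LabeledGraph κ W) : Prop :=
  DuplicatorSurvives A B q Fin.elim0 Fin.elim0 Fin.elim0 Fin.elim0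

/-! ### Gluing partitioned graphs along bicliques -/

/-- A graph with a labeled partition, given by the function `π` sending a vertex to the label of
its part; `U_c` is interpreted as the part with label `c`. -/
def partitioned {κ V : Type*} (G : SimpleGraph V) (π : V → κ) : LabeledGraph κ V where
  graph := G
  label := fun c => {v | π v = c}

/-- The disjoint union of the graphs `G j`, with a biclique added between the part `h` of `G j`
and the part `h'` of `G j'` whenever `(j, h)` and `(j', h')` are adjacent in `B`. -/
def glue {k : ℕ} {ℓ : Fin k → ℕ} {V : Fin k → Type*} (G : ∀ j, SimpleGraph (V j))
    (π : ∀ j, V j → Fin (ℓ j)) (B : SimpleGraph (Σ j, Fin (ℓ j))) :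
    SimpleGraph (Σ j, V j) where
  Adj x y := (∃ (j : Fin k) (v w : V j), x = ⟨j, v⟩ ∧ y = ⟨j, w⟩ ∧ (G j).Adj v w) ∨
    B.Adj ⟨x.1, π x.1 x.2⟩ ⟨y.1, π y.1 y.2⟩
  symm := by
    refine ⟨?_⟩
    rintro x y (⟨j, v, w, hx, hy, h⟩ | h)
    · exact Or.inl ⟨j, w, v, hy, hx, h.symm⟩
    · exact Or.inr h.symm
  loopless := by
    refine ⟨?_⟩
    rintro ⟨i, x⟩ (⟨j, v, w, hx, hy, h⟩ | h)
    · have hvw := hx.symm.trans hy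
      simp only [Sigma.mk.injEq, heq_eq_eq, true_and] at hvw
      exact h.ne hvw
    · exact h.ne rfl

/-- `(G, 𝒫°, X, X')`: the glued graph with all parts of all `G j` as labels and two further unary
relations for the distinguished parts `X` and `X'`. -/
def gluedStructure {k : ℕ} {ℓ : Fin k → ℕ} {V : Fin k → Type*} (G : ∀ j, SimpleGraph (V j))
    (π : ∀ j, V j → Fin (ℓ j)) (B : SimpleGraph (Σ j, Fin (ℓ j)))
    (X X' : Σ j, Fin (ℓ j)) :
    LabeledGraph ((Σ j, Fin (ℓ j)) ⊕ Fin 2) (Σ j, V j) where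
  graph := glue G π B
  label := Sum.elim (fun p => {x | (⟨x.1, π x.1 x.2⟩ : Σ j, Fin (ℓ j)) = p})
    ![{x | (⟨x.1, π x.1 x.2⟩ : Σ j, Fin (ℓ j)) = X}, {x | (⟨x.1, π x.1 x.2⟩ : Σ j, Fin (ℓ j)) = X'}]

/-! ### Vertex partitions, quotient trigraphs, partition sequences -/

section Partitions

/-- All edges or no edge between `X` and `Y`. -/
def Homogeneous {V : Type*} (G : SimpleGraph V) (X Y : Finset V) : Prop :=
  (∀ x ∈ X, ∀ y ∈ Y, G.Adj x y) ∨ (∀ x ∈ X, ∀ y ∈ Y, ¬ G.Adj x y)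

/-- `XY` is a red edge between two distinct parts. Red loops are irrelevant for the components and
are left out. -/
def RedAdj {V : Type*} (G : SimpleGraph V) (X Y : Finset V) : Prop :=
  X ≠ Y ∧ ¬ Homogeneous G X Y

/-- `XY` is a black edge between two distinct parts. -/
def BlackAdj {V : Type*} (G : SimpleGraph V) (X Y : Finset V) : Prop :=
  X ≠ Y ∧ ∀ x ∈ X, ∀ y ∈ Y, G.Adj x y

variable {V : Type*} [Fintype V] [DecidableEq V]

/-- The red graph of the quotient trigraph `G/P`; its vertices are the parts. -/
def redGraph (G : SimpleGraph V) (P : Finpartition (Finset.univ : Finset V)) :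
    SimpleGraph {X : Finset V // X ∈ P.parts} where
  Adj X Y := RedAdj G X.1 Y.1
  symm := by
    refine ⟨?_⟩
    rintro X Y ⟨hne, h⟩
    refine ⟨hne.symm, fun h' => h ?_⟩
    rcases h' with h' | h'
    · exact Or.inl fun x hx y hy => (h' y hy x hx).symm
    · exact Or.inr fun x hx y hy hxy => h' y hy x hx hxy.symm
  loopless := ⟨fun _ h => h.1 rfl⟩

/-- Every red component of `G/P` has at most `d` parts. -/
def ComponentWidthLE (G : SimpleGraph V) (P : Finpartition (Finset.univ : Finset V)) (d : ℕ) :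
    Prop :=
  ∀ D : (redGraph G P).ConnectedComponent, D.supp.ncard ≤ d

/-- `P'` arises from `P` by merging the two parts `X` and `X'`. -/
def Merges (P P' : Finpartition (Finset.univ : Finset V)) (X X' : Finset V) : Prop :=
  X ∈ P.parts ∧ X' ∈ P.parts ∧ X ≠ X' ∧ P'.parts = insert (X ∪ X') (P.parts \ {X, X'})

/-- `P n, …, P 1` is a partition sequence of the `n`-element set `V` (the values of `P` at other
indices are irrelevant). -/
def IsPartitionSequence (P : ℕ → Finpartition (Finset.univ : Finset V)) : Prop :=
  (P (Fintype.card V)).parts = Finset.univ.image (fun v : V => ({v} : Finset V)) ∧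
  (P 1).parts = {Finset.univ} ∧
  ∀ i, 1 ≤ i → i < Fintype.card V → ∃ X X', Merges (P (i + 1)) (P i) X X'

/-- The initial vertices landing in the red component `D`. -/
def componentVertices {G : SimpleGraph V} {P : Finpartition (Finset.univ : Finset V)}
    (D : (redGraph G P).ConnectedComponent) : Set V :=
  {v | ∃ A ∈ D.supp, v ∈ A.1}

/-- A labeling of the parts by `d` labels that gives the parts of each red component distinct
labels. -/
def IsLabeling (G : SimpleGraph V) (P : Finpartition (Finset.univ : Finset V)) {d : ℕ}
    (l : {X : Finset V // X ∈ P.parts} → Fin d) : Prop :=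
  ∀ A B, (redGraph G P).Reachable A B → l A = l B → A = B

/-- `(G[C], 𝒫°[C])` for the vertex set `C` of the red component `D`. -/
def componentStructure {G : SimpleGraph V} {P : Finpartition (Finset.univ : Finset V)} {d : ℕ}
    (l : {X : Finset V // X ∈ P.parts} → Fin d) (D : (redGraph G P).ConnectedComponent) :
    LabeledGraph (Fin d) (componentVertices D) where
  graph := G.induce (componentVertices D)
  label := fun c => {v | ∃ A ∈ D.supp, l A = c ∧ v.1 ∈ A.1}

/-- The local MSO rank-`q` partitioned type of the red component `D`. -/
def localType (q : ℕ) {G : SimpleGraph V} {P : Finpartition (Finset.univ : Finset V)} {d : ℕ}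
    (l : {X : Finset V // X ∈ P.parts} → Fin d) (D : (redGraph G P).ConnectedComponent) :
    Set (MSO (Fin d) 0 0) :=
  (componentStructure l D).rankType q

/-- The merge of two parts `X ≠ X'` of a vertex-partitioned graph, with labelings before
and after the merge. -/
structure MergeStep (V : Type*) [Fintype V] [DecidableEq V] (d : ℕ) where
  G : SimpleGraph V
  P : Finpartition (Finset.univ : Finset V)
  P' : Finpartition (Finset.univ : Finset V)
  X : {A : Finset V // A ∈ P.parts}
  X' : {A : Finset V // A ∈ P.parts}
  merges : Merges P P' X.1 X'.1
  l : {A : Finset V // A ∈ P.parts} → Fin d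
  l' : {A : Finset V // A ∈ P'.parts} → Fin d
  isLabeling : IsLabeling G P l
  isLabeling' : IsLabeling G P' l'

namespace MergeStep

variable {d : ℕ} (M : MergeStep V d)

/-- The part resulting from the old part `A`: it is `X ∪ X'` for `A = X` and `A = X'`, and `A`
itself otherwise. -/
def newPart (A : {A : Finset V // A ∈ M.P.parts}) : {A : Finset V // A ∈ M.P'.parts} :=
  if h : A = M.X ∨ A = M.X' then ⟨M.X.1 ∪ M.X'.1, by simp [M.merges.2.2.2]⟩
  else ⟨A.1, by
    rw [not_or] at h
    have h1 : A.1 ≠ M.X.1 := fun e => h.1 (Subtype.ext e)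
    have h2 : A.1 ≠ M.X'.1 := fun e => h.2 (Subtype.ext e)
    simp [M.merges.2.2.2, h1, h2, A.2]⟩

/-- The red component of an old part in `G/P`. -/
def oldComponent (A : {A : Finset V // A ∈ M.P.parts}) : (redGraph M.G M.P).ConnectedComponent :=
  (redGraph M.G M.P).connectedComponentMk A

/-- The red component of `G/P'` that contains the merged part `X ∪ X'`. -/
def newComponent : (redGraph M.G M.P').ConnectedComponent :=
  (redGraph M.G M.P').connectedComponentMk (M.newPart M.X)

/-- The parts of `P` that end up in the new red component. -/
def Involved : Type _ := {A : {A : Finset V // A ∈ M.P.parts} //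
  M.newPart A ∈ M.newComponent.supp}

/-- `ι` matches the data of two merges: the contracted pairs, the grouping of
the involved parts into red components, the labels before and after the merge, the black edges
between distinct red components, and the local types of the red components. -/
def Matching {W : Type*} [Fintype W] [DecidableEq W] (q : ℕ) (M : MergeStep V d)
    (N : MergeStep W d) (ι : M.Involved ≃ N.Involved) : Prop :=
  (∀ A, A.1 = M.X ↔ (ι A).1 = N.X) ∧
  (∀ A, A.1 = M.X' ↔ (ι A).1 = N.X') ∧
  (∀ A B, M.oldComponent A.1 = M.oldComponent B.1 ↔
    N.oldComponent (ι A).1 = N.oldComponent (ι B).1) ∧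
  (∀ A, M.l A.1 = N.l (ι A).1) ∧
  (∀ A, M.l' (M.newPart A.1) = N.l' (N.newPart (ι A).1)) ∧
  (∀ A B, M.oldComponent A.1 ≠ M.oldComponent B.1 →
    (BlackAdj M.G A.1.1 B.1.1 ↔ BlackAdj N.G (ι A).1.1 (ι B).1.1)) ∧
  (∀ A, localType q M.l (M.oldComponent A.1) = localType q N.l (N.oldComponent (ι A).1))

end MergeStep

end Partitions

/-! ### Random access machines -/

/-- Instructions of a random access machine with memory `m`, read-only random access input `inp`
and unit cost. -/
inductive Instr
  /-- `m[r] := k` -/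
  | const (r k : ℕ)
  /-- `m[r] := m[s] + m[t]` -/
  | add (r s t : ℕ)
  /-- `m[r] := max (m[s] - m[t]) 0` -/
  | sub (r s t : ℕ)
  /-- `m[r] := m[m[s]]` -/
  | load (r s : ℕ)
  /-- `m[m[r]] := m[s]` -/
  | store (r s : ℕ)
  /-- `m[r] := inp[m[s]]` -/
  | read (r s : ℕ)
  /-- jump to instruction `i` if `m[r] = 0` -/
  | jumpZero (r i : ℕ)

namespace RAM

structure State where
  pc : ℕ
  mem : ℕ → ℕ

/-- All memory cells are `0` at the start. -/
def init : State := ⟨0, fun _ => 0⟩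

/-- Execution of one instruction. -/
def exec (inp : List ℕ) (σ : State) : Instr → State
  | .const r k => ⟨σ.pc + 1, Function.update σ.mem r k⟩
  | .add r s t => ⟨σ.pc + 1, Function.update σ.mem r (σ.mem s + σ.mem t)⟩
  | .sub r s t => ⟨σ.pc + 1, Function.update σ.mem r (σ.mem s - σ.mem t)⟩
  | .load r s => ⟨σ.pc + 1, Function.update σ.mem r (σ.mem (σ.mem s))⟩
  | .store r s => ⟨σ.pc + 1, Function.update σ.mem (σ.mem r) (σ.mem s)⟩
  | .read r s => ⟨σ.pc + 1, Function.update σ.mem r (inp.getD (σ.mem s) 0)⟩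
  | .jumpZero r i => ⟨if σ.mem r = 0 then i else σ.pc + 1, σ.mem⟩

/-- One step; the machine halts when the program counter leaves the program. -/
def step (prog : List Instr) (inp : List ℕ) (σ : State) : State :=
  match prog[σ.pc]? with
  | some i => exec inp σ i
  | none => σ

/-- The state after `t` steps. -/
def run (prog : List Instr) (inp : List ℕ) (t : ℕ) : State := (step prog inp)^[t] init

/-- On input `inp` the program halts after at most `T` steps with output `b` in cell `0`, and all
numbers in the memory are at most `N` at all times (so that words of `⌈log₂ (N + 1)⌉` bits
suffice). -/
def Outputs (prog : List Instr) (inp : List ℕ) (T N b : ℕ) : Prop :=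
  prog.length ≤ (run prog inp T).pc ∧ (run prog inp T).mem 0 = b ∧
    ∀ t a, (run prog inp t).mem a ≤ N

end RAM

/-! ### Graphs given with a sequence, as machine input -/

/-- One contraction of a trigraph whose vertices are named by vertices of the initial graph: the
trigraph vertex `drop` is contracted into `keep`, and `red` lists the red neighbors that
`keep` has afterwards. -/
structure Contraction (n : ℕ) where
  keep : Fin n
  drop : Fin n
  red : List (Fin n)

/-- The part named `w` after the contractions `cs` (`∅` if `w` has been dropped). -/
def block {n : ℕ} (cs : List (Contraction n)) : Fin n → Finset (Fin n) :=
  cs.foldl (fun B c w => if w = c.keep then B c.keep ∪ B c.drop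
    else if w = c.drop then ∅ else B w) (fun w => {w})

/-- The list `cs` describes the partition sequence `P n, …, P 1` of `G` with its quotient
trigraphs. -/
def Describes {n : ℕ} (G : SimpleGraph (Fin n)) (P : ℕ → Finpartition (Finset.univ : Finset (Fin n)))
    (cs : List (Contraction n)) : Prop :=
  cs.length + 1 = n ∧
  ∀ (t : ℕ) (ht : t < cs.length),
    Merges (P (n - t)) (P (n - (t + 1))) (block (cs.take t) cs[t].keep)
      (block (cs.take t) cs[t].drop) ∧
    cs[t].red.Nodup ∧
    ∀ w, w ∈ cs[t].red ↔
      RedAdj G (block (cs.take (t + 1)) cs[t].keep) (block (cs.take (t + 1)) w)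

/-- The adjacency matrix, row by row. -/
def adjacencyWord {n : ℕ} (G : SimpleGraph (Fin n)) [DecidableRel G.Adj] : List ℕ :=
  (List.finRange n).flatMap fun u => (List.finRange n).map fun v => if G.Adj u v then 1 else 0

/-- One contraction as a sequence of numbers. -/
def Contraction.word {n : ℕ} (c : Contraction n) : List ℕ :=
  c.keep.val :: c.drop.val :: c.red.length :: c.red.map Fin.val

/-- The machine input: `d`, `n`, `|φ|`, the sentence, the adjacency matrix, the contractions. -/
def inputWord {n : ℕ} (φ : MSO Empty 0 0) (d : ℕ) (G : SimpleGraph (Fin n)) [DecidableRel G.Adj]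
    (cs : List (Contraction n)) : List ℕ :=
  d :: n :: φ.size :: (φ.encode ++ adjacencyWord G ++ cs.flatMap Contraction.word)

/-! Statements 1 and 2 rest on playing games in parallel. If a structure is composed of disjoint
components and adjacency across components depends only on the labels, Duplicator keeps one local
game per component. A set is cut into its traces and the local answers are glued together; a vertex
is answered inside its component, while the other local games merely lose a round
(`duplicatorSurvives_of_components`). For statement 2, the new red component consists of whole old
red components, and parts in different red components are joined completely or not at all, so the
black edges play the role of the bicliques. Passing between types and games uses that the graphs are
finite: if all answers of Duplicator were wrong, finitely many separating formulas could be
conjoined and quantified (`MSO.exists_vertex`, `MSO.exists_set`).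

For statement 3 a type is a single number `ty`. It codes a tree of depth `|φ|` whose nodes record
the atomic facts about the sets played so far and whose children are the subtrees for all choices of
one more set. Vertices are played as singletons, so set moves suffice. The tree of a union with
bicliques (`unionT`), of a relabeled graph (`relabelT`), of a single vertex (`leafT`), and the truth
value of a sentence (`evalT`) are all primitive recursive in these codes. A primitive recursive
function is computed by a fixed program whose running time depends on the arguments only
(`exists_computes`); the arguments that occur are bounded in terms of `|φ|` and `d`, so each call
takes constant time. Thus one program serves all `φ` and `d`, and no table of types is needed.

The program keeps, for every red component, a list of its parts, each named by one of its vertices,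
and the type of the induced subgraph with the positions in the list as labels. A contraction unites
the components of the two contracted parts and of the red neighbors of the new part. These make up
exactly the new red component before the merge, so at most `d + 1` parts are involved
(`Records.Describes.contract`). Parts from different components are homogeneous, so one matrix entry
per pair of names decides the black edges. Two relabelings then carry out the merge. The last record
belongs to the part `V(G)`, and the sentence is evaluated on its type. -/

/-! ### Finite sets of natural numbers as natural numbers -/

namespace TypeCode

/-- The number whose binary digits describe a finite set. -/
def ofSet (s : Finset ℕ) : ℕ := ∑ i ∈ s, 2 ^ i

/-- The finite set of positions of the binary digits `1`, as a list. -/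
def bits (t : ℕ) : List ℕ := (List.range t).filter fun i => t / 2 ^ i % 2 = 1

/-- The number coding the set of the entries of a list. -/
def ofList (l : List ℕ) : ℕ := ofSet l.toFinset

theorem mem_bits {i t : ℕ} : i ∈ bits t ↔ t.testBit i = true := by
  simp only [bits, List.mem_filter, List.mem_range, Nat.testBit_eq_decide_div_mod_eq,
    decide_eq_true_eq, and_iff_right_iff_imp]
  intro h
  by_contra hlt
  rw [Nat.div_eq_of_lt] at h
  · simp at h
  · exact lt_of_le_of_lt (not_lt.1 hlt) (Nat.lt_two_pow_self)

theorem mem_bits_ofSet {i : ℕ} {s : Finset ℕ} : i ∈ bits (ofSet s) ↔ i ∈ s := by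
  rw [mem_bits, ← Nat.mem_bitIndices, ← List.mem_toFinset, ofSet,
    Finset.toFinset_bitIndices_sum_two_pow]

theorem mem_bits_ofList {i : ℕ} {l : List ℕ} : i ∈ bits (ofList l) ↔ i ∈ l := by
  rw [ofList, mem_bits_ofSet, List.mem_toFinset]

theorem bits_lt {i t : ℕ} (h : i ∈ bits t) : i < t := by
  simp only [bits, List.mem_filter, List.mem_range] at h
  exact h.1

theorem ofSet_lt {s : Finset ℕ} {b : ℕ} (h : ∀ i ∈ s, i < b) : ofSet s < 2 ^ b :=
  Nat.geomSum_lt (le_refl 2) h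

/-- Adding a power of two sets a digit that was `0`. This presents `ofList` as a fold over the list,
the form from which primitive recursiveness follows. -/
theorem ofList_cons (x : ℕ) (l : List ℕ) :
    ofList (x :: l) = if x ∈ bits (ofList l) then ofList l else ofList l + 2 ^ x := by
  split_ifs with h
  · rw [mem_bits_ofList] at h
    simp [ofList, List.toFinset_cons, Finset.insert_eq_of_mem, h]
  · rw [mem_bits_ofList] at h
    rw [ofList, List.toFinset_cons, ofSet, Finset.sum_insert (by simpa using h), add_comm]
    rfl

open Primrec

theorem primrec_pow : Primrec₂ ((· ^ ·) : ℕ → ℕ → ℕ) := Primrec₂.unpaired'.1 Nat.Primrec.pow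

theorem primrec_bits : Primrec bits := by
  have hR : PrimrecRel fun (i t : ℕ) => t / 2 ^ i % 2 = 1 :=
    Primrec.eq.comp (nat_mod.comp (nat_div.comp snd (primrec_pow.comp (const 2) fst)) (const 2))
      (const 1)
  exact (hR.listFilter.comp list_range .id)

theorem primrec_mem_list : PrimrecRel fun (x : ℕ) (l : List ℕ) => x ∈ l := by
  have h : PrimrecRel fun (l : List ℕ) (x : ℕ) => ∃ a ∈ l, a = x :=
    PrimrecRel.exists_mem_list Primrec.eq
  exact (h.comp snd fst).of_eq fun p => by simp

theorem primrec_mem_bits : PrimrecRel fun (x t : ℕ) => x ∈ bits t :=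
  primrec_mem_list.comp fst (primrec_bits.comp snd)

theorem primrec_ofList : Primrec ofList := by
  have h : Primrec fun l : List ℕ => l.foldr
      (fun x a => if x ∈ bits a then a else a + 2 ^ x) 0 := by
    refine list_foldr (f := fun l : List ℕ => l)
      (h := fun _ (p : ℕ × ℕ) => if p.1 ∈ bits p.2 then p.2 else p.2 + 2 ^ p.1) .id (const 0) (Primrec.ite
      (primrec_mem_bits.comp (fst.comp snd) (snd.comp snd)) (snd.comp snd)
        (nat_add.comp (snd.comp snd) (primrec_pow.comp (const 2) (fst.comp snd))))
  refine h.of_eq fun l => ?_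
  induction l with
  | nil => simp [ofList, ofSet]
  | cons x l ih => rw [List.foldr_cons, ih, ofList_cons]

/-! ### Atomic facts about played sets -/

/-- An atomic fact of kind `kd` with the arguments `i` and `j`. The kind `0` says that the sets
`i` and `j` intersect, `1` that there is an edge between them, `2` that the set `i` meets the
label `j`, and `3` that the set `i` has two elements. -/
def fact (kd i j : ℕ) : ℕ := Nat.pair kd (Nat.pair i j)

def kind (f : ℕ) : ℕ := f.unpair.1
def arg₁ (f : ℕ) : ℕ := f.unpair.2.unpair.1
def arg₂ (f : ℕ) : ℕ := f.unpair.2.unpair.2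

@[simp] theorem kind_fact (k i j : ℕ) : kind (fact k i j) = k := by simp [kind, fact]
@[simp] theorem arg₁_fact (k i j : ℕ) : arg₁ (fact k i j) = i := by simp [arg₁, fact]
@[simp] theorem arg₂_fact (k i j : ℕ) : arg₂ (fact k i j) = j := by simp [arg₂, fact]
@[simp] theorem fact_eta (f : ℕ) : fact (kind f) (arg₁ f) (arg₂ f) = f := by
  simp [kind, fact, arg₁, arg₂]

theorem fact_inj {k i j k' i' j' : ℕ} : fact k i j = fact k' i' j' ↔ k = k' ∧ i = i' ∧ j = j' := by
  simp [fact]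

theorem primrec_kind : Primrec kind := fst.comp unpair
theorem primrec_arg₁ : Primrec arg₁ := fst.comp (unpair.comp (snd.comp unpair))
theorem primrec_arg₂ : Primrec arg₂ := snd.comp (unpair.comp (snd.comp unpair))

theorem primrec_fact {α : Type*} [Primcodable α] {k i j : α → ℕ} (hk : Primrec k)
    (hi : Primrec i) (hj : Primrec j) : Primrec fun a => fact (k a) (i a) (j a) :=
  Primrec₂.natPair.comp hk (Primrec₂.natPair.comp hi hj)

/-! ### Operations on type trees -/

/-- The facts of a node of a type tree. -/
def atom (t : ℕ) : ℕ := t.unpair.1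

/-- The children of a node of a type tree. -/
def kids (t : ℕ) : List ℕ := bits t.unpair.2

/-- A node with given facts and children. -/
def node (a : ℕ) (l : List ℕ) : ℕ := Nat.pair a (ofList l)

/-- Children are smaller numbers than their parent. The tree itself is therefore a measure for
recursion over trees, both for termination and for `nat_omega_rec`. -/
theorem kids_lt {t x : ℕ} (h : x ∈ kids t) : x < t :=
  (bits_lt h).trans_le (Nat.unpair_right_le t)

theorem primrec_atom : Primrec atom := fst.comp unpair
theorem primrec_kids : Primrec kids := primrec_bits.comp (snd.comp unpair)
theorem primrec_node : Primrec₂ node :=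
  Primrec₂.natPair.comp fst (primrec_ofList.comp snd)

/-- Facts about a disjoint union that come from a fact about either side; `B` codes the set of
pairs of labels that are completely adjacent. -/
def crossFacts (B f g : ℕ) : List ℕ :=
  -- `fact 0 i i` says that the set `i` is nonempty. A set that meets both sides of a disjoint union
  -- has two elements.
  if kind f = 0 ∧ kind g = 0 ∧ arg₁ f = arg₂ f ∧ arg₁ g = arg₂ g ∧ arg₁ f = arg₁ g then
    [fact 3 (arg₁ f) 0]
  else if kind f = 2 ∧ kind g = 2 ∧ Nat.pair (arg₂ f) (arg₂ g) ∈ bits B then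
    [fact 1 (arg₁ f) (arg₁ g), fact 1 (arg₁ g) (arg₁ f)]
  else []

/-- Labels are shifted by `m`. -/
def shiftFact (m f : ℕ) : ℕ := if kind f = 2 then fact 2 (arg₁ f) (arg₂ f + m) else f

/-- The facts about a disjoint union with bicliques between labels. -/
def unionAtom (B m a b : ℕ) : ℕ :=
  ofList (bits a ++ ((bits b).map (shiftFact m) ++
    (bits a).flatMap fun f => (bits b).flatMap fun g => crossFacts B f g))

/-- The type of a disjoint union with bicliques between labels; the labels of the second side are
shifted by `m`. -/
def unionT (B m t s : ℕ) : ℕ :=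
  node (unionAtom B m (atom t) (atom s))
    ((kids t).attach.flatMap fun t' => (kids s).map fun s' => unionT B m t'.1 s')
termination_by t
decreasing_by exact kids_lt t'.2

theorem unionT_eq (B m t s : ℕ) : unionT B m t s =
    node (unionAtom B m (atom t) (atom s))
      ((kids t).flatMap fun t' => (kids s).map fun s' => unionT B m t' s') := by
  rw [unionT]
  congr 1
  conv_rhs => rw [← List.attach_map_subtype_val (kids t), List.flatMap_map]

theorem primrec_crossFacts : Primrec fun p : ℕ × ℕ × ℕ => crossFacts p.1 p.2.1 p.2.2 := by
  have hf : Primrec fun p : ℕ × ℕ × ℕ => p.2.1 := fst.comp snd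
  have hg : Primrec fun p : ℕ × ℕ × ℕ => p.2.2 := snd.comp snd
  refine Primrec.ite ?_ ?_ (Primrec.ite ?_ ?_ (const []))
  · exact (Primrec.eq.comp (primrec_kind.comp hf) (const 0)).and
      ((Primrec.eq.comp (primrec_kind.comp hg) (const 0)).and
      ((Primrec.eq.comp (primrec_arg₁.comp hf) (primrec_arg₂.comp hf)).and
      ((Primrec.eq.comp (primrec_arg₁.comp hg) (primrec_arg₂.comp hg)).and
      (Primrec.eq.comp (primrec_arg₁.comp hf) (primrec_arg₁.comp hg)))))
  · exact list_cons.comp (primrec_fact (const 3) (primrec_arg₁.comp hf) (const 0)) (const [])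
  · exact (Primrec.eq.comp (primrec_kind.comp hf) (const 2)).and
      ((Primrec.eq.comp (primrec_kind.comp hg) (const 2)).and
      (primrec_mem_bits.comp (Primrec₂.natPair.comp (primrec_arg₂.comp hf) (primrec_arg₂.comp hg))
        fst))
  · exact list_cons.comp (primrec_fact (const 1) (primrec_arg₁.comp hf) (primrec_arg₁.comp hg))
      (list_cons.comp (primrec_fact (const 1) (primrec_arg₁.comp hg) (primrec_arg₁.comp hf))
        (const []))

theorem primrec_shiftFact : Primrec₂ shiftFact :=
  Primrec.ite (Primrec.eq.comp (primrec_kind.comp snd) (const 2))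
    (primrec_fact (const 2) (primrec_arg₁.comp snd) (nat_add.comp (primrec_arg₂.comp snd) fst)) snd

theorem primrec_unionAtom :
    Primrec fun p : (ℕ × ℕ) × (ℕ × ℕ) => unionAtom p.1.1 p.1.2 p.2.1 p.2.2 := by
  have ha : Primrec fun p : (ℕ × ℕ) × (ℕ × ℕ) => bits p.2.1 := primrec_bits.comp (fst.comp snd)
  have hb : Primrec fun p : (ℕ × ℕ) × (ℕ × ℕ) => bits p.2.2 := primrec_bits.comp (snd.comp snd)
  refine primrec_ofList.comp (list_append.comp ha (list_append.comp (list_map hb ?_)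
    (list_flatMap ha (list_flatMap (hb.comp fst) ?_))))
  · exact primrec_shiftFact.comp (snd.comp (fst.comp fst)) snd
  · exact primrec_crossFacts.comp (Primrec.pair (fst.comp (fst.comp (fst.comp fst)))
      (Primrec.pair (snd.comp fst) snd))

/-- The recursion descends in both trees at once; the first tree alone serves as the measure on
pairs. -/
theorem primrec_unionT :
    Primrec₂ fun (c : ℕ × ℕ) (p : ℕ × ℕ) => unionT c.1 c.2 p.1 p.2 := by
  refine nat_omega_rec (m := fun _ p => p.1)
    (l := fun _ p => (kids p.1).flatMap fun t' => (kids p.2).map fun s' => (t', s'))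
    (g := fun c q => some (node (unionAtom c.1 c.2 (atom q.1.1) (atom q.1.2)) q.2))
    _ (fst.comp snd) ?_ ?_ ?_ ?_
  · refine list_flatMap (primrec_kids.comp (fst.comp snd))
      (list_map (primrec_kids.comp (snd.comp (snd.comp fst))) (Primrec.pair (snd.comp fst) snd))
  · have h1 : Primrec fun x : (ℕ × ℕ) × (ℕ × ℕ) × List ℕ => (atom x.2.1.1, atom x.2.1.2) :=
      Primrec.pair (primrec_atom.comp (fst.comp (fst.comp snd)))
        (primrec_atom.comp (snd.comp (fst.comp snd)))
    have h2 : Primrec fun x : (ℕ × ℕ) × (ℕ × ℕ) × List ℕ =>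
        unionAtom x.1.1 x.1.2 (atom x.2.1.1) (atom x.2.1.2) :=
      primrec_unionAtom.comp (g := fun x : (ℕ × ℕ) × (ℕ × ℕ) × List ℕ =>
        (x.1, (atom x.2.1.1, atom x.2.1.2))) (Primrec.pair fst h1)
    exact option_some.comp (primrec_node.comp h2 (snd.comp snd))
  · intro c p p' h
    simp only [List.mem_flatMap, List.mem_map] at h
    obtain ⟨t', ht', s', _, rfl⟩ := h
    exact kids_lt ht'
  · intro c p
    simp only [List.map_flatMap, List.map_map, Function.comp_def]
    rw [← unionT_eq]

/-- The label `a` is replaced by `b`. -/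
def relabelFact (a b f : ℕ) : ℕ := if kind f = 2 ∧ arg₂ f = a then fact 2 (arg₁ f) b else f

/-- The type after replacing the label `a` by `b`. -/
def relabelT (a b t : ℕ) : ℕ :=
  node (ofList ((bits (atom t)).map (relabelFact a b)))
    ((kids t).attach.map fun t' => relabelT a b t'.1)
termination_by t
decreasing_by exact kids_lt t'.2

theorem relabelT_eq (a b t : ℕ) : relabelT a b t =
    node (ofList ((bits (atom t)).map (relabelFact a b))) ((kids t).map (relabelT a b)) := by
  rw [relabelT]
  congr 1
  conv_rhs => rw [← List.attach_map_subtype_val (kids t), List.map_map]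
  rfl

theorem primrec_relabelT : Primrec₂ fun (c : ℕ × ℕ) (t : ℕ) => relabelT c.1 c.2 t := by
  refine nat_omega_rec (m := fun _ t => t) (l := fun _ t => kids t)
    (g := fun c q => some (node (ofList ((bits (atom q.1)).map (relabelFact c.1 c.2))) q.2))
    _ snd (primrec_kids.comp snd) ?_ (fun c t t' h => kids_lt h) ?_
  · refine option_some.comp (primrec_node.comp (primrec_ofList.comp (list_map
      (primrec_bits.comp (primrec_atom.comp (fst.comp snd))) ?_)) (snd.comp snd))
    exact Primrec.ite ((Primrec.eq.comp (primrec_kind.comp snd) (const 2)).and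
      (Primrec.eq.comp (primrec_arg₂.comp snd) (fst.comp (fst.comp fst))))
      (primrec_fact (const 2) (primrec_arg₁.comp snd) (snd.comp (fst.comp fst))) snd
  · intro c t
    rw [← relabelT_eq]

/-- The facts about sets on a single vertex with label `0`; the entry `i` of `N` tells whether the
set `i` contains the vertex. -/
def leafAtom (N : List Bool) : ℕ :=
  ofList ((List.range N.length).flatMap fun i => (List.range N.length).flatMap fun j =>
    if N.getD i false = true ∧ N.getD j false = true then [fact 0 i j, fact 2 i 0] else [])

/-- The type of a single vertex with label `0`. -/
def leafT : ℕ → List Bool → ℕ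
  | 0, N => node (leafAtom N) []
  | r + 1, N => node (leafAtom N) [leafT r (true :: N), leafT r (false :: N)]

theorem primrec_leafAtom : Primrec leafAtom := by
  refine primrec_ofList.comp (list_flatMap (list_range.comp list_length)
    (list_flatMap (list_range.comp (list_length.comp fst)) (Primrec.ite (PrimrecPred.and ?_ ?_) ?_
      (const []))))
  · exact Primrec.eq.comp ((list_getD false).comp (fst.comp fst) (snd.comp fst)) (const true)
  · exact Primrec.eq.comp ((list_getD false).comp (fst.comp fst) snd) (const true)
  · exact list_cons.comp (primrec_fact (const 0) (snd.comp fst) snd)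
      (list_cons.comp (primrec_fact (const 2) (snd.comp fst) (const 0)) (const []))

theorem primrec_leafT : Primrec fun p : ℕ × List Bool => leafT p.1 p.2 := by
  refine nat_omega_rec' (m := fun p => p.1)
    (l := fun p => if p.1 = 0 then [] else [(p.1 - 1, true :: p.2), (p.1 - 1, false :: p.2)])
    (g := fun p q => some (node (leafAtom p.2) q))
    _ fst ?_ ?_ ?_ ?_
  · refine Primrec.ite (Primrec.eq.comp fst (const 0)) (const []) ?_
    have h : ∀ b : Bool, Primrec fun p : ℕ × List Bool => (p.1 - 1, b :: p.2) := fun b =>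
      Primrec.pair (nat_sub.comp fst (const 1)) (list_cons.comp (const b) snd)
    exact list_cons.comp (h true) (list_cons.comp (h false) (const []))
  · exact option_some.comp (primrec_node.comp (primrec_leafAtom.comp (snd.comp fst)) snd)
  · rintro ⟨r, N⟩ p' h
    rcases r with _ | r
    · simp at h
    · simp only [Nat.add_eq_zero_iff, one_ne_zero, and_false, if_false, Nat.add_sub_cancel,
        List.mem_cons, List.not_mem_nil, or_false] at h
      rcases h with rfl | rfl <;> simp
  · rintro ⟨r, N⟩
    rcases r with _ | r <;> simp [leafT]

end TypeCode

namespace TypeCode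

open Primrec

/-! ### Evaluation of sentences on type trees -/

/-- One step of skipping `c` formulas in prefix notation at the beginning of a list. -/
def skipStep (p : ℕ × List ℕ) : ℕ × List ℕ :=
  if p.1 = 0 then p
  -- The counter `p.1` is the number of formulas still to be skipped. A conjunction replaces one
  -- formula by two.
  else if p.2.headI = 5 then (p.1 + 1, p.2.tail)
  else if p.2.headI = 4 ∨ p.2.headI = 6 ∨ p.2.headI = 7 then (p.1, p.2.tail)
  else if p.2.headI = 0 then (p.1 - 1, p.2.tail)
  -- The remaining tokens are those of the atomic formulas with two arguments.
  else (p.1 - 1, p.2.drop 3)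

/-- Remove a formula in prefix notation from the beginning of a list. -/
def skip (l : List ℕ) : List ℕ := (skipStep^[l.length] (1, l)).2

theorem skipStep_length (p : ℕ × List ℕ) : (skipStep p).2.length ≤ p.2.length := by
  unfold skipStep
  split_ifs <;> simp

theorem length_skip (l : List ℕ) : (skip l).length ≤ l.length := by
  have h : ∀ k p, (skipStep^[k] p).2.length ≤ p.2.length := by
    intro k
    induction k with
    | zero => simp
    | succ k ih => intro p; exact (ih _).trans (skipStep_length p)
  exact h _ _

/-- The counter is generalized to `c + 1` because the first half of a conjunction is skipped while
its second half is still pending. -/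
theorem skipStep_iterate {e s : ℕ} (φ : MSO Empty e s) : ∀ (c : ℕ) (l : List ℕ),
    ∃ k ≤ φ.encode.length, skipStep^[k] (c + 1, φ.encode ++ l) = (c, l) := by
  induction φ with
  | falsum => intro c l; exact ⟨1, by simp [MSO.encode], by simp [MSO.encode, skipStep]⟩
  | eq x y => intro c l; exact ⟨1, by simp [MSO.encode], by simp [MSO.encode, skipStep]⟩
  | edge x y => intro c l; exact ⟨1, by simp [MSO.encode], by simp [MSO.encode, skipStep]⟩
  | mem x X => intro c l; exact ⟨1, by simp [MSO.encode], by simp [MSO.encode, skipStep]⟩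
  | lab c => exact c.elim
  | neg φ ih | exVertex φ ih | exSet φ ih =>
    intro c l
    obtain ⟨k, hk, h⟩ := ih c l
    refine ⟨k + 1, by simpa [MSO.encode] using hk, ?_⟩
    rw [Function.iterate_succ_apply, ← h]
    simp [MSO.encode, skipStep]
  | conj φ ψ ih₁ ih₂ =>
    intro c l
    obtain ⟨k₁, hk₁, h₁⟩ := ih₁ (c + 1) (ψ.encode ++ l)
    obtain ⟨k₂, hk₂, h₂⟩ := ih₂ c l
    refine ⟨k₂ + k₁ + 1, by simp [MSO.encode]; omega, ?_⟩
    rw [Function.iterate_succ_apply, Function.iterate_add_apply, ← h₂, ← h₁]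
    simp [MSO.encode, skipStep]

theorem skip_encode_append {e s : ℕ} (φ : MSO Empty e s) (l : List ℕ) :
    skip (φ.encode ++ l) = l := by
  obtain ⟨k, hk, h⟩ := skipStep_iterate φ 0 l
  -- Once the counter is `0` further steps are idle, so iterating as often as the list is long does
  -- no harm.
  have h0 : ∀ j, skipStep^[j] (0, l) = (0, l) := fun j =>
    Function.iterate_fixed (by simp [skipStep]) j
  obtain ⟨j, hj⟩ := Nat.exists_eq_add_of_le (hk.trans (by simp : _ ≤ (φ.encode ++ l).length))
  rw [skip, hj, add_comm, Function.iterate_add_apply, h, h0]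

theorem primrec_skip : Primrec skip := by
  have hc : ∀ k : ℕ, PrimrecPred fun p : ℕ × List ℕ => p.2.headI = k := fun k =>
    Primrec.eq.comp (list_headI.comp snd) (const k)
  have ht : Primrec fun p : ℕ × List ℕ => p.2.tail := list_tail.comp snd
  have h : Primrec skipStep := by
    refine Primrec.ite (Primrec.eq.comp fst (const 0)) .id (Primrec.ite (hc 5) ?_
      (Primrec.ite ((hc 4).or ((hc 6).or (hc 7))) ?_ (Primrec.ite (hc 0) ?_ ?_)))
    · exact Primrec.pair (nat_add.comp fst (const 1)) ht
    · exact Primrec.pair fst ht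
    · exact Primrec.pair (nat_sub.comp fst (const 1)) ht
    · exact Primrec.pair (nat_sub.comp fst (const 1)) (list_drop.comp (const 3) snd)
  exact snd.comp (nat_iterate list_length (Primrec.pair (const 1) .id) (h.comp snd).to₂)

/-- A token list, a type tree, and the positions of the vertex and set variables among the
played sets. -/
abbrev EvalState := List ℕ × ℕ × List ℕ × List ℕ

/-- The most recently played set is a singleton. -/
def IsOne (t : ℕ) : Prop := fact 0 0 0 ∈ bits (atom t) ∧ ¬ fact 3 0 0 ∈ bits (atom t)

instance : DecidablePred IsOne := fun _ => inferInstanceAs (Decidable (_ ∧ _))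

/-- The state for the quantified formula after a vertex move. -/
def moveVertex (p : EvalState) (t : ℕ) : EvalState :=
  (p.1.tail, t, 0 :: p.2.2.1.map Nat.succ, p.2.2.2.map Nat.succ)

/-- The state for the quantified formula after a set move. -/
def moveSet (p : EvalState) (t : ℕ) : EvalState :=
  (p.1.tail, t, p.2.2.1.map Nat.succ, 0 :: p.2.2.2.map Nat.succ)

/-- The states on which the value at a state depends. -/
def evalQueries (p : EvalState) : List EvalState :=
  if p.1.headI = 4 then [(p.1.tail, p.2)]
  else if p.1.headI = 5 then [(p.1.tail, p.2), (skip p.1.tail, p.2)]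
  else if p.1.headI = 6 then ((kids p.2.1).filter fun t => IsOne t).map (moveVertex p)
  else if p.1.headI = 7 then (kids p.2.1).map (moveSet p)
  else []

/-- The value at a state in terms of the values of the states it depends on. -/
def evalAnswer (p : EvalState) (r : List Bool) : Bool :=
  if p.1.headI = 1 then
    decide (fact 0 (p.2.2.1.getD (p.1.getD 1 0) 0) (p.2.2.1.getD (p.1.getD 2 0) 0) ∈
      bits (atom p.2.1))
  else if p.1.headI = 2 then
    decide (fact 1 (p.2.2.1.getD (p.1.getD 1 0) 0) (p.2.2.1.getD (p.1.getD 2 0) 0) ∈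
      bits (atom p.2.1))
  else if p.1.headI = 3 then
    decide (fact 0 (p.2.2.1.getD (p.1.getD 1 0) 0) (p.2.2.2.getD (p.1.getD 2 0) 0) ∈
      bits (atom p.2.1))
  else if p.1.headI = 4 then !(r.getD 0 false)
  else if p.1.headI = 5 then r.getD 0 false && r.getD 1 false
  -- The token `0` poses no queries, so this clause gives the value false for `falsum`.
  else decide (∃ b ∈ r, b = true)

/-- Every query drops at least the leading token. The length of the token list is thus a measure for
the recursion, although the type tree also changes at quantifiers. -/
theorem evalQueries_lt {p p' : EvalState} (h : p' ∈ evalQueries p) :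
    p'.1.length < p.1.length := by
  have hp : p.1 ≠ [] := by
    rintro h0
    simp [evalQueries, h0] at h
  have hl : p.1.tail.length < p.1.length := by
    rw [List.length_tail]
    have := List.length_pos_iff.2 hp
    omega
  have hs := length_skip p.1.tail
  unfold evalQueries at h
  split_ifs at h
  · simp only [List.mem_singleton] at h; subst h; exact hl
  · simp only [List.mem_cons, List.not_mem_nil, or_false] at h
    rcases h with rfl | rfl
    · exact hl
    · exact hs.trans_lt hl
  · obtain ⟨t, _, rfl⟩ := List.mem_map.1 h; exact hl
  · obtain ⟨t, _, rfl⟩ := List.mem_map.1 h; exact hl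
  · simp at h

/-- The truth value of the formula at the beginning of a token list in a structure with the
given type tree. -/
def evalT (p : EvalState) : Bool :=
  evalAnswer p ((evalQueries p).attach.map fun p' => evalT p'.1)
termination_by p.1.length
decreasing_by exact evalQueries_lt p'.2

theorem evalT_eq (p : EvalState) : evalT p = evalAnswer p ((evalQueries p).map evalT) := by
  rw [evalT]
  congr 1
  conv_rhs => rw [← List.attach_map_subtype_val (evalQueries p), List.map_map]
  rfl

theorem primrec_evalQueries : Primrec evalQueries := by
  have hc : ∀ k : ℕ, PrimrecPred fun p : EvalState => p.1.headI = k := fun k =>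
    Primrec.eq.comp (list_headI.comp fst) (const k)
  have ht : Primrec fun p : EvalState => p.1.tail := list_tail.comp fst
  have hk : Primrec fun p : EvalState => kids p.2.1 := primrec_kids.comp (fst.comp snd)
  have hE : Primrec fun p : EvalState => p.2.2.1.map Nat.succ :=
    list_map (fst.comp (snd.comp snd)) (succ.comp snd)
  have hS : Primrec fun p : EvalState => p.2.2.2.map Nat.succ :=
    list_map (snd.comp (snd.comp snd)) (succ.comp snd)
  have hone : PrimrecPred IsOne :=
    (primrec_mem_bits.comp (const (fact 0 0 0)) primrec_atom).and
      (primrec_mem_bits.comp (const (fact 3 0 0)) primrec_atom).not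
  refine Primrec.ite (hc 4) ?_ (Primrec.ite (hc 5) ?_ (Primrec.ite (hc 6) ?_ (Primrec.ite (hc 7)
    ?_ (const []))))
  · exact list_cons.comp (Primrec.pair ht snd) (const [])
  · exact list_cons.comp (Primrec.pair ht snd)
      (list_cons.comp (Primrec.pair (primrec_skip.comp ht) snd) (const []))
  · exact list_map ((listFilter hone).comp hk) (Primrec.pair (ht.comp fst) (Primrec.pair snd
      (Primrec.pair (list_cons.comp (const 0) (hE.comp fst)) (hS.comp fst))))
  · exact list_map hk (Primrec.pair (ht.comp fst) (Primrec.pair snd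
      (Primrec.pair (hE.comp fst) (list_cons.comp (const 0) (hS.comp fst)))))

theorem primrec_evalAnswer : Primrec₂ evalAnswer := by
  have hc : ∀ k : ℕ, PrimrecPred fun x : EvalState × List Bool => x.1.1.headI = k := fun k =>
    Primrec.eq.comp (list_headI.comp (fst.comp fst)) (const k)
  have hn : ∀ k : ℕ, Primrec fun x : EvalState × List Bool => x.1.1.getD k 0 := fun k =>
    (list_getD 0).comp (fst.comp fst) (const k)
  have hE : ∀ k : ℕ, Primrec fun x : EvalState × List Bool => x.1.2.2.1.getD (x.1.1.getD k 0) 0 :=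
    fun k => (list_getD 0).comp (fst.comp (snd.comp (snd.comp fst))) (hn k)
  have hS : ∀ k : ℕ, Primrec fun x : EvalState × List Bool => x.1.2.2.2.getD (x.1.1.getD k 0) 0 :=
    fun k => (list_getD 0).comp (snd.comp (snd.comp (snd.comp fst))) (hn k)
  have ha : Primrec fun x : EvalState × List Bool => atom x.1.2.1 :=
    primrec_atom.comp (fst.comp (snd.comp fst))
  have hr : ∀ k : ℕ, Primrec fun x : EvalState × List Bool => x.2.getD k false := fun k =>
    (list_getD false).comp snd (const k)
  refine Primrec.ite (hc 1) ?_ (Primrec.ite (hc 2) ?_ (Primrec.ite (hc 3) ?_ (Primrec.ite (hc 4)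
    ?_ (Primrec.ite (hc 5) ?_ ?_))))
  · exact (primrec_mem_bits.comp (primrec_fact (const 0) (hE 1) (hE 2)) ha).decide
  · exact (primrec_mem_bits.comp (primrec_fact (const 1) (hE 1) (hE 2)) ha).decide
  · exact (primrec_mem_bits.comp (primrec_fact (const 0) (hE 1) (hS 2)) ha).decide
  · exact Primrec.not.comp (hr 0)
  · exact Primrec.and.comp (hr 0) (hr 1)
  · have h : PrimrecPred fun l : List Bool => ∃ b ∈ l, b = true :=
      PrimrecPred.exists_mem_list (Primrec.eq.comp .id (const true))
    exact (h.comp snd).decide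

theorem primrec_evalT : Primrec evalT :=
  nat_omega_rec' (m := fun p => p.1.length) (l := evalQueries)
    (g := fun p r => some (evalAnswer p r)) _ (list_length.comp fst) primrec_evalQueries
    (option_some.comp primrec_evalAnswer) (fun _ _ h => evalQueries_lt h)
    (fun p => by rw [← evalT_eq])

/-! ### Types of induced subgraphs -/

section Semantics

variable {V : Type*}

/-- `f` is a fact about the traces on `C` of the played sets `P`. -/
def IsFact (G : SimpleGraph V) (C : Finset V) (lab : V → ℕ) (P : List (Finset V)) (f : ℕ) : Prop :=
  (∃ i j, f = fact 0 i j ∧ ∃ v ∈ C, v ∈ P.getD i ∅ ∧ v ∈ P.getD j ∅) ∨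
  (∃ i j, f = fact 1 i j ∧ ∃ v ∈ C, ∃ w ∈ C, v ∈ P.getD i ∅ ∧ w ∈ P.getD j ∅ ∧ G.Adj v w) ∨
  (∃ i, ∃ v ∈ C, v ∈ P.getD i ∅ ∧ f = fact 2 i (lab v)) ∨
  (∃ i, f = fact 3 i 0 ∧ ∃ v ∈ C, ∃ w ∈ C, v ∈ P.getD i ∅ ∧ w ∈ P.getD i ∅ ∧ v ≠ w)

/-- A bound on the facts about variables and labels up to `M`. -/
def factBound (M : ℕ) : ℕ := ((M + 1) ^ 2 + 4) ^ 2

theorem fact_lt {k i j M : ℕ} (hk : k ≤ 3) (hi : i ≤ M) (hj : j ≤ M) :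
    fact k i j < factBound M := by
  have h1 : Nat.pair i j < (M + 1) ^ 2 :=
    (Nat.pair_lt_max_add_one_sq i j).trans_le (Nat.pow_le_pow_left (by omega) 2)
  exact (Nat.pair_lt_max_add_one_sq _ _).trans_le (Nat.pow_le_pow_left (by omega) 2)

open Classical in
/-- The facts about the traces on `C` of the played sets. -/
noncomputable def facts (G : SimpleGraph V) (C : Finset V) (lab : V → ℕ) (P : List (Finset V)) :
    Finset ℕ :=
  (Finset.range (factBound (P.length + C.sup lab))).filter (IsFact G C lab P)

theorem lt_length_of_mem_getD {P : List (Finset V)} {i : ℕ} {v : V} (h : v ∈ P.getD i ∅) :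
    i < P.length := by
  by_contra hi
  rw [List.getD_eq_default _ _ (not_lt.1 hi)] at h
  simp at h

variable {G : SimpleGraph V} {C : Finset V} {lab : V → ℕ} {P : List (Finset V)}

/-- Positions beyond the end of `P` default to the empty set, so a fact mentions only indices below
`P.length` and labels of vertices in `C`. Hence the range in `facts` loses nothing, and type codes
can be bounded independently of the graph. -/
theorem IsFact.lt {f M : ℕ} (hM : ∀ v ∈ C, P.length + lab v ≤ M) (h : IsFact G C lab P f) :
    f < factBound M := by
  rcases h with ⟨i, j, rfl, v, hv, hi, hj⟩ | ⟨i, j, rfl, v, hv, w, hw, hi, hj, _⟩ |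
    ⟨i, v, hv, hi, rfl⟩ | ⟨i, rfl, v, hv, w, _, hi, _⟩
  · have := lt_length_of_mem_getD hi
    have := lt_length_of_mem_getD hj
    have := hM v hv
    exact fact_lt (by omega) (by omega) (by omega)
  · have := lt_length_of_mem_getD hi
    have := lt_length_of_mem_getD hj
    have := hM v hv
    exact fact_lt (by omega) (by omega) (by omega)
  · have := lt_length_of_mem_getD hi
    have := hM v hv
    exact fact_lt (by omega) (by omega) (by omega)
  · have := lt_length_of_mem_getD hi
    have := hM v hv
    exact fact_lt (by omega) (by omega) (by omega)

theorem mem_facts {f : ℕ} : f ∈ facts G C lab P ↔ IsFact G C lab P f := by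
  classical
  rw [facts, Finset.mem_filter, Finset.mem_range, and_iff_right_iff_imp]
  exact IsFact.lt fun v hv => Nat.add_le_add_left (Finset.le_sup hv) _

theorem isFact_zero {i j : ℕ} : IsFact G C lab P (fact 0 i j) ↔
    ∃ v ∈ C, v ∈ P.getD i ∅ ∧ v ∈ P.getD j ∅ := by
  simp only [IsFact, fact_inj]
  constructor
  · rintro (⟨i', j', ⟨-, rfl, rfl⟩, h⟩ | ⟨i', j', ⟨h, -⟩, -⟩ | ⟨i', v, -, -, h, -⟩ | ⟨i', ⟨h, -⟩, -⟩)
    · exact h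
    all_goals omega
  · exact fun h => Or.inl ⟨i, j, by simp, h⟩

theorem isFact_one {i j : ℕ} : IsFact G C lab P (fact 1 i j) ↔
    ∃ v ∈ C, ∃ w ∈ C, v ∈ P.getD i ∅ ∧ w ∈ P.getD j ∅ ∧ G.Adj v w := by
  simp only [IsFact, fact_inj]
  constructor
  · rintro (⟨i', j', ⟨h, -⟩, -⟩ | ⟨i', j', ⟨-, rfl, rfl⟩, h⟩ | ⟨i', v, -, -, h, -⟩ | ⟨i', ⟨h, -⟩, -⟩)
    · omega
    · exact h
    all_goals omega
  · exact fun h => Or.inr (Or.inl ⟨i, j, by simp, h⟩)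

theorem isFact_two {i j : ℕ} : IsFact G C lab P (fact 2 i j) ↔
    ∃ v ∈ C, v ∈ P.getD i ∅ ∧ lab v = j := by
  simp only [IsFact, fact_inj]
  constructor
  · rintro (⟨i', j', ⟨h, -⟩, -⟩ | ⟨i', j', ⟨h, -⟩, -⟩ | ⟨i', v, hv, hi, -, rfl, rfl⟩ |
      ⟨i', ⟨h, -⟩, -⟩)
    · omega
    · omega
    · exact ⟨v, hv, hi, rfl⟩
    · omega
  · rintro ⟨v, hv, hi, rfl⟩
    exact Or.inr (Or.inr (Or.inl ⟨i, v, hv, hi, by simp⟩))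

theorem isFact_three {i j : ℕ} : IsFact G C lab P (fact 3 i j) ↔ j = 0 ∧
    ∃ v ∈ C, ∃ w ∈ C, v ∈ P.getD i ∅ ∧ w ∈ P.getD i ∅ ∧ v ≠ w := by
  simp only [IsFact, fact_inj]
  constructor
  · rintro (⟨i', j', ⟨h, -⟩, -⟩ | ⟨i', j', ⟨h, -⟩, -⟩ | ⟨i', v, -, -, h, -⟩ |
      ⟨i', ⟨-, rfl, rfl⟩, h⟩)
    · omega
    · omega
    · omega
    · exact ⟨rfl, h⟩
  · rintro ⟨rfl, h⟩
    exact Or.inr (Or.inr (Or.inr ⟨i, by simp, h⟩))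

theorem IsFact.kind_le {f : ℕ} (h : IsFact G C lab P f) : kind f ≤ 3 := by
  rcases h with ⟨i, j, rfl, _⟩ | ⟨i, j, rfl, _⟩ | ⟨i, v, _, _, rfl⟩ | ⟨i, rfl, _⟩ <;> simp

/-- To compute the code of the facts it suffices to list the facts of each kind. -/
theorem ofList_eq_facts {l : List ℕ} (hk : ∀ f ∈ l, kind f ≤ 3)
    (h : ∀ k i j, k ≤ 3 → (fact k i j ∈ l ↔ IsFact G C lab P (fact k i j))) :
    ofList l = ofSet (facts G C lab P) := by
  rw [ofList]
  congr 1
  ext f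
  rw [List.mem_toFinset, mem_facts]
  by_cases hf : kind f ≤ 3
  · rw [← fact_eta f]
    exact h _ _ _ hf
  · exact ⟨fun h' => absurd (hk f h') hf, fun h' => absurd h'.kind_le hf⟩

variable [Fintype V]

variable (G C lab)

/-- The type tree of depth `r` of the subgraph induced by `C` with vertex labels `lab` and the
played sets `P`. -/
noncomputable def ty : ℕ → List (Finset V) → ℕ
  | 0, P => Nat.pair (ofSet (facts G C lab P)) (ofSet ∅)
  | r + 1, P => Nat.pair (ofSet (facts G C lab P))
      (ofSet (Finset.univ.image fun X => ty r (X :: P)))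

variable {G C lab}

theorem mem_bits_atom_ty {r f : ℕ} : f ∈ bits (atom (ty G C lab r P)) ↔ IsFact G C lab P f := by
  cases r <;> simp [ty, atom, mem_bits_ofSet, mem_facts]

theorem mem_kids_ty_succ {r x : ℕ} :
    x ∈ kids (ty G C lab (r + 1) P) ↔ ∃ X, ty G C lab r (X :: P) = x := by
  simp [ty, kids, mem_bits_ofSet]

theorem kids_ty_zero : kids (ty G C lab 0 P) = [] := by
  simp [ty, kids, ofSet, bits]

theorem node_eq_ty_zero {l : List ℕ} {a : ℕ} (ha : a = ofSet (facts G C lab P))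
    (hl : ∀ x, x ∉ l) : node a l = ty G C lab 0 P := by
  rw [List.eq_nil_iff_forall_not_mem.2 hl, ha]
  rfl

theorem node_eq_ty_succ {l : List ℕ} {a r : ℕ} (ha : a = ofSet (facts G C lab P))
    (hl : ∀ x, x ∈ l ↔ ∃ X, ty G C lab r (X :: P) = x) : node a l = ty G C lab (r + 1) P := by
  have : l.toFinset = Finset.univ.image fun X => ty G C lab r (X :: P) := by
    ext x; simp [hl]
  rw [node, ofList, this, ha]
  rfl

/-- A bound on the type trees of depth `r` for variables and labels up to `M`. -/
def tyBound (M : ℕ) : ℕ → ℕ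
  | 0 => Nat.pair (2 ^ factBound M) 0
  | r + 1 => Nat.pair (2 ^ factBound M) (2 ^ (tyBound M r + 1))

theorem pair_le_pair {a b a' b' : ℕ} (ha : a ≤ a') (hb : b ≤ b') : Nat.pair a b ≤ Nat.pair a' b' := by
  have h1 : Nat.pair a b ≤ Nat.pair a' b := by
    rcases ha.eq_or_lt with rfl | h
    · exact le_rfl
    · exact (Nat.pair_lt_pair_left b h).le
  have h2 : Nat.pair a' b ≤ Nat.pair a' b' := by
    rcases hb.eq_or_lt with rfl | h
    · exact le_rfl
    · exact (Nat.pair_lt_pair_right a' h).le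
  exact h1.trans h2

/-- Each level plays one more set and has one level less below it, so `P.length + r` stays constant
along the recursion and a single `M` works at all levels. The bound does not involve the number of
vertices. -/
theorem ty_le {M : ℕ} : ∀ {r : ℕ} {P : List (Finset V)},
    (∀ v ∈ C, P.length + r + lab v ≤ M) → ty G C lab r P ≤ tyBound M r
  | 0, P, h => by
    refine pair_le_pair (ofSet_lt fun f hf => ?_).le (by simp [ofSet])
    exact IsFact.lt (fun v hv => h v hv) (mem_facts.1 hf)
  | r + 1, P, h => by
    refine pair_le_pair (ofSet_lt fun f hf => ?_).le (ofSet_lt fun x hx => ?_).le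
    · exact IsFact.lt (fun v hv => by have := h v hv; omega) (mem_facts.1 hf)
    · obtain ⟨X, -, rfl⟩ := Finset.mem_image.1 hx
      exact Nat.lt_succ_of_le (ty_le fun v hv => by
        have := h v hv; simp only [List.length_cons]; omega)

/-- Children range over all subsets of `V`, yet only traces on `C` matter. Hence one set can
represent independent choices on disjoint pieces. -/
theorem ty_congr {lab' : V → ℕ} (hlab : ∀ v ∈ C, lab v = lab' v) :
    ∀ {r : ℕ} {P P' : List (Finset V)}, (∀ i, ∀ v ∈ C, v ∈ P.getD i ∅ ↔ v ∈ P'.getD i ∅) →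
      ty G C lab r P = ty G C lab' r P' := by
  have hf : ∀ {P P' : List (Finset V)}, (∀ i, ∀ v ∈ C, v ∈ P.getD i ∅ ↔ v ∈ P'.getD i ∅) →
      facts G C lab P = facts G C lab' P' := by
    intro P P' h
    ext f
    rw [mem_facts, mem_facts]
    refine or_congr ?_ (or_congr ?_ (or_congr ?_ ?_))
    · refine exists₂_congr fun i j => and_congr_right fun _ => exists_congr fun v =>
        and_congr_right fun hv => ?_
      rw [h i v hv, h j v hv]
    · refine exists₂_congr fun i j => and_congr_right fun _ => exists_congr fun v =>
        and_congr_right fun hv => exists_congr fun w => and_congr_right fun hw => ?_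
      rw [h i v hv, h j w hw]
    · refine exists_congr fun i => exists_congr fun v => and_congr_right fun hv => ?_
      rw [h i v hv, hlab v hv]
    · refine exists_congr fun i => and_congr_right fun _ => exists_congr fun v =>
        and_congr_right fun hv => exists_congr fun w => and_congr_right fun hw => ?_
      rw [h i v hv, h i w hw]
  intro r
  induction r with
  | zero => intro P P' h; rw [ty, ty, hf h]
  | succ r ih =>
    intro P P' h
    rw [ty, ty, hf h]
    congr 2
    ext x
    simp only [Finset.mem_image, Finset.mem_univ, true_and]
    refine exists_congr fun X => ?_
    rw [ih (P := X :: P) (P' := X :: P')]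
    intro i v hv
    cases i with
    | zero => simp
    | succ i => simpa using h i v hv

end Semantics

end TypeCode

/-! ### Correctness of the tree operations and of the evaluation -/

namespace TypeCode

section Semantics

variable {V : Type*} {G : SimpleGraph V} {C : Finset V} {lab : V → ℕ}
  {P : List (Finset V)}

theorem kind_shiftFact (m f : ℕ) : kind (shiftFact m f) = kind f := by
  unfold shiftFact
  split_ifs with h
  · rw [kind_fact, h]
  · rfl

theorem fact_mem_map_shiftFact {l : List ℕ} {m k i j : ℕ} :
    fact k i j ∈ l.map (shiftFact m) ↔
      (k ≠ 2 ∧ fact k i j ∈ l) ∨ (k = 2 ∧ ∃ j', fact 2 i j' ∈ l ∧ j = j' + m) := by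
  rw [List.mem_map]
  constructor
  · rintro ⟨f, hf, h⟩
    unfold shiftFact at h
    split_ifs at h with hk
    · rw [fact_inj] at h
      obtain ⟨rfl, rfl, rfl⟩ := h
      refine Or.inr ⟨rfl, arg₂ f, ?_, rfl⟩
      rwa [← hk, fact_eta]
    · subst h
      exact Or.inl ⟨by simpa using hk, hf⟩
  · rintro (⟨hk, h⟩ | ⟨rfl, j', h, rfl⟩)
    · exact ⟨_, h, by simp [shiftFact, hk]⟩
    · exact ⟨_, h, by simp [shiftFact]⟩

theorem kind_le_of_mem_crossFacts {B f g x : ℕ} (h : x ∈ crossFacts B f g) : kind x ≤ 3 := by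
  unfold crossFacts at h
  split_ifs at h
  · simp only [List.mem_singleton] at h; simp [h]
  · simp only [List.mem_cons, List.not_mem_nil, or_false] at h
    rcases h with rfl | rfl <;> simp
  · simp at h

theorem fact_mem_crossFacts {B k i j : ℕ} {a b : List ℕ} :
    (∃ f ∈ a, ∃ g ∈ b, fact k i j ∈ crossFacts B f g) ↔
      (k = 3 ∧ j = 0 ∧ fact 0 i i ∈ a ∧ fact 0 i i ∈ b) ∨
      (k = 1 ∧ ∃ c c', Nat.pair c c' ∈ bits B ∧
        ((fact 2 i c ∈ a ∧ fact 2 j c' ∈ b) ∨ (fact 2 j c ∈ a ∧ fact 2 i c' ∈ b))) := by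
  constructor
  · rintro ⟨f, hf, g, hg, h⟩
    unfold crossFacts at h
    split_ifs at h with h0 h2
    · obtain ⟨h1, h2, h3, h4, h5⟩ := h0
      rw [List.mem_singleton, fact_inj] at h
      obtain ⟨rfl, rfl, rfl⟩ := h
      refine Or.inl ⟨rfl, rfl, ?_, ?_⟩
      · have := fact_eta f
        rw [h1, ← h3] at this; rwa [this]
      · have := fact_eta g
        rw [h2, ← h4, ← h5] at this; rwa [this]
    · obtain ⟨h3, h4, h5⟩ := h2
      have hf' := fact_eta f
      have hg' := fact_eta g
      rw [h3] at hf'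
      rw [h4] at hg'
      simp only [List.mem_cons, fact_inj, List.not_mem_nil, or_false] at h
      refine Or.inr ?_
      rcases h with ⟨rfl, rfl, rfl⟩ | ⟨rfl, rfl, rfl⟩
      · exact ⟨rfl, _, _, h5, Or.inl ⟨by rwa [hf'], by rwa [hg']⟩⟩
      · exact ⟨rfl, _, _, h5, Or.inr ⟨by rwa [hf'], by rwa [hg']⟩⟩
    · simp at h
  · rintro (⟨rfl, rfl, h1, h2⟩ | ⟨rfl, c, c', hB, ⟨h1, h2⟩ | ⟨h1, h2⟩⟩)
    · exact ⟨_, h1, _, h2, by simp [crossFacts]⟩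
    · exact ⟨_, h1, _, h2, by simp [crossFacts, hB]⟩
    · exact ⟨_, h1, _, h2, by simp [crossFacts, hB]⟩

/-- Facts about a union are inherited from one side, with two exceptions: two elements of a set may
lie on different sides, and an edge may cross. The first needs only that the set meets both sides,
the second is decided by the labels through `B`. -/
theorem unionAtom_eq [DecidableEq V] {C₁ C₂ : Finset V} {lab₁ lab₂ : V → ℕ} {B m a b : ℕ}
    (hB : ∀ x ∈ C₁, ∀ y ∈ C₂, G.Adj x y ↔ Nat.pair (lab₁ x) (lab₂ y) ∈ bits B)
    (hC : Disjoint C₁ C₂)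
    (h₁ : ∀ x ∈ C₁, lab x = lab₁ x) (h₂ : ∀ x ∈ C₂, lab x = lab₂ x + m)
    (ha : ∀ f, f ∈ bits a ↔ IsFact G C₁ lab₁ P f) (hb : ∀ f, f ∈ bits b ↔ IsFact G C₂ lab₂ P f) :
    unionAtom B m a b = ofSet (facts G (C₁ ∪ C₂) lab P) := by
  refine ofList_eq_facts ?_ ?_
  · intro f hf
    simp only [List.mem_append, List.mem_flatMap] at hf
    rcases hf with hf | hf | ⟨g, _, g', _, hf⟩
    · exact ((ha f).1 hf).kind_le
    · obtain ⟨g, hg, rfl⟩ := List.mem_map.1 hf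
      rw [kind_shiftFact]
      exact ((hb g).1 hg).kind_le
    · exact kind_le_of_mem_crossFacts hf
  · intro k i j hk
    rw [List.mem_append, List.mem_append, fact_mem_map_shiftFact]
    simp only [List.mem_flatMap]
    rw [fact_mem_crossFacts]
    simp only [ha, hb]
    have hk' : k = 0 ∨ k = 1 ∨ k = 2 ∨ k = 3 := by omega
    rcases hk' with rfl | rfl | rfl | rfl
    · simp only [isFact_zero]
      simp only [Finset.mem_union]
      constructor
      · rintro (⟨v, hv, h⟩ | ((⟨-, v, hv, h⟩ | ⟨h, -⟩) | (⟨h, -⟩ | ⟨h, -⟩)))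
        · exact ⟨v, Or.inl hv, h⟩
        · exact ⟨v, Or.inr hv, h⟩
        all_goals omega
      · rintro ⟨v, hv | hv, h⟩
        · exact Or.inl ⟨v, hv, h⟩
        · exact Or.inr (Or.inl (Or.inl ⟨by omega, v, hv, h⟩))
    · simp only [isFact_one, isFact_two]
      simp only [Finset.mem_union]
      constructor
      · rintro (⟨v, hv, w, hw, h⟩ | ((⟨-, v, hv, w, hw, h⟩ | ⟨h, -⟩) | (⟨h, -⟩ | ⟨-, c, c', hc, h⟩)))
        · exact ⟨v, Or.inl hv, w, Or.inl hw, h⟩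
        · exact ⟨v, Or.inr hv, w, Or.inr hw, h⟩
        · omega
        · omega
        · rcases h with ⟨⟨v, hv, hi, rfl⟩, w, hw, hj, rfl⟩ | ⟨⟨v, hv, hi, rfl⟩, w, hw, hj, rfl⟩
          · exact ⟨v, Or.inl hv, w, Or.inr hw, hi, hj, (hB v hv w hw).2 hc⟩
          · exact ⟨w, Or.inr hw, v, Or.inl hv, hj, hi, ((hB v hv w hw).2 hc).symm⟩
      · rintro ⟨v, hv | hv, w, hw | hw, hi, hj, h⟩
        · exact Or.inl ⟨v, hv, w, hw, hi, hj, h⟩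
        · exact Or.inr (Or.inr (Or.inr ⟨trivial, _, _, (hB v hv w hw).1 h,
            Or.inl ⟨⟨v, hv, hi, rfl⟩, w, hw, hj, rfl⟩⟩))
        · exact Or.inr (Or.inr (Or.inr ⟨trivial, _, _, (hB w hw v hv).1 h.symm,
            Or.inr ⟨⟨w, hw, hj, rfl⟩, v, hv, hi, rfl⟩⟩))
        · exact Or.inr (Or.inl (Or.inl ⟨by omega, v, hv, w, hw, hi, hj, h⟩))
    · simp only [isFact_two]
      simp only [Finset.mem_union]
      constructor
      · rintro (⟨v, hv, hi, rfl⟩ | ((⟨h, -⟩ | ⟨-, j', ⟨v, hv, hi, rfl⟩, rfl⟩) | (⟨h, -⟩ | ⟨h, -⟩)))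
        · exact ⟨v, Or.inl hv, hi, h₁ v hv⟩
        · omega
        · exact ⟨v, Or.inr hv, hi, h₂ v hv⟩
        · omega
        · omega
      · rintro ⟨v, hv | hv, hi, rfl⟩
        · exact Or.inl ⟨v, hv, hi, (h₁ v hv).symm⟩
        · exact Or.inr (Or.inl (Or.inr ⟨trivial, _, ⟨v, hv, hi, rfl⟩, h₂ v hv⟩))
    · simp only [isFact_three, isFact_zero]
      simp only [Finset.mem_union]
      constructor
      · rintro (⟨h0, v, hv, w, hw, h⟩ | ((⟨-, h0, v, hv, w, hw, h⟩ | ⟨h, -⟩) |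
          (⟨-, h0, ⟨v, hv, hi, -⟩, w, hw, hj, -⟩ | ⟨h, -⟩)))
        · exact ⟨h0, v, Or.inl hv, w, Or.inl hw, h⟩
        · exact ⟨h0, v, Or.inr hv, w, Or.inr hw, h⟩
        · omega
        · refine ⟨h0, v, Or.inl hv, w, Or.inr hw, hi, hj, ?_⟩
          rintro rfl
          exact Finset.disjoint_left.1 hC hv hw
        · omega
      · rintro ⟨h0, v, hv | hv, w, hw | hw, hi, hj, h⟩
        · exact Or.inl ⟨h0, v, hv, w, hw, hi, hj, h⟩
        · exact Or.inr (Or.inr (Or.inl ⟨trivial, h0, ⟨v, hv, hi, hi⟩, w, hw, hj, hj⟩))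
        · exact Or.inr (Or.inr (Or.inl ⟨trivial, h0, ⟨w, hw, hj, hj⟩, v, hv, hi, hi⟩))
        · exact Or.inr (Or.inl (Or.inl ⟨by omega, h0, v, hv, w, hw, hi, hj, h⟩))

/-- This is the composition theorem on the level of codes: choosing a set in the union amounts to
choosing its two traces independently, which is why `unionT` pairs all children. -/
theorem unionT_ty [Fintype V] [DecidableEq V] {C₁ C₂ : Finset V} {lab₁ lab₂ : V → ℕ} {B m : ℕ}
    (hB : ∀ x ∈ C₁, ∀ y ∈ C₂, G.Adj x y ↔ Nat.pair (lab₁ x) (lab₂ y) ∈ bits B)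
    (hC : Disjoint C₁ C₂)
    (h₁ : ∀ x ∈ C₁, lab x = lab₁ x) (h₂ : ∀ x ∈ C₂, lab x = lab₂ x + m) :
    ∀ (r : ℕ) (P : List (Finset V)),
      unionT B m (ty G C₁ lab₁ r P) (ty G C₂ lab₂ r P) = ty G (C₁ ∪ C₂) lab r P
  | 0, P => by
    rw [unionT_eq]
    refine node_eq_ty_zero (unionAtom_eq hB hC h₁ h₂ (fun f => mem_bits_atom_ty)
      (fun f => mem_bits_atom_ty)) ?_
    simp [kids_ty_zero]
  | r + 1, P => by
    rw [unionT_eq]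
    refine node_eq_ty_succ (unionAtom_eq hB hC h₁ h₂ (fun f => mem_bits_atom_ty)
      (fun f => mem_bits_atom_ty)) fun x => ?_
    simp only [List.mem_flatMap, List.mem_map, mem_kids_ty_succ]
    constructor
    · rintro ⟨_, ⟨X, rfl⟩, _, ⟨Y, rfl⟩, rfl⟩
      -- This set has the trace of `X` on `C₁` and that of `Y` on `C₂`.
      refine ⟨(X ∩ C₁) ∪ (Y ∩ C₂), ?_⟩
      rw [← unionT_ty hB hC h₁ h₂ r]
      congr 1
      · refine ty_congr (fun _ _ => rfl) fun i v hv => ?_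
        cases i with
        | zero =>
          have := Finset.disjoint_left.1 hC hv
          simp [hv, this]
        | succ i => simp
      · refine ty_congr (fun _ _ => rfl) fun i v hv => ?_
        cases i with
        | zero =>
          have := Finset.disjoint_right.1 hC hv
          simp [hv, this]
        | succ i => simp
    · rintro ⟨X, rfl⟩
      exact ⟨_, ⟨X, rfl⟩, _, ⟨X, rfl⟩, unionT_ty hB hC h₁ h₂ r (X :: P)⟩

theorem relabelAtom_eq {a b x : ℕ} (hx : ∀ f, f ∈ bits x ↔ IsFact G C lab P f) :
    ofList ((bits x).map (relabelFact a b)) =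
      ofSet (facts G C (fun v => if lab v = a then b else lab v) P) := by
  have hkind : ∀ f, kind (relabelFact a b f) = kind f := by
    intro f
    unfold relabelFact
    split_ifs with h
    · rw [kind_fact, h.1]
    · rfl
  have hmem : ∀ k i j, fact k i j ∈ (bits x).map (relabelFact a b) ↔
      (k ≠ 2 ∧ fact k i j ∈ bits x) ∨
      (k = 2 ∧ ∃ j', fact 2 i j' ∈ bits x ∧ (if j' = a then b else j') = j) := by
    intro k i j
    rw [List.mem_map]
    constructor
    · rintro ⟨f, hf, h⟩
      have hf' := fact_eta f
      unfold relabelFact at h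
      split_ifs at h with hk
      · rw [fact_inj] at h
        obtain ⟨rfl, rfl, rfl⟩ := h
        rw [hk.1, hk.2] at hf'
        exact Or.inr ⟨rfl, a, by rwa [hf'], by simp⟩
      · subst h
        simp only [kind_fact, arg₂_fact, not_and] at hk
        by_cases h2 : k = 2
        · subst h2
          exact Or.inr ⟨rfl, j, hf, by simp [hk rfl]⟩
        · exact Or.inl ⟨h2, hf⟩
    · rintro (⟨hk, h⟩ | ⟨rfl, j', h, rfl⟩)
      · exact ⟨_, h, by simp [relabelFact, hk]⟩
      · refine ⟨_, h, ?_⟩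
        by_cases hj : j' = a <;> simp [relabelFact, hj]
  refine ofList_eq_facts ?_ ?_
  · intro f hf
    obtain ⟨g, hg, rfl⟩ := List.mem_map.1 hf
    rw [hkind]
    exact ((hx g).1 hg).kind_le
  · intro k i j hk
    rw [hmem]
    simp only [hx]
    have hk' : k = 0 ∨ k = 1 ∨ k = 2 ∨ k = 3 := by omega
    rcases hk' with rfl | rfl | rfl | rfl
    · simp [isFact_zero]
    · simp [isFact_one]
    · simp only [isFact_two]
      constructor
      · rintro (⟨h, -⟩ | ⟨-, j', ⟨v, hv, hi, rfl⟩, h⟩)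
        · omega
        · exact ⟨v, hv, hi, h⟩
      · rintro ⟨v, hv, hi, h⟩
        exact Or.inr ⟨trivial, _, ⟨v, hv, hi, rfl⟩, h⟩
    · simp [isFact_three]

theorem relabelT_ty [Fintype V] (a b : ℕ) : ∀ (r : ℕ) (P : List (Finset V)),
    relabelT a b (ty G C lab r P) = ty G C (fun v => if lab v = a then b else lab v) r P
  | 0, P => by
    rw [relabelT_eq]
    exact node_eq_ty_zero (relabelAtom_eq fun f => mem_bits_atom_ty) (by simp [kids_ty_zero])
  | r + 1, P => by
    rw [relabelT_eq]
    refine node_eq_ty_succ (relabelAtom_eq fun f => mem_bits_atom_ty) fun x => ?_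
    simp only [List.mem_map, mem_kids_ty_succ]
    constructor
    · rintro ⟨_, ⟨X, rfl⟩, rfl⟩
      exact ⟨X, (relabelT_ty a b r (X :: P)).symm⟩
    · rintro ⟨X, rfl⟩
      exact ⟨_, ⟨X, rfl⟩, relabelT_ty a b r (X :: P)⟩

theorem leafAtom_eq {u : V} {N : List Bool} (hl : lab u = 0)
    (hN : ∀ i, N.getD i false = true ↔ u ∈ P.getD i ∅) :
    leafAtom N = ofSet (facts G {u} lab P) := by
  have hmem : ∀ f, f ∈ ((List.range N.length).flatMap fun i =>
      (List.range N.length).flatMap fun j =>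
        if N.getD i false = true ∧ N.getD j false = true then [fact 0 i j, fact 2 i 0] else []) ↔
      ∃ i j, u ∈ P.getD i ∅ ∧ u ∈ P.getD j ∅ ∧ (f = fact 0 i j ∨ f = fact 2 i 0) := by
    have hlt : ∀ i, u ∈ P.getD i ∅ → i < N.length := by
      intro i hi
      by_contra h
      rw [← hN, List.getD_eq_default _ _ (not_lt.1 h)] at hi
      simp at hi
    intro f
    simp only [List.mem_flatMap, List.mem_range, hN]
    constructor
    · rintro ⟨i, _, j, _, h⟩
      split_ifs at h with h'
      · exact ⟨i, j, (hN i).1 h'.1, (hN j).1 h'.2, by simpa using h⟩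
      · simp at h
    · rintro ⟨i, j, hi, hj, h⟩
      exact ⟨i, hlt i hi, j, hlt j hj, by rw [if_pos ⟨(hN i).2 hi, (hN j).2 hj⟩]; simpa using h⟩
  refine ofList_eq_facts ?_ ?_
  · intro f hf
    obtain ⟨i, j, _, _, rfl | rfl⟩ := (hmem f).1 hf <;> simp
  · intro k i j hk
    rw [hmem]
    simp only [fact_inj]
    have hk' : k = 0 ∨ k = 1 ∨ k = 2 ∨ k = 3 := by omega
    rcases hk' with rfl | rfl | rfl | rfl
    · simp only [isFact_zero, Finset.mem_singleton, exists_eq_left]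
      constructor
      · rintro ⟨i', j', hi, hj, ⟨-, rfl, rfl⟩ | ⟨h, -⟩⟩
        · exact ⟨hi, hj⟩
        · omega
      · rintro ⟨hi, hj⟩
        exact ⟨i, j, hi, hj, by simp⟩
    · simp [isFact_one]
    · simp only [isFact_two, Finset.mem_singleton, exists_eq_left, hl]
      constructor
      · rintro ⟨i', j', hi, hj, ⟨h, -⟩ | ⟨-, rfl, rfl⟩⟩
        · omega
        · exact ⟨hi, rfl⟩
      · rintro ⟨hi, rfl⟩
        exact ⟨i, i, hi, hi, by simp⟩
    · simp only [isFact_three, Finset.mem_singleton, exists_eq_left]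
      simp

/-- On one vertex a set has only two possible traces, represented by `{u}` and `∅`; these give the
two children in `leafT`. -/
theorem leafT_eq_ty [Fintype V] {u : V} (hl : lab u = 0) : ∀ (r : ℕ) (N : List Bool) (P : List (Finset V)),
    (∀ i, N.getD i false = true ↔ u ∈ P.getD i ∅) → leafT r N = ty G {u} lab r P
  | 0, N, P, h => node_eq_ty_zero (leafAtom_eq hl h) (by simp)
  | r + 1, N, P, h => by
    have h' : ∀ (b : Bool) (X : Finset V), (b = true ↔ u ∈ X) →
        leafT r (b :: N) = ty G {u} lab r (X :: P) := by
      intro b X hb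
      refine leafT_eq_ty hl r _ _ fun i => ?_
      cases i with
      | zero => simpa using hb
      | succ i => simpa using h i
    refine node_eq_ty_succ (leafAtom_eq hl h) fun x => ?_
    simp only [List.mem_cons, List.not_mem_nil, or_false]
    constructor
    · rintro (rfl | rfl)
      · exact ⟨{u}, (h' true {u} (by simp)).symm⟩
      · exact ⟨∅, (h' false ∅ (by simp)).symm⟩
    · rintro ⟨X, rfl⟩
      by_cases hu : u ∈ X
      · exact Or.inl (h' true X (by simp [hu])).symm
      · exact Or.inr (h' false X (by simp [hu])).symm

theorem isOne_ty [Fintype V] {r : ℕ} {X : Finset V} :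
    IsOne (ty G Finset.univ lab r (X :: P)) ↔ ∃ v, X = {v} := by
  simp only [IsOne, mem_bits_atom_ty, isFact_zero, isFact_three, Finset.mem_univ, true_and,
    List.getD_cons_zero, and_self]
  rw [← Finset.card_eq_one]
  constructor
  · rintro ⟨⟨v, hv⟩, h⟩
    refine Finset.card_eq_one.2 ⟨v, Finset.eq_singleton_iff_unique_mem.2 ⟨hv, fun w hw => ?_⟩⟩
    by_contra hne
    exact h ⟨w, v, hw, hv, hne⟩
  · intro h
    obtain ⟨v, rfl⟩ := Finset.card_eq_one.1 h
    refine ⟨⟨v, by simp⟩, ?_⟩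
    rintro ⟨w, w', hw, hw', hne⟩
    simp only [Finset.mem_singleton] at hw hw'
    exact hne (hw.trans hw'.symm)

/-- First-order and set variables are both interpreted by played sets; `vE` and `vS` give their
positions in `P`, and a vertex variable is interpreted by a singleton. The tokens `l` after the
formula are left arbitrary, as needed for the first half of a conjunction. -/
theorem evalT_ty [Fintype V] {e s : ℕ} (φ : MSO Empty e s) :
    ∀ (r : ℕ) (P : List (Finset V)) (vE vS l : List ℕ) (a : Fin e → V) (S : Fin s → Set V),
      φ.rank ≤ r → vE.length = e → vS.length = s →
      (∀ x : Fin e, P.getD (vE.getD x 0) ∅ = {a x}) →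
      (∀ X : Fin s, ∀ v, v ∈ P.getD (vS.getD X 0) ∅ ↔ v ∈ S X) →
      (evalT (φ.encode ++ l, ty G Finset.univ lab r P, vE, vS) = true ↔
        φ.Sat G.toStructure a S) := by
  -- A newly played set goes to the front of `P`, so all earlier positions are shifted by one.
  have hmap : ∀ (X : Finset V) (P : List (Finset V)) (vs : List ℕ) (x : ℕ), x < vs.length →
      (X :: P).getD ((vs.map Nat.succ).getD x 0) ∅ = P.getD (vs.getD x 0) ∅ := by
    intro X P vs x hx
    have h1 : (vs.map Nat.succ).getD x 0 = vs.getD x 0 + 1 := by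
      simp [List.getD_eq_getElem?_getD, hx]
    rw [h1, List.getD_cons_succ]
  induction φ with
  | falsum =>
    intro r P vE vS l a S _ _ _ _ _
    rw [evalT_eq]
    simp [MSO.encode, MSO.Sat, evalAnswer, evalQueries]
  | eq x y =>
    intro r P vE vS l a S _ _ _ hE _
    rw [evalT_eq]
    change evalAnswer (1 :: (x : ℕ) :: (y : ℕ) :: l, ty G Finset.univ lab r P, vE, vS) _ = true ↔ _
    simp [MSO.Sat, evalAnswer, mem_bits_atom_ty, isFact_zero]
    simp only [← List.getD_eq_getElem?_getD, hE]
    simp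
  | edge x y =>
    intro r P vE vS l a S _ _ _ hE _
    rw [evalT_eq]
    change evalAnswer (2 :: (x : ℕ) :: (y : ℕ) :: l, ty G Finset.univ lab r P, vE, vS) _ = true ↔ _
    simp [MSO.Sat, evalAnswer, mem_bits_atom_ty, isFact_one]
    simp only [← List.getD_eq_getElem?_getD, hE]
    simp [SimpleGraph.toStructure]
  | lab c => exact c.elim
  | mem x X =>
    intro r P vE vS l a S _ _ _ hE hS
    rw [evalT_eq]
    change evalAnswer (3 :: (x : ℕ) :: (X : ℕ) :: l, ty G Finset.univ lab r P, vE, vS) _ = true ↔ _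
    simp [MSO.Sat, evalAnswer, mem_bits_atom_ty, isFact_zero]
    simp only [← List.getD_eq_getElem?_getD, hE, hS]
    simp
  | neg φ ih =>
    intro r P vE vS l a S hr he hs hE hS
    rw [evalT_eq]
    have := ih r P vE vS l a S hr he hs hE hS
    simp only [MSO.encode, MSO.Sat, evalAnswer, evalQueries]
    simp [← this]
  | conj φ ψ ih₁ ih₂ =>
    intro r P vE vS l a S hr he hs hE hS
    rw [evalT_eq]
    simp only [MSO.rank, max_le_iff] at hr
    have h₁ := ih₁ r P vE vS (ψ.encode ++ l) a S hr.1 he hs hE hS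
    have h₂ := ih₂ r P vE vS l a S hr.2 he hs hE hS
    simp only [MSO.encode, MSO.Sat, evalAnswer, evalQueries]
    simp [← h₁, ← h₂, skip_encode_append]
  | exVertex φ ih =>
    intro r P vE vS l a S hr he hs hE hS
    rw [evalT_eq]
    obtain ⟨r, rfl⟩ : ∃ r', r = r' + 1 := ⟨r - 1, by simp only [MSO.rank] at hr; omega⟩
    have key : ∀ v, evalT (φ.encode ++ l, ty G Finset.univ lab r ({v} :: P),
        0 :: vE.map Nat.succ, vS.map Nat.succ) = true ↔
        φ.Sat G.toStructure (Fin.cons v a) S := by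
      intro v
      refine ih r _ _ _ l _ _ (by simpa [MSO.rank] using hr) (by simp [he]) (by simp [hs]) ?_ ?_
      · intro x
        refine Fin.cases ?_ (fun x => ?_) x
        · simp
        · simp only [Fin.val_succ, List.getD_cons_succ, Fin.cons_succ]
          rw [hmap _ _ _ _ (by omega), hE]
      · intro X v
        rw [hmap _ _ _ _ (by omega), hS]
    simp only [MSO.encode, MSO.Sat, evalAnswer, evalQueries]
    simp only [← key]
    simp only [List.cons_append, List.headI_cons, List.mem_map]
    norm_num
    simp only [mem_kids_ty_succ, moveVertex]
    constructor
    -- A child that passes the filter `IsOne` comes from a singleton, so the surviving set moves are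
    -- exactly the vertex moves.
    · rintro ⟨_, ⟨⟨X, rfl⟩, h1⟩, h⟩
      obtain ⟨v, rfl⟩ := isOne_ty.1 h1
      exact ⟨v, h⟩
    · rintro ⟨v, h⟩
      exact ⟨_, ⟨⟨{v}, rfl⟩, isOne_ty.2 ⟨v, rfl⟩⟩, h⟩
  | exSet φ ih =>
    intro r P vE vS l a S hr he hs hE hS
    rw [evalT_eq]
    obtain ⟨r, rfl⟩ : ∃ r', r = r' + 1 := ⟨r - 1, by simp only [MSO.rank] at hr; omega⟩
    have key : ∀ X : Finset V, evalT (φ.encode ++ l, ty G Finset.univ lab r (X :: P),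
        vE.map Nat.succ, 0 :: vS.map Nat.succ) = true ↔
        φ.Sat G.toStructure a (Fin.cons (X : Set V) S) := by
      intro X
      refine ih r _ _ _ l _ _ (by simpa [MSO.rank] using hr) (by simp [he]) (by simp [hs]) ?_ ?_
      · intro x
        rw [hmap _ _ _ _ (by omega), hE]
      · intro Y
        refine Fin.cases ?_ (fun Y => ?_) Y
        · simp
        · simp only [Fin.val_succ, List.getD_cons_succ, Fin.cons_succ]
          rw [hmap _ _ _ _ (by omega)]
          exact hS Y
    have hset : (∃ X : Set V, φ.Sat G.toStructure a (Fin.cons X S)) ↔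
        ∃ X : Finset V, φ.Sat G.toStructure a (Fin.cons (X : Set V) S) := by
      classical
      constructor
      · rintro ⟨X, h⟩
        exact ⟨X.toFinset, by simpa using h⟩
      · rintro ⟨X, h⟩
        exact ⟨_, h⟩
    simp only [MSO.encode, MSO.Sat, evalAnswer, evalQueries]
    rw [hset]
    simp only [← key]
    simp only [List.cons_append, List.headI_cons, List.mem_map]
    norm_num
    simp only [mem_kids_ty_succ, moveSet]
    constructor
    · rintro ⟨_, ⟨X, rfl⟩, h⟩
      exact ⟨X, h⟩
    · rintro ⟨X, h⟩
      exact ⟨_, ⟨X, rfl⟩, h⟩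

theorem rank_le_size {e s : ℕ} (φ : MSO Empty e s) : φ.rank ≤ φ.size := by
  induction φ with
  | lab c => exact c.elim
  | conj φ ψ h₁ h₂ => simp only [MSO.size, MSO.encode, MSO.rank, List.length_cons,
      List.length_append] at *; omega
  | _ => simp only [MSO.size, MSO.encode, MSO.rank, List.length_cons] at *; omega

theorem evalT_ty_sentence [Fintype V] (φ : MSO Empty 0 0) :
    evalT (φ.encode, ty G Finset.univ lab φ.size [], [], []) = true ↔ G.toStructure.Models φ := by
  have := evalT_ty (G := G) (lab := lab) φ φ.size [] [] [] [] Fin.elim0 Fin.elim0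
    (rank_le_size φ) rfl rfl (fun x => x.elim0) (fun x => x.elim0)
  rwa [List.append_nil] at this

/-- Connective symbols are at most `7`, and variable indices are below the number of free variables.
A quantifier frees one variable in its scope but the scope is one symbol shorter, so the bound
passes through the induction. -/
theorem encode_le {e s : ℕ} (φ : MSO Empty e s) : ∀ x ∈ φ.encode, x ≤ e + s + φ.size + 7 := by
  induction φ with
  | lab c => exact c.elim
  | conj φ ψ h₁ h₂ =>
    intro x hx
    simp only [MSO.size, MSO.encode, List.length_cons, List.length_append, List.mem_cons,
      List.mem_append] at *
    rcases hx with rfl | hx | hx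
    · omega
    · have := h₁ x hx; omega
    · have := h₂ x hx; omega
  | neg φ h | exVertex φ h | exSet φ h =>
    intro x hx
    simp only [MSO.size, MSO.encode, List.length_cons, List.mem_cons] at *
    rcases hx with rfl | hx
    · omega
    · have := h x hx; omega
  | falsum =>
    intro x hx
    simp only [MSO.encode, List.mem_cons, List.not_mem_nil, or_false] at hx
    omega
  | eq y z | edge y z | mem y z =>
    intro x hx
    simp only [MSO.encode, List.mem_cons, List.not_mem_nil, or_false] at hx
    have := y.2
    have := z.2
    omega

end Semantics

end TypeCode

namespace RAM

/-! ### Structured programs -/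

/-- Structured programs. The memory cell `1` is never written to, so that it always contains `0`
and can be used for unconditional jumps. -/
inductive Cmd
  | op (i : Instr)
  | seq (c₁ c₂ : Cmd)
  /-- `c₁` if the cell `r` contains `0`, and `c₂` otherwise -/
  | ifz (r : ℕ) (c₁ c₂ : Cmd)
  /-- repeat `c` until the cell `r` contains `0` -/
  | loop (r : ℕ) (c : Cmd)

namespace Cmd

notation:65 c₁:66 ";;" c₂:65 => Cmd.seq c₁ c₂

/-- The length of the compiled program. -/
def size : Cmd → ℕ
  | op _ => 1
  | seq c₁ c₂ => c₁.size + c₂.size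
  | ifz _ c₁ c₂ => c₁.size + c₂.size + 2
  | loop _ c => c.size + 2

/-- The machine program, to be placed at the address `L`. -/
def compile : Cmd → ℕ → List Instr
  | op i, _ => [i]
  | seq c₁ c₂, L => c₁.compile L ++ c₂.compile (L + c₁.size)
  -- The branch for a nonzero cell stands first and ends with a jump over the other branch; that
  -- jump is unconditional because cell `1` contains `0`.
  | ifz r c₁ c₂, L => .jumpZero r (L + c₂.size + 2) :: (c₂.compile (L + 1) ++
      .jumpZero 1 (L + c₁.size + c₂.size + 2) :: c₁.compile (L + c₂.size + 2))
  | loop r c, L => .jumpZero r (L + c.size + 2) :: (c.compile (L + 1) ++ [.jumpZero 1 L])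

theorem length_compile (c : Cmd) : ∀ L, (c.compile L).length = c.size := by
  induction c with
  | op => intro L; rfl
  | seq c₁ c₂ h₁ h₂ => intro L; simp [compile, size, h₁, h₂]
  | ifz r c₁ c₂ h₁ h₂ => intro L; simp [compile, size, h₁, h₂]; omega
  | loop r c h => intro L; simp [compile, size, h]

end Cmd

/-- The cell written by an instruction that is not a jump, and its new value. -/
def effect (inp : List ℕ) (m : ℕ → ℕ) : Instr → Option (ℕ × ℕ)
  | .const r k => some (r, k)
  | .add r s t => some (r, m s + m t)
  | .sub r s t => some (r, m s - m t)
  | .load r s => some (r, m (m s))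
  | .store r s => some (m r, m s)
  | .read r s => some (r, inp.getD (m s) 0)
  | .jumpZero _ _ => none

/-- Big-step semantics with the number of machine steps; all values written are at most `N`. -/
inductive Big (inp : List ℕ) (N : ℕ) : Cmd → (ℕ → ℕ) → (ℕ → ℕ) → ℕ → Prop
  | op {i m a x} : effect inp m i = some (a, x) → x ≤ N → a ≠ 1 →
      Big inp N (.op i) m (Function.update m a x) 1
  | seq {c₁ c₂ m m₁ m₂ t₁ t₂} : Big inp N c₁ m m₁ t₁ → Big inp N c₂ m₁ m₂ t₂ →
      Big inp N (.seq c₁ c₂) m m₂ (t₁ + t₂)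
  -- One step is the test; the nonzero branch pays a second step for the jump over the other branch.
  | ifz_zero {r c₁ c₂ m m' t} : m r = 0 → Big inp N c₁ m m' t →
      Big inp N (.ifz r c₁ c₂) m m' (t + 1)
  | ifz_pos {r c₁ c₂ m m' t} : m r ≠ 0 → Big inp N c₂ m m' t →
      Big inp N (.ifz r c₁ c₂) m m' (t + 2)
  | loop_zero {r c m} : m r = 0 → Big inp N (.loop r c) m m 1
  | loop_pos {r c m m₁ m₂ t₁ t₂} : m r ≠ 0 → Big inp N c m m₁ t₁ →
      Big inp N (.loop r c) m₁ m₂ t₂ → Big inp N (.loop r c) m m₂ (t₁ + t₂ + 2)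

/-- From `σ` the program reaches `σ'` in `t` steps, with all numbers in the memory at most `N`. -/
def Reaches (prog : List Instr) (inp : List ℕ) (N : ℕ) (σ σ' : State) (t : ℕ) : Prop :=
  (step prog inp)^[t] σ = σ' ∧ ∀ t' ≤ t, ∀ a, ((step prog inp)^[t'] σ).mem a ≤ N

theorem Reaches.trans {prog inp N σ₁ σ₂ σ₃ t₁ t₂} (h₁ : Reaches prog inp N σ₁ σ₂ t₁)
    (h₂ : Reaches prog inp N σ₂ σ₃ t₂) : Reaches prog inp N σ₁ σ₃ (t₁ + t₂) := by
  refine ⟨?_, fun t' ht' a => ?_⟩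
  · rw [add_comm, Function.iterate_add_apply, h₁.1, h₂.1]
  · rcases le_total t' t₁ with h | h
    · exact h₁.2 t' h a
    · obtain ⟨k, rfl⟩ := Nat.exists_eq_add_of_le h
      rw [add_comm t₁ k, Function.iterate_add_apply, h₁.1]
      exact h₂.2 k (by omega) a

theorem Reaches.one {prog inp N} {σ : State} (h : ∀ a, σ.mem a ≤ N)
    (h' : ∀ a, (step prog inp σ).mem a ≤ N) : Reaches prog inp N σ (step prog inp σ) 1 := by
  refine ⟨rfl, fun t' ht' a => ?_⟩
  interval_cases t'
  · exact h a
  · exact h' a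

theorem step_eq {prog inp} {σ : State} {i : Instr} (h : prog[σ.pc]? = some i) :
    step prog inp σ = exec inp σ i := by
  rw [step, h]

theorem exec_eq_of_effect {inp : List ℕ} {σ : State} {i : Instr} {a x : ℕ}
    (h : effect inp σ.mem i = some (a, x)) :
    exec inp σ i = ⟨σ.pc + 1, Function.update σ.mem a x⟩ := by
  cases i <;> simp only [effect, Option.some.injEq, Prod.mk.injEq, reduceCtorEq] at h <;>
    obtain ⟨rfl, rfl⟩ := h <;> rfl

theorem reaches_jump_zero {prog inp N r k pc m} (h : prog[pc]? = some (.jumpZero r k))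
    (hm : ∀ a, m a ≤ N) (hr : m r = 0) : Reaches prog inp N ⟨pc, m⟩ ⟨k, m⟩ 1 := by
  have hs : step prog inp ⟨pc, m⟩ = ⟨k, m⟩ := by
    rw [step_eq (σ := ⟨pc, m⟩) h]
    simp [exec, hr]
  have := Reaches.one (prog := prog) (inp := inp) (σ := ⟨pc, m⟩) hm (by rw [hs]; exact hm)
  rwa [hs] at this

theorem reaches_jump_pos {prog inp N r k pc m} (h : prog[pc]? = some (.jumpZero r k))
    (hm : ∀ a, m a ≤ N) (hr : m r ≠ 0) : Reaches prog inp N ⟨pc, m⟩ ⟨pc + 1, m⟩ 1 := by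
  have hs : step prog inp ⟨pc, m⟩ = ⟨pc + 1, m⟩ := by
    rw [step_eq (σ := ⟨pc, m⟩) h]
    simp [exec, hr]
  have := Reaches.one (prog := prog) (inp := inp) (σ := ⟨pc, m⟩) hm (by rw [hs]; exact hm)
  rwa [hs] at this

/-- The compiled program simulates the big-step semantics. -/
theorem Big.reaches {inp : List ℕ} {N : ℕ} {c : Cmd} {m m' : ℕ → ℕ} {t : ℕ}
    (h : Big inp N c m m' t) : m 1 = 0 → (∀ a, m a ≤ N) →
      m' 1 = 0 ∧ (∀ a, m' a ≤ N) ∧ ∀ pre post : List Instr,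
        Reaches (pre ++ (c.compile pre.length ++ post)) inp N ⟨pre.length, m⟩
          ⟨pre.length + c.size, m'⟩ t := by
  induction h with
  | @op i m a x he hx ha =>
    intro h1 hN
    have hN' : ∀ b, Function.update m a x b ≤ N := by
      intro b
      by_cases hb : b = a
      · subst hb; simpa using hx
      · simpa [hb] using hN b
    refine ⟨by simpa [ha.symm] using h1, hN', fun pre post => ?_⟩
    have hs : step (pre ++ ((Cmd.op i).compile pre.length ++ post)) inp ⟨pre.length, m⟩ =
        ⟨pre.length + 1, Function.update m a x⟩ := by
      rw [step_eq (i := i) (by simp [Cmd.compile]), exec_eq_of_effect he]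
    have := Reaches.one (inp := inp) (prog := pre ++ ((Cmd.op i).compile pre.length ++ post))
      (σ := ⟨pre.length, m⟩) hN (by rw [hs]; exact hN')
    rwa [hs] at this
  | @seq c₁ c₂ m m₁ m₂ t₁ t₂ _ _ ih₁ ih₂ =>
    intro h1 hN
    obtain ⟨h1', hN', hr⟩ := ih₁ h1 hN
    obtain ⟨h1'', hN'', hr'⟩ := ih₂ h1' hN'
    refine ⟨h1'', hN'', fun pre post => ?_⟩
    -- Each half of the program is run inside the whole, with the other half counted to the
    -- surrounding code. Jumps are absolute, which is why the induction quantifies over `pre` and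
    -- `post`.
    have e₁ := hr pre (c₂.compile (pre.length + c₁.size) ++ post)
    have e₂ := hr' (pre ++ c₁.compile pre.length) post
    simp only [List.length_append, Cmd.length_compile, List.append_assoc] at e₁ e₂
    simp only [Cmd.compile, Cmd.size, List.append_assoc, ← add_assoc]
    exact e₁.trans e₂
  | @ifz_zero r c₁ c₂ m m' t hr _ ih =>
    intro h1 hN
    obtain ⟨h1', hN', hc⟩ := ih h1 hN
    refine ⟨h1', hN', fun pre post => ?_⟩
    have e₂ := hc (pre ++ (.jumpZero r (pre.length + c₂.size + 2) ::
      (c₂.compile (pre.length + 1) ++ [.jumpZero 1 (pre.length + c₁.size + c₂.size + 2)]))) post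
    have hl : (pre ++ (Instr.jumpZero r (pre.length + c₂.size + 2) ::
      (c₂.compile (pre.length + 1) ++
        [.jumpZero 1 (pre.length + c₁.size + c₂.size + 2)]))).length =
        pre.length + c₂.size + 2 := by
      simp [Cmd.length_compile]; omega
    rw [hl] at e₂
    have e₁ : Reaches (pre ++ ((Cmd.ifz r c₁ c₂).compile pre.length ++ post)) inp N
        ⟨pre.length, m⟩ ⟨pre.length + c₂.size + 2, m⟩ 1 :=
      reaches_jump_zero (r := r) (by simp [Cmd.compile]) hN hr
    have e₃ := e₁.trans (t₂ := t) (σ₃ := ⟨pre.length + c₂.size + 2 + c₁.size, m'⟩)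
      (by simpa [Cmd.compile] using e₂)
    rw [add_comm t 1]
    convert e₃ using 2
    simp only [Cmd.size]; omega
  | @ifz_pos r c₁ c₂ m m' t hr _ ih =>
    intro h1 hN
    obtain ⟨h1', hN', hc⟩ := ih h1 hN
    refine ⟨h1', hN', fun pre post => ?_⟩
    have e₂ := hc (pre ++ [.jumpZero r (pre.length + c₂.size + 2)])
      (.jumpZero 1 (pre.length + c₁.size + c₂.size + 2) ::
        (c₁.compile (pre.length + c₂.size + 2) ++ post))
    simp only [List.length_append, List.length_singleton] at e₂
    have e₁ : Reaches (pre ++ ((Cmd.ifz r c₁ c₂).compile pre.length ++ post)) inp N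
        ⟨pre.length, m⟩ ⟨pre.length + 1, m⟩ 1 :=
      reaches_jump_pos (r := r) (k := pre.length + c₂.size + 2) (by simp [Cmd.compile]) hN hr
    have e₃ := e₁.trans (t₂ := t) (σ₃ := ⟨pre.length + 1 + c₂.size, m'⟩)
      (by simpa [Cmd.compile] using e₂)
    have e₄ : Reaches (pre ++ ((Cmd.ifz r c₁ c₂).compile pre.length ++ post)) inp N
        ⟨pre.length + 1 + c₂.size, m'⟩ ⟨pre.length + c₁.size + c₂.size + 2, m'⟩ 1 := by
      refine reaches_jump_zero (r := 1) ?_ hN' h1'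
      simp only [Cmd.compile, List.cons_append, List.append_assoc]
      rw [List.getElem?_append_right (by omega),
        show pre.length + 1 + c₂.size - pre.length = c₂.size + 1 by omega, List.getElem?_cons_succ,
        List.getElem?_append_right (by rw [Cmd.length_compile])]
      simp [Cmd.length_compile]
    have e₅ := e₃.trans e₄
    rw [show pre.length + c₁.size + c₂.size + 2 = pre.length + (Cmd.ifz r c₁ c₂).size by
      simp only [Cmd.size]; omega, show 1 + t + 1 = t + 2 by omega] at e₅
    exact e₅
  | @loop_zero r c m hr =>
    intro h1 hN
    refine ⟨h1, hN, fun pre post => ?_⟩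
    exact reaches_jump_zero (r := r) (by simp [Cmd.compile, Cmd.size, add_assoc]) hN hr
  | @loop_pos r c m m₁ m₂ t₁ t₂ hr _ _ ih₁ ih₂ =>
    intro h1 hN
    obtain ⟨h1', hN', hc⟩ := ih₁ h1 hN
    obtain ⟨h1'', hN'', hc'⟩ := ih₂ h1' hN'
    refine ⟨h1'', hN'', fun pre post => ?_⟩
    have e₁ : Reaches (pre ++ ((Cmd.loop r c).compile pre.length ++ post)) inp N
        ⟨pre.length, m⟩ ⟨pre.length + 1, m⟩ 1 :=
      reaches_jump_pos (r := r) (k := pre.length + c.size + 2) (by simp [Cmd.compile]) hN hr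
    have e₂ := hc (pre ++ [.jumpZero r (pre.length + c.size + 2)])
      (.jumpZero 1 pre.length :: post)
    simp only [List.length_append, List.length_singleton] at e₂
    have e₃ := e₁.trans (t₂ := t₁) (σ₃ := ⟨pre.length + 1 + c.size, m₁⟩)
      (by simpa [Cmd.compile] using e₂)
    have e₄ : Reaches (pre ++ ((Cmd.loop r c).compile pre.length ++ post)) inp N
        ⟨pre.length + 1 + c.size, m₁⟩ ⟨pre.length, m₁⟩ 1 := by
      refine reaches_jump_zero (r := 1) ?_ hN' h1'
      simp only [Cmd.compile, List.cons_append, List.append_assoc]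
      rw [List.getElem?_append_right (by omega),
        show pre.length + 1 + c.size - pre.length = c.size + 1 by omega, List.getElem?_cons_succ,
        List.getElem?_append_right (by rw [Cmd.length_compile])]
      simp [Cmd.length_compile]
    have e₅ := (e₃.trans e₄).trans (hc' pre post)
    convert e₅ using 1
    omega

/-- A halted machine repeats its state, so the result persists until time `T` and the memory bound
holds at all later times as well. -/
theorem Big.outputs {inp : List ℕ} {N T : ℕ} {c : Cmd} {m' : ℕ → ℕ} {t : ℕ}
    (h : Big inp N c (fun _ => 0) m' t) (ht : t ≤ T) :
    Outputs (c.compile 0) inp T N (m' 0) := by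
  obtain ⟨-, hN, hr⟩ := h.reaches rfl (fun _ => Nat.zero_le _)
  obtain ⟨h₁, h₂⟩ := hr [] []
  simp only [List.nil_append, List.append_nil, List.length_nil, zero_add] at h₁ h₂
  have hhalt : ∀ k, (step (c.compile 0) inp)^[k] ⟨c.size, m'⟩ = ⟨c.size, m'⟩ := fun k =>
    Function.iterate_fixed (by simp [step, Cmd.length_compile]) k
  have hrun : ∀ k, t ≤ k → run (c.compile 0) inp k = ⟨c.size, m'⟩ := by
    intro k hk
    obtain ⟨j, rfl⟩ := Nat.exists_eq_add_of_le hk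
    rw [run, add_comm, Function.iterate_add_apply]
    change (step (c.compile 0) inp)^[j] ((step (c.compile 0) inp)^[t] ⟨0, fun _ => 0⟩) = _
    rw [h₁, hhalt]
  refine ⟨?_, ?_, fun k a => ?_⟩
  · rw [hrun T ht, Cmd.length_compile]
  · rw [hrun T ht]
  · rcases le_total k t with hk | hk
    · exact h₂ k hk a
    · rw [hrun k hk]
      exact hN a

/-! ### Total correctness with time and size bounds -/

/-- From the memory `m` the program `c` terminates within `T` steps with a memory satisfying `Q`,
and all values written are at most `N`. -/
def Runs (inp : List ℕ) (N : ℕ) (c : Cmd) (m : ℕ → ℕ) (T : ℕ) (Q : (ℕ → ℕ) → Prop) : Prop :=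
  ∃ m' t, t ≤ T ∧ Big inp N c m m' t ∧ Q m'

section Rules

variable {inp : List ℕ} {N : ℕ} {c c₁ c₂ : Cmd} {m : ℕ → ℕ} {T T₁ T₂ r : ℕ}
  {Q Q' : (ℕ → ℕ) → Prop}

theorem Runs.mono (h : Runs inp N c m T₁ Q) (hT : T₁ ≤ T) (hQ : ∀ m', Q m' → Q' m') :
    Runs inp N c m T Q' := by
  obtain ⟨m', t, ht, hb, hq⟩ := h
  exact ⟨m', t, ht.trans hT, hb, hQ m' hq⟩

theorem runs_op {i : Instr} {a x : ℕ} (he : effect inp m i = some (a, x)) (hx : x ≤ N) (ha : a ≠ 1)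
    (hQ : Q (Function.update m a x)) : Runs inp N (.op i) m 1 Q :=
  ⟨_, 1, le_rfl, .op he hx ha, hQ⟩

theorem Runs.seq (h : Runs inp N c₁ m T₁ fun m' => Runs inp N c₂ m' T₂ Q) :
    Runs inp N (c₁ ;; c₂) m (T₁ + T₂) Q := by
  obtain ⟨m₁, t₁, ht₁, hb₁, m₂, t₂, ht₂, hb₂, hq⟩ := h
  exact ⟨m₂, _, Nat.add_le_add ht₁ ht₂, .seq hb₁ hb₂, hq⟩

theorem runs_ifz (h₁ : m r = 0 → Runs inp N c₁ m T Q) (h₂ : m r ≠ 0 → Runs inp N c₂ m T Q) :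
    Runs inp N (.ifz r c₁ c₂) m (T + 2) Q := by
  by_cases hr : m r = 0
  · obtain ⟨m', t, ht, hb, hq⟩ := h₁ hr
    exact ⟨m', _, by omega, .ifz_zero hr hb, hq⟩
  · obtain ⟨m', t, ht, hb, hq⟩ := h₂ hr
    exact ⟨m', _, by omega, .ifz_pos hr hb, hq⟩

/-- A loop with the invariant `I k`, where `k` is the number of remaining rounds. -/
theorem runs_loop {I : ℕ → (ℕ → ℕ) → Prop} (h0 : ∀ m, I 0 m → m r = 0)
    (hpos : ∀ k m, I (k + 1) m → m r ≠ 0)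
    (hstep : ∀ k m, I (k + 1) m → Runs inp N c m T (I k)) :
    ∀ k m, I k m → Runs inp N (.loop r c) m (k * (T + 2) + 1) (I 0)
  | 0, m, h => ⟨m, 1, by omega, .loop_zero (h0 m h), h⟩
  | k + 1, m, h => by
    obtain ⟨m₁, t₁, ht₁, hb₁, h₁⟩ := hstep k m h
    obtain ⟨m₂, t₂, ht₂, hb₂, h₂⟩ := runs_loop h0 hpos hstep k m₁ h₁
    refine ⟨m₂, _, ?_, .loop_pos (hpos k m h) hb₁ hb₂, h₂⟩
    rw [Nat.succ_mul]
    omega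

end Rules

/-! ### Programs for primitive recursive functions -/

/-- The program `c` stores the value of `f` at the contents of the cells `arg` in the cell `out`;
apart from `out` it changes only cells in `[b, b')`. Its running time and the size of the numbers
depend on the arguments only. -/
def Computes {n : ℕ} (f : List.Vector ℕ n → ℕ) (arg : Fin n → ℕ) (out b b' : ℕ) (c : Cmd) : Prop :=
  ∀ v : List.Vector ℕ n, ∃ T N₀, ∀ inp N m, N₀ ≤ N → (∀ i, m (arg i) = v.get i) →
    Runs inp N c m T fun m' => m' out = f v ∧ ∀ a, a ≠ out → (a < b ∨ b' ≤ a) → m' a = m a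

/-- This is the inner step of composition. The values go to the consecutive cells from `b` on, and
every program takes its scratch space from `b + k` upwards, so it spoils neither the arguments nor
earlier values. The hypothesis `hg` is the induction hypothesis of `exists_computes`. -/
theorem exists_computes_list {n k : ℕ} (g : Fin k → List.Vector ℕ n → ℕ) (arg : Fin n → ℕ) (b : ℕ)
    (harg : ∀ i, arg i < b) (hb : 1 < b)
    (hg : ∀ i, ∀ out b₀, (∀ i, arg i < b₀) → out < b₀ → 1 < out → 1 < b₀ →
      ∃ c b', b₀ ≤ b' ∧ Computes (g i) arg out b₀ b' c) :
    ∃ c b', b + k ≤ b' ∧ ∀ v : List.Vector ℕ n, ∃ T N₀, ∀ inp N m, N₀ ≤ N →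
      (∀ i, m (arg i) = v.get i) → Runs inp N c m T fun m' =>
        (∀ i : Fin k, m' (b + i) = g i v) ∧ ∀ a, (a < b ∨ b' ≤ a) → m' a = m a := by
  suffices H : ∀ j ≤ k, ∃ c b', b + k ≤ b' ∧ ∀ v : List.Vector ℕ n, ∃ T N₀, ∀ inp N m, N₀ ≤ N →
      (∀ i, m (arg i) = v.get i) → Runs inp N c m T fun m' =>
        (∀ i : Fin k, i < j → m' (b + i) = g i v) ∧ ∀ a, (a < b ∨ b' ≤ a) → m' a = m a by
    obtain ⟨c, b', hb', h⟩ := H k le_rfl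
    refine ⟨c, b', hb', fun v => ?_⟩
    obtain ⟨T, N₀, h⟩ := h v
    exact ⟨T, N₀, fun inp N m hN hm => (h inp N m hN hm).mono le_rfl
      fun m' h' => ⟨fun i => h'.1 i i.2, h'.2⟩⟩
  intro j
  induction j with
  | zero =>
    intro _
    -- There is no empty command; a write to a cell that may be changed anyway takes its place.
    refine ⟨.op (.const b 0), b + k + 1, by omega, fun v => ⟨1, 0, fun inp N m hN hm => ?_⟩⟩
    refine runs_op rfl (Nat.zero_le _) (by omega) ⟨fun i hi => by omega, fun a ha => ?_⟩
    rw [Function.update_of_ne (by omega)]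
  | succ j ih =>
    intro hj
    obtain ⟨c, b', hb', h⟩ := ih (by omega)
    obtain ⟨c₂, b₂, hb₂, h₂⟩ := hg ⟨j, by omega⟩ (b + j) (b + k)
      (fun i => (harg i).trans_le (by omega)) (by omega) (by omega) (by omega)
    refine ⟨c ;; c₂, max b' b₂, by omega, fun v => ?_⟩
    obtain ⟨T, N₀, h⟩ := h v
    obtain ⟨T₂, N₂, h₂⟩ := h₂ v
    refine ⟨T + T₂, max N₀ N₂, fun inp N m hN hm => ?_⟩
    refine ((h inp N m (by omega) hm).mono le_rfl fun m₁ h₁ => ?_).seq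
    refine (h₂ inp N m₁ (by omega) fun i => ?_).mono le_rfl fun m₂ h₃ => ⟨fun i hi => ?_, fun a ha => ?_⟩
    · rw [h₁.2 _ (Or.inl (harg i)), hm]
    · rcases Nat.lt_succ_iff_lt_or_eq.1 hi with hi | hi
      · rw [h₃.2 _ (by omega) (by omega), h₁.1 i hi]
      · rw [show i = ⟨j, by omega⟩ from Fin.ext hi]
        exact h₃.1
    · rw [h₃.2 a (by omega) (by omega), h₁.2 a (by omega)]

/-- Every primitive recursive function is computed by a program. -/
theorem exists_computes {n : ℕ} {f : List.Vector ℕ n → ℕ} (hf : Nat.Primrec' f) :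
    ∀ (arg : Fin n → ℕ) (out b : ℕ), (∀ i, arg i < b) → out < b → out ≠ 1 → 1 < b →
      ∃ c b', b ≤ b' ∧ Computes f arg out b b' c := by
  induction hf with
  | zero =>
    intro arg out b _ _ ho _
    refine ⟨.op (.const out 0), b, le_rfl, fun v => ⟨1, 0, fun inp N m hN hm => ?_⟩⟩
    refine runs_op rfl (Nat.zero_le _) ho ⟨by simp, fun a ha _ => ?_⟩
    rw [Function.update_of_ne ha]
  | succ =>
    intro arg out b harg hout ho hb
    refine ⟨.op (.const b 1) ;; .op (.add out (arg 0) b), b + 1, by omega, fun v =>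
      ⟨1 + 1, v.head + 1, fun inp N m hN hm => ?_⟩⟩
    have h0 := hm 0
    rw [List.Vector.get_zero] at h0
    refine (runs_op rfl (by omega) (by omega) (runs_op rfl ?_ ho ⟨?_, fun a ha hab => ?_⟩)).seq
    · have := harg 0
      rw [Function.update_self, Function.update_of_ne (by omega), h0]
      exact hN
    · have := harg 0
      rw [Function.update_self, Function.update_self, Function.update_of_ne (by omega), h0]
    · rw [Function.update_of_ne ha, Function.update_of_ne (by omega)]
  | get i =>
    intro arg out b harg hout ho hb
    -- Copying is adding zero. `Computes` does not assume that cell `1` contains `0`, so the zero is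
    -- created in a scratch cell.
    refine ⟨.op (.const b 0) ;; .op (.add out (arg i) b), b + 1, by omega, fun v =>
      ⟨1 + 1, v.get i, fun inp N m hN hm => ?_⟩⟩
    have h0 := hm i
    have := harg i
    refine (runs_op rfl (by omega) (by omega) (runs_op rfl ?_ ho ⟨?_, fun a ha hab => ?_⟩)).seq
    · rw [Function.update_self, Function.update_of_ne (by omega), h0]
      exact hN
    · rw [Function.update_self, Function.update_self, Function.update_of_ne (by omega), h0,
        add_zero]
    · rw [Function.update_of_ne ha, Function.update_of_ne (by omega)]
  | @comp n k f g _ _ ihf ihg =>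
    intro arg out b harg hout ho hb
    obtain ⟨c₁, b₁, hb₁, h₁⟩ := exists_computes_list g arg b harg hb
      (fun i out b₀ ha ho ho' hb₀ => ihg i arg out b₀ ha ho (by omega) hb₀)
    obtain ⟨c₂, b₂, hb₂, h₂⟩ := ihf (fun i => b + i) out (b + k) (fun i => by omega) (by omega) ho
      (by omega)
    refine ⟨c₁ ;; c₂, max b₁ b₂, by omega, fun v => ?_⟩
    obtain ⟨T₁, N₁, h₁⟩ := h₁ v
    obtain ⟨T₂, N₂, h₂⟩ := h₂ (List.Vector.ofFn fun i => g i v)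
    refine ⟨T₁ + T₂, max N₁ N₂, fun inp N m hN hm => ?_⟩
    refine ((h₁ inp N m (by omega) hm).mono le_rfl fun m₁ h₃ => ?_).seq
    refine (h₂ inp N m₁ (by omega) fun i => ?_).mono le_rfl fun m₂ h₄ => ⟨h₄.1, fun a ha hab => ?_⟩
    · rw [h₃.1, List.Vector.get_ofFn]
    · rw [h₄.2 a ha (by omega), h₃.2 a (by omega)]
  | @prec n f g _ _ ihf ihg =>
    intro arg out b harg hout ho hb
    -- The cell `b` holds the index of the round, `b + 1` the current value, `b + 2` the number of
    -- remaining rounds, `b + 3` the constant `1`, `b + 4` the next value and `b + 5` the constant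
    -- `0`. Scratch space begins at `b + 6`.
    obtain ⟨c₁, b₁, hb₁, h₁⟩ := ihf (fun i => arg i.succ) (b + 1) (b + 6)
      (fun i => (harg _).trans_le (by omega)) (by omega) (by omega) (by omega)
    obtain ⟨c₂, b₂, hb₂, h₂⟩ := ihg (Fin.cons b (Fin.cons (b + 1) fun i => arg i.succ)) (b + 4)
      (b + 6) (by
        intro i
        refine Fin.cases ?_ (fun i => Fin.cases ?_ (fun i => ?_) i) i
        · simp
        · simp
        · simp only [Fin.cons_succ]
          exact (harg _).trans_le (by omega)) (by omega) (by omega) (by omega)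
    let body : Cmd := c₂ ;; .op (.sub (b + 2) (b + 2) (b + 3)) ;; .op (.add b b (b + 3)) ;;
      .op (.add (b + 1) (b + 4) (b + 5))
    let F : List.Vector ℕ n → ℕ → ℕ := fun w y => y.rec (f w) fun y IH => g (y ::ᵥ IH ::ᵥ w)
    -- The time of a round depends on the values reached so far. Hence the rounds are added up by
    -- induction instead of using `runs_loop`, which asks for a uniform bound.
    have hloop : ∀ (w : List.Vector ℕ n) (k y : ℕ), ∃ T N₀, ∀ inp N m, N₀ ≤ N →
        (∀ i, m (arg i.succ) = w.get i) → m b = y → m (b + 1) = F w y → m (b + 2) = k →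
        m (b + 3) = 1 → m (b + 5) = 0 → Runs inp N (.loop (b + 2) body) m T fun m' =>
          m' (b + 1) = F w (y + k) ∧ m' (b + 5) = 0 ∧
          ∀ a, (a < b ∨ max b₁ b₂ ≤ a) → m' a = m a := by
      intro w k
      induction k with
      | zero =>
        intro y
        exact ⟨1, 0, fun inp N m _ _ _ hF hk _ hz =>
          ⟨m, 1, le_rfl, .loop_zero hk, hF, hz, fun _ _ => rfl⟩⟩
      | succ k ih =>
        intro y
        obtain ⟨T, N₀, h⟩ := ih (y + 1)
        obtain ⟨T', N', h'⟩ := h₂ (y ::ᵥ F w y ::ᵥ w)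
        refine ⟨T' + 3 + T + 2, max (max N₀ N') (k + y + 1 + F w (y + 1)),
          fun inp N m hN hw hy hF hk ho hz => ?_⟩
        have hbody : Runs inp N body m (T' + (1 + (1 + 1))) fun m' => m' b = y + 1 ∧
            m' (b + 1) = F w (y + 1) ∧ m' (b + 2) = k ∧ m' (b + 3) = 1 ∧ m' (b + 5) = 0 ∧
            ∀ a, (a < b ∨ max b₁ b₂ ≤ a) → m' a = m a := by
          refine ((h' inp N m (by omega) ?_).mono le_rfl fun m₁ h₃ => ?_).seq
          · intro i
            refine Fin.cases ?_ (fun i => Fin.cases ?_ (fun i => ?_) i) i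
            · simpa using hy
            · exact hF
            · simpa using hw i
          have e0 := h₃.2 b (by omega) (by omega)
          have e2 := h₃.2 (b + 2) (by omega) (by omega)
          have e3 := h₃.2 (b + 3) (by omega) (by omega)
          have e5 := h₃.2 (b + 5) (by omega) (by omega)
          have e4 : m₁ (b + 4) = F w (y + 1) := h₃.1
          refine (runs_op rfl ?_ (by omega) (runs_op rfl ?_ (by omega)
            (runs_op rfl ?_ (by omega) ⟨?_, ?_, ?_, ?_, ?_, fun a ha => ?_⟩)).seq).seq
          · rw [e2]; omega
          · simp [e0, e3]; omega
          · simp [e4, e5, hz]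
            omega
          · simp [e0, e3, hy, ho]
          · simp [e4, e5, hz]
          · simp [e2, e3, ho, hk]
          · simp [e3, ho]
          · simp [e5, hz]
          · rw [Function.update_of_ne (by omega), Function.update_of_ne (by omega),
              Function.update_of_ne (by omega), h₃.2 a (by omega) (by omega)]
        obtain ⟨m₁, t₁, ht₁, hb₁', hy', hF', hk', ho', hz', hfr⟩ := hbody
        obtain ⟨m₂, t₂, ht₂, hb₂', h₃⟩ := h inp N m₁ (by omega)
          (fun i => by rw [hfr _ (Or.inl (harg _)), hw]) hy' hF' hk' ho' hz'
        refine ⟨m₂, _, ?_, .loop_pos (by omega) hb₁' hb₂', ?_, h₃.2.1, fun a ha => ?_⟩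
        · omega
        · rw [h₃.1, Nat.add_assoc, Nat.add_comm 1 k]
        · rw [h₃.2.2 a ha, hfr a ha]
    refine ⟨.op (.const (b + 5) 0) ;; c₁ ;; .op (.const b 0) ;;
      .op (.add (b + 2) (arg 0) (b + 5)) ;; .op (.const (b + 3) 1) ;; .loop (b + 2) body ;;
      .op (.add out (b + 1) (b + 5)), max b₁ b₂, by omega, fun v => ?_⟩
    obtain ⟨T₁, N₁, h₁⟩ := h₁ v.tail
    obtain ⟨T₂, N₂, hloop⟩ := hloop v.tail v.head 0
    refine ⟨1 + (T₁ + (1 + (1 + (1 + (T₂ + 1))))), max (max N₁ N₂) (v.head + F v.tail v.head + 1),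
      fun inp N m hN hm => ?_⟩
    have h0 := hm 0
    rw [List.Vector.get_zero] at h0
    refine (runs_op rfl (Nat.zero_le _) (by omega) ?_).seq
    refine Runs.seq ((h₁ inp N _ (by omega) fun i => ?_).mono le_rfl fun m₁ h₃ => ?_)
    · have := harg i.succ
      change Function.update m (b + 5) 0 (arg i.succ) = _
      rw [Function.update_of_ne (by omega), hm]
      simp
    have e5 : m₁ (b + 5) = 0 := by
      rw [h₃.2 (b + 5) (by omega) (by omega), Function.update_self]
    have e1 : m₁ (b + 1) = F v.tail 0 := h₃.1
    have hfr : ∀ a, (a < b ∨ max b₁ b₂ ≤ a) → m₁ a = m a := by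
      intro a ha
      rw [h₃.2 a (by omega) (by omega), Function.update_of_ne (by omega)]
    have ea := harg 0
    refine (runs_op rfl (Nat.zero_le _) (by omega) ?_).seq
    refine (runs_op rfl ?_ (by omega) ?_).seq
    · rw [Function.update_of_ne (by omega), Function.update_of_ne (by omega), e5,
        hfr _ (by omega), h0]
      omega
    refine (runs_op rfl (by omega) (by omega) ?_).seq
    refine Runs.seq ((hloop inp N _ (by omega) (fun i => ?_) ?_ ?_ ?_ ?_ ?_).mono le_rfl
      fun m₂ h₄ => ?_)
    · have := harg i.succ
      rw [Function.update_of_ne (by omega), Function.update_of_ne (by omega),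
        Function.update_of_ne (by omega), hfr _ (by omega), hm]
      simp
    · simp
    · simp [e1]
    · rw [Function.update_of_ne (by omega), Function.update_self, Function.update_of_ne (by omega),
        Function.update_of_ne (by omega), e5, hfr _ (by omega), h0, add_zero]
    · simp
    · simp [e5]
    have e6 : m₂ (b + 1) = F v.tail v.head := by rw [h₄.1, Nat.zero_add]
    refine runs_op rfl ?_ ho ⟨?_, fun a ha hab => ?_⟩
    · rw [e6, h₄.2.1]; omega
    · rw [Function.update_self, e6, h₄.2.1, add_zero]
    · rw [Function.update_of_ne ha, h₄.2.2 a (by omega), Function.update_of_ne (by omega),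
        Function.update_of_ne (by omega), Function.update_of_ne (by omega), hfr a (by omega)]

/-- A program for a function of bounded arguments has bounded running time. -/
theorem Computes.bounded {n : ℕ} {f : List.Vector ℕ n → ℕ} {arg : Fin n → ℕ} {out b b' : ℕ}
    {c : Cmd} (h : Computes f arg out b b' c) (bd : ℕ) :
    ∃ T N₀, ∀ inp N m, N₀ ≤ N → (∀ i, m (arg i) ≤ bd) → Runs inp N c m T fun m' =>
      m' out = f (List.Vector.ofFn fun i => m (arg i)) ∧
        ∀ a, a ≠ out → (a < b ∨ b' ≤ a) → m' a = m a := by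
  choose T N₀ h using h
  -- Only finitely many argument tuples have entries at most `bd`, so the maximum over them bounds
  -- time and size.
  let S : Finset (Fin n → Fin (bd + 1)) := Finset.univ
  let e : (Fin n → Fin (bd + 1)) → List.Vector ℕ n := fun v => List.Vector.ofFn fun i => (v i : ℕ)
  refine ⟨S.sup fun v => T (e v), S.sup fun v => N₀ (e v), fun inp N m hN hm => ?_⟩
  let v : Fin n → Fin (bd + 1) := fun i => ⟨m (arg i), Nat.lt_succ_of_le (hm i)⟩
  have hv : e v = List.Vector.ofFn fun i => m (arg i) := rfl
  rw [← hv]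
  refine (h (e v) inp N m ?_ fun i => ?_).mono ?_ fun _ h' => h'
  · exact (Finset.le_sup (f := fun v => N₀ (e v)) (Finset.mem_univ v)).trans hN
  · simp [e, v]
  · exact Finset.le_sup (f := fun v => T (e v)) (Finset.mem_univ v)

/-! ### Straight-line programs -/

/-- Execute instructions one after the other. -/
def block : List Instr → Cmd
  | [] => .op (.add 8 8 1)
  | [i] => .op i
  | i :: is => .op i ;; block is

/-- The condition under which straight-line code establishes `Q`. -/
def Pre (inp : List ℕ) (N : ℕ) : List Instr → (ℕ → ℕ) → ((ℕ → ℕ) → Prop) → Prop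
  | [], m, Q => Q m
  | i :: is, m, Q => ∃ a x, effect inp m i = some (a, x) ∧ x ≤ N ∧ a ≠ 1 ∧
      Pre inp N is (Function.update m a x) Q

section Pre

variable {inp : List ℕ} {N r s t k : ℕ} {is : List Instr} {m : ℕ → ℕ} {Q : (ℕ → ℕ) → Prop}

theorem pre_nil : Pre inp N [] m Q ↔ Q m := Iff.rfl

theorem pre_const : Pre inp N (.const r k :: is) m Q ↔
    k ≤ N ∧ r ≠ 1 ∧ Pre inp N is (Function.update m r k) Q := by simp [Pre, effect]

theorem pre_add : Pre inp N (.add r s t :: is) m Q ↔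
    m s + m t ≤ N ∧ r ≠ 1 ∧ Pre inp N is (Function.update m r (m s + m t)) Q := by
  simp [Pre, effect]

theorem pre_sub : Pre inp N (.sub r s t :: is) m Q ↔
    m s - m t ≤ N ∧ r ≠ 1 ∧ Pre inp N is (Function.update m r (m s - m t)) Q := by
  simp [Pre, effect]

theorem pre_load : Pre inp N (.load r s :: is) m Q ↔
    m (m s) ≤ N ∧ r ≠ 1 ∧ Pre inp N is (Function.update m r (m (m s))) Q := by
  simp [Pre, effect]

theorem pre_store : Pre inp N (.store r s :: is) m Q ↔
    m s ≤ N ∧ m r ≠ 1 ∧ Pre inp N is (Function.update m (m r) (m s)) Q := by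
  simp [Pre, effect]

theorem pre_read : Pre inp N (.read r s :: is) m Q ↔
    inp.getD (m s) 0 ≤ N ∧ r ≠ 1 ∧ Pre inp N is (Function.update m r (inp.getD (m s) 0)) Q := by
  simp [Pre, effect]

end Pre

theorem runs_block {inp : List ℕ} {N : ℕ} {Q : (ℕ → ℕ) → Prop} :
    ∀ {is : List Instr} {m : ℕ → ℕ}, is ≠ [] → Pre inp N is m Q →
      Runs inp N (block is) m is.length Q
  | [], _, h, _ => absurd rfl h
  | [i], m, _, ⟨a, x, he, hx, ha, hQ⟩ => runs_op he hx ha hQ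
  | i :: j :: is, m, _, ⟨a, x, he, hx, ha, hQ⟩ => by
    have := (runs_op he hx ha (runs_block (List.cons_ne_nil j is) hQ)).seq
    rwa [add_comm] at this

end RAM

namespace RAM

open TypeCode

/-! ### Searching a list in the memory -/

/-- Find the position of the number in cell `21` in the list at the address in cell `14` of the
length in cell `23`; the result is in cell `24`. -/
def findCmd : Cmd :=
  block [.add 24 23 1, .add 25 23 1] ;;
  -- With truncated subtraction, the sum of the two differences vanishes exactly when the numbers
  -- are equal.
  .loop 25 (block [.sub 25 25 2, .add 26 14 25, .load 26 26, .sub 27 26 21, .sub 28 21 26,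
    .add 27 27 28] ;; .ifz 27 (.op (.add 24 25 1)) (.op (.add 27 27 1)))

theorem runs_find {inp : List ℕ} {N n base : ℕ} {m : ℕ → ℕ} {ns : List (Fin n)} {w : Fin n}
    (h1 : m 1 = 0) (h2 : m 2 = 1) (h14 : m 14 = base) (hbase : 64 ≤ base)
    (h23 : m 23 = ns.length) (h21 : m 21 = w)
    (hns : ∀ i (h : i < ns.length), m (base + i) = ns[i]) (hN : base + ns.length + 2 * n ≤ N) :
    Runs inp N findCmd m (2 + (ns.length * 11 + 1)) fun m' =>
      m' 24 = ns.idxOf w ∧ ∀ a, (a < 24 ∨ 29 ≤ a) → m' a = m a := by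
  have hloop := runs_loop (inp := inp) (N := N) (r := 25) (T := 6 + (1 + 2))
    (c := block [.sub 25 25 2, .add 26 14 25, .load 26 26, .sub 27 26 21, .sub 28 21 26,
      .add 27 27 28] ;; .ifz 27 (.op (.add 24 25 1)) (.op (.add 27 27 1)))
    -- The list is scanned from its end, so the last hit is the first occurrence. If there is none,
    -- cell `24` keeps the length of the list, in agreement with `idxOf`.
    (I := fun k m' => k ≤ ns.length ∧ m' 25 = k ∧ m' 24 = k + (ns.drop k).idxOf w ∧
      ∀ a, (a < 24 ∨ 29 ≤ a) → m' a = m a)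
    (fun m h => h.2.1) (fun k m h => by rw [h.2.1]; omega)
    (by
      rintro k m' ⟨hk, h25, h24, hfr⟩
      have e1 := hfr 1 (by omega)
      have e2 := hfr 2 (by omega)
      have e14 := hfr 14 (by omega)
      have e21 := hfr 21 (by omega)
      have ek := hfr (base + k) (by omega)
      rw [h1] at e1; rw [h2] at e2; rw [h14] at e14; rw [h21] at e21; rw [hns k (by omega)] at ek
      have hdrop : ns.drop k = ns[k] :: ns.drop (k + 1) := List.drop_eq_getElem_cons (by omega)
      have hlt := (ns[k]).2
      have hlt' := w.2
      refine Runs.seq (runs_block (by simp) ?_)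
      simp (disch := omega) only [pre_nil, pre_add, pre_sub, pre_load, Function.update_self,
        Function.update_of_ne, h25, e2, e14, e21, ek, Nat.add_sub_cancel]
      refine ⟨by omega, by omega, by omega, by omega, by omega, by omega, by omega, by omega,
        by omega, by omega, by omega, by omega, runs_ifz (fun h => ?_) fun h => ?_⟩
      · simp (disch := omega) only [Function.update_self] at h
        have hw : ns[k] = w := Fin.ext (by omega)
        refine runs_op rfl ?_ (by omega) ⟨by omega, ?_, ?_, fun a ha => ?_⟩
        · simp (disch := omega) only [Function.update_self, Function.update_of_ne, e1]
          omega
        · simp (disch := omega) only [Function.update_self, Function.update_of_ne]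
        · simp (disch := omega) only [Function.update_self, Function.update_of_ne, e1, hdrop,
            List.idxOf_cons, hw, beq_self_eq_true, cond_true]
        · simp (disch := omega) only [Function.update_of_ne]
          exact hfr a ha
      · simp (disch := omega) only [Function.update_self] at h
        have hw : ns[k] ≠ w := fun hw => h (by rw [hw]; omega)
        refine runs_op rfl ?_ (by omega) ⟨by omega, ?_, ?_, fun a ha => ?_⟩
        · simp (disch := omega) only [Function.update_self, Function.update_of_ne, e1]
          omega
        · simp (disch := omega) only [Function.update_self, Function.update_of_ne]
        · simp (disch := omega) only [Function.update_of_ne, h24, hdrop]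
          rw [List.idxOf_cons_ne _ hw]
          omega
        · simp (disch := omega) only [Function.update_of_ne]
          exact hfr a ha)
  refine Runs.seq (runs_block (by simp) ?_)
  simp (disch := omega) only [pre_nil, pre_add, Function.update_of_ne, h1, h23]
  refine ⟨by omega, by omega, by omega, by omega, ?_⟩
  refine (hloop ns.length _ ⟨le_rfl, ?_, ?_, fun a ha => ?_⟩).mono le_rfl fun m' h => ?_
  · simp (disch := omega) only [Function.update_self, add_zero]
  · simp (disch := omega) only [Function.update_self, Function.update_of_ne]
    simp
  · simp (disch := omega) only [Function.update_of_ne]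
  · refine ⟨?_, h.2.2.2⟩
    simpa using h.2.2.1

end RAM

/-! ### Uniting lists of parts together with their types -/

namespace TypeCode

theorem eq_of_bits {a b : ℕ} (h : ∀ x, x ∈ bits a ↔ x ∈ bits b) : a = b :=
  Nat.eq_of_testBit_eq fun i => by
    have := h i
    rw [mem_bits, mem_bits] at this
    exact Bool.eq_iff_iff.2 this

theorem lt_of_bits {a k : ℕ} (h : ∀ x ∈ bits a, x < k) : a < 2 ^ k :=
  Nat.lt_pow_two_of_testBit a fun i hi => by
    by_contra hc
    rw [Bool.not_eq_false, ← mem_bits] at hc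
    exact absurd (h i hc) (by omega)

open Classical in
/-- The set of adjacent pairs of positions in two lists of vertices. -/
noncomputable def blackCode {n : ℕ} (G : SimpleGraph (Fin n)) (ns ls : List (Fin n)) : ℕ :=
  ofSet (((Finset.univ : Finset (Fin ns.length × Fin ls.length)).filter
    fun p => G.Adj ns[p.1] ls[p.2]).image fun p => Nat.pair p.1 p.2)

theorem mem_bits_blackCode {n : ℕ} {G : SimpleGraph (Fin n)} {ns ls : List (Fin n)} {x : ℕ} :
    x ∈ bits (blackCode G ns ls) ↔ ∃ (i j : ℕ) (hi : i < ns.length) (hj : j < ls.length),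
      G.Adj ns[i] ls[j] ∧ Nat.pair i j = x := by
  rw [blackCode, mem_bits_ofSet]
  simp only [Finset.mem_image, Finset.mem_filter, Finset.mem_univ, true_and, Prod.exists]
  constructor
  · rintro ⟨i, j, h, rfl⟩
    exact ⟨i, j, i.2, j.2, h, rfl⟩
  · rintro ⟨i, j, hi, hj, h, rfl⟩
    exact ⟨⟨i, hi⟩, ⟨j, hj⟩, h, rfl⟩

/-- The type of a union; the first side is ignored if it has no labels. -/
def unionN (B m t s : ℕ) : ℕ := if m = 0 then s else unionT B m t s

/-- Insert a pair into a coded set. -/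
def insertPair (B i j : ℕ) : ℕ := ofList (Nat.pair i j :: bits B)

theorem mem_bits_insertPair {B i j x : ℕ} :
    x ∈ bits (insertPair B i j) ↔ x = Nat.pair i j ∨ x ∈ bits B := by
  rw [insertPair, mem_bits_ofList, List.mem_cons]

/-- Extend a list of parts with its type by the parts of the red component of `w`, unless `w` is
already there. The red components are given by the lists `L w` with the types `τ w`. -/
noncomputable def extend {n : ℕ} (G : SimpleGraph (Fin n)) (L : Fin n → List (Fin n))
    (τ : Fin n → ℕ) (p : List (Fin n) × ℕ) (w : Fin n) : List (Fin n) × ℕ :=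
  if w ∈ p.1 then p
  else (p.1 ++ L w, unionN (blackCode G p.1 (L w)) p.1.length p.2 (τ w))

end TypeCode

namespace RAM

open TypeCode

/-! ### Programs for the operations on types -/

/-- Programs for the operations on types, with fixed argument and result cells. -/
structure Routines where
  cons : Cmd
  leaf : Cmd
  insert : Cmd
  union : Cmd
  relabel₁ : Cmd
  relabel₂ : Cmd
  eval : Cmd

/-- The truth value of a coded sentence on a type. -/
def evalN (p t : ℕ) : ℕ := (evalT ((Encodable.decode (α := List ℕ) p).getD [], t, [], [])).toNat

/-- The result of a program is stored in cell `r`, and only scratch cells are changed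
otherwise. -/
def Stores (K r x : ℕ) (m m' : ℕ → ℕ) : Prop :=
  m' r = x ∧ ∀ a, a ≠ r → (a < 64 ∨ K ≤ a) → m' a = m a

/-- The programs work within `T` steps for arguments up to `bd`. -/
structure Routines.Spec (M : Routines) (K bd T N₀ : ℕ) : Prop where
  cons : ∀ inp N m, N₀ ≤ N → m 26 ≤ bd → m 6 ≤ bd → Runs inp N M.cons m T
    (Stores K 6 (Nat.succ (Nat.pair (m 26) (m 6))) m)
  leaf : ∀ inp N m, N₀ ≤ N → m 4 ≤ bd → Runs inp N M.leaf m T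
    (Stores K 7 (leafT (m 4) []) m)
  insert : ∀ inp N m, N₀ ≤ N → m 32 ≤ bd → m 37 ≤ bd → m 34 ≤ bd → Runs inp N M.insert m T
    (Stores K 32 (insertPair (m 32) (m 37) (m 34)) m)
  union : ∀ inp N m, N₀ ≤ N → m 32 ≤ bd → m 23 ≤ bd → m 22 ≤ bd → m 30 ≤ bd →
    Runs inp N M.union m T (Stores K 22 (unionN (m 32) (m 23) (m 22) (m 30)) m)
  relabel₁ : ∀ inp N m, N₀ ≤ N → m 18 ≤ bd → m 24 ≤ bd → m 22 ≤ bd → Runs inp N M.relabel₁ m T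
    (Stores K 22 (relabelT (m 18) (m 24) (m 22)) m)
  relabel₂ : ∀ inp N m, N₀ ≤ N → m 23 ≤ bd → m 18 ≤ bd → m 22 ≤ bd → Runs inp N M.relabel₂ m T
    (Stores K 22 (relabelT (m 23) (m 18) (m 22)) m)
  eval : ∀ inp N m, N₀ ≤ N → m 6 ≤ bd → m 22 ≤ bd → Runs inp N M.eval m T
    (Stores K 0 (evalN (m 6) (m 22)) m)

/-- All operations on types are primitive recursive, so they have programs. The programs and the end
`K` of their scratch space do not depend on `bd`; only the time and the size bound do. -/
theorem exists_routines : ∃ (M : Routines) (K : ℕ), 64 ≤ K ∧ ∀ bd, ∃ T N₀, M.Spec K bd T N₀ := by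
  have H : ∀ {n : ℕ} (f : List.Vector ℕ n → ℕ) (arg : Fin n → ℕ) (out : ℕ), Primrec f →
      (∀ i, arg i < 64) → out < 64 → out ≠ 1 →
      ∃ c b', 64 ≤ b' ∧ Computes f arg out 64 b' c := fun f arg out hf ha ho ho' =>
    exists_computes (Nat.Primrec'.of_prim hf) arg out 64 ha ho ho' (by omega)
  have get : ∀ {n : ℕ} (i : Fin n), Primrec fun v : List.Vector ℕ n => v.get i := fun i =>
    Primrec.vector_get.comp .id (.const i)
  have hcons : Primrec fun v : List.Vector ℕ 2 => Nat.succ (Nat.pair (v.get 0) (v.get 1)) :=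
    Primrec.succ.comp (Primrec₂.natPair.comp (get 0) (get 1))
  have hleaf : Primrec fun v : List.Vector ℕ 1 => leafT (v.get 0) [] :=
    primrec_leafT.comp (Primrec.pair (get 0) (.const []))
  have hinsert : Primrec fun v : List.Vector ℕ 3 => insertPair (v.get 0) (v.get 1) (v.get 2) :=
    primrec_ofList.comp (Primrec.list_cons.comp (Primrec₂.natPair.comp (get 1) (get 2))
      (primrec_bits.comp (get 0)))
  have hunion : Primrec fun v : List.Vector ℕ 4 =>
      unionN (v.get 0) (v.get 1) (v.get 2) (v.get 3) :=
    Primrec.ite (Primrec.eq.comp (get 1) (.const 0)) (get 3)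
      (primrec_unionT.comp (Primrec.pair (get 0) (get 1)) (Primrec.pair (get 2) (get 3)))
  have hrel : Primrec fun v : List.Vector ℕ 3 => relabelT (v.get 0) (v.get 1) (v.get 2) :=
    primrec_relabelT.comp (Primrec.pair (get 0) (get 1)) (get 2)
  have heval : Primrec fun v : List.Vector ℕ 2 => evalN (v.get 0) (v.get 1) := by
    refine (Primrec.dom_bool Bool.toNat).comp (primrec_evalT.comp (Primrec.pair ?_
      (Primrec.pair (get 1) (.const ([], [])))))
    exact Primrec.option_getD.comp (Primrec.decode.comp (get 0)) (.const [])
  obtain ⟨c₁, b₁, hb₁, h₁⟩ := H _ ![26, 6] 6 hcons (by decide) (by decide) (by decide)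
  obtain ⟨c₂, b₂, hb₂, h₂⟩ := H _ ![4] 7 hleaf (by decide) (by decide) (by decide)
  obtain ⟨c₃, b₃, hb₃, h₃⟩ := H _ ![32, 37, 34] 32 hinsert (by decide) (by decide) (by decide)
  obtain ⟨c₄, b₄, hb₄, h₄⟩ := H _ ![32, 23, 22, 30] 22 hunion (by decide) (by decide) (by decide)
  obtain ⟨c₅, b₅, hb₅, h₅⟩ := H _ ![18, 24, 22] 22 hrel (by decide) (by decide) (by decide)
  obtain ⟨c₆, b₆, hb₆, h₆⟩ := H _ ![23, 18, 22] 22 hrel (by decide) (by decide) (by decide)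
  obtain ⟨c₇, b₇, hb₇, h₇⟩ := H _ ![6, 22] 0 heval (by decide) (by decide) (by decide)
  -- The sum exceeds the scratch space of each of the routines, so the heap that starts there is
  -- safe from all of them.
  refine ⟨⟨c₁, c₂, c₃, c₄, c₅, c₆, c₇⟩, b₁ + b₂ + b₃ + b₄ + b₅ + b₆ + b₇, by omega, fun bd => ?_⟩
  obtain ⟨T₁, N₁, h₁⟩ := h₁.bounded bd
  obtain ⟨T₂, N₂, h₂⟩ := h₂.bounded bd
  obtain ⟨T₃, N₃, h₃⟩ := h₃.bounded bd
  obtain ⟨T₄, N₄, h₄⟩ := h₄.bounded bd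
  obtain ⟨T₅, N₅, h₅⟩ := h₅.bounded bd
  obtain ⟨T₆, N₆, h₆⟩ := h₆.bounded bd
  obtain ⟨T₇, N₇, h₇⟩ := h₇.bounded bd
  refine ⟨T₁ + T₂ + T₃ + T₄ + T₅ + T₆ + T₇, N₁ + N₂ + N₃ + N₄ + N₅ + N₆ + N₇, ?_, ?_, ?_, ?_, ?_,
    ?_, ?_⟩
  · intro inp N m hN ha hb
    refine (h₁ inp N m (by omega) (by simp [Fin.forall_fin_succ, ha, hb])).mono (by omega)
      fun m' h => ⟨by simpa using h.1, fun a ha hK => h.2 a ha (by omega)⟩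
  · intro inp N m hN ha
    refine (h₂ inp N m (by omega) (by simp [ha])).mono (by omega)
      fun m' h => ⟨by simpa using h.1, fun a ha hK => h.2 a ha (by omega)⟩
  · intro inp N m hN ha hb hc
    refine (h₃ inp N m (by omega) (by simp [Fin.forall_fin_succ, ha, hb, hc])).mono (by omega)
      fun m' h => ⟨by simpa using h.1, fun a ha hK => h.2 a ha (by omega)⟩
  · intro inp N m hN ha hb hc hd
    refine (h₄ inp N m (by omega) (by simp [Fin.forall_fin_succ, ha, hb, hc, hd])).mono (by omega)
      fun m' h => ⟨by simpa using h.1, fun a ha hK => h.2 a ha (by omega)⟩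
  · intro inp N m hN ha hb hc
    refine (h₅ inp N m (by omega) (by simp [Fin.forall_fin_succ, ha, hb, hc])).mono (by omega)
      fun m' h => ⟨by simpa using h.1, fun a ha hK => h.2 a ha (by omega)⟩
  · intro inp N m hN ha hb hc
    refine (h₆ inp N m (by omega) (by simp [Fin.forall_fin_succ, ha, hb, hc])).mono (by omega)
      fun m' h => ⟨by simpa using h.1, fun a ha hK => h.2 a ha (by omega)⟩
  · intro inp N m hN ha hb
    refine (h₇ inp N m (by omega) (by simp [Fin.forall_fin_succ, ha, hb])).mono (by omega)
      fun m' h => ⟨by simpa using h.1, fun a ha hK => h.2 a ha (by omega)⟩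

/-! ### Extending the current list of parts -/

/-- The heap contains the row offsets of the adjacency matrix at `K + w` and, for the vertices `w`
with `A w`, a pointer at `K + n + w` to a record consisting of the type `τ w`, the length of the
list `L w`, and the list `L w`. The heap ends at `e`. -/
structure Heap {n : ℕ} (K s e : ℕ) (A : Fin n → Prop) (L : Fin n → List (Fin n)) (τ : Fin n → ℕ)
    (m : ℕ → ℕ) : Prop where
  row : ∀ w : Fin n, m (K + w) = 3 + s + w * n
  record : ∀ w, A w → ∃ p, m (K + n + w) = p ∧ K + 2 * n ≤ p ∧ p + 2 + (L w).length ≤ e ∧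
    m p = τ w ∧ m (p + 1) = (L w).length ∧ ∀ i (h : i < (L w).length), m (p + 2 + i) = (L w)[i]

theorem Heap.congr {n K s e : ℕ} {A : Fin n → Prop} {L : Fin n → List (Fin n)} {τ : Fin n → ℕ}
    {m m' : ℕ → ℕ} (h : Heap K s e A L τ m) (he : K + 2 * n ≤ e)
    (hm : ∀ a, K ≤ a → a < e → m' a = m a) : Heap K s e A L τ m' where
  row w := by rw [hm _ (by omega) (by omega), h.row]
  record w hw := by
    obtain ⟨p, h₁, h₂, h₃, h₄, h₅, h₆⟩ := h.record w hw
    refine ⟨p, ?_, h₂, h₃, ?_, ?_, fun i hi => ?_⟩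
    · rw [hm _ (by omega) (by omega), h₁]
    · rw [hm _ (by omega) (by omega), h₄]
    · rw [hm _ (by omega) (by omega), h₅]
    · rw [hm _ (by omega) (by omega), h₆ i hi]

/-- The current list of parts `p.1` is stored at `e + 2`; its type and length are in registers. -/
structure Current {n : ℕ} (e : ℕ) (p : List (Fin n) × ℕ) (m : ℕ → ℕ) : Prop where
  type : m 22 = p.2
  length : m 23 = p.1.length
  list : ∀ i (h : i < p.1.length), m (e + 2 + i) = p.1[i]

/-- The registers that are constant during the processing of a contraction. -/
structure Regs (K n e : ℕ) (m : ℕ → ℕ) : Prop where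
  zero : m 1 = 0
  one : m 2 = 1
  row : m 10 = K
  ptr : m 11 = K + n
  base : m 14 = e + 2

/-- Record the adjacencies between the current parts and the part in cell `36`. -/
def rowCmd (M : Routines) : Cmd :=
  .op (.add 37 23 1) ;;
  -- The matrix entry is found at the row offset of the name in the current list plus the column in
  -- cell `36`. One entry suffices, since parts in different red components are homogeneous.
  .loop 37 (block [.sub 37 37 2, .add 38 14 37, .load 38 38, .add 38 10 38, .load 38 38,
    .add 38 38 36, .read 38 38] ;; .ifz 38 (.op (.add 38 38 1)) M.insert)

/-- Append the red component of the part in cell `21` to the current list. -/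
def appendCmd (M : Routines) : Cmd :=
  block [.add 29 11 21, .load 29 29, .load 30 29, .add 29 29 2, .load 31 29, .const 32 0,
    .add 33 31 1, .const 34 0, .add 35 14 23] ;;
  .loop 33 (block [.add 29 29 2, .load 36 29, .store 35 36, .add 35 35 2] ;; rowCmd M ;;
    block [.add 34 34 2, .sub 33 33 2]) ;;
  -- The length is increased only at the end: until then `rowCmd` compares the new parts with the
  -- old ones only, and the union needs the old length as its label shift.
  M.union ;; .op (.add 23 23 31)

/-- Append the red component of the part in cell `21` to the current list unless it is there. -/
def extendCmd (M : Routines) : Cmd :=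
  -- A missing part yields the length of the list as its position, so the difference is `0` exactly
  -- for missing parts.
  findCmd ;; .op (.sub 26 23 24) ;; .ifz 26 (appendCmd M) (.op (.add 26 26 1))

section

variable {M : Routines} {K bd T N₀ n s e N : ℕ} {inp : List ℕ} {G : SimpleGraph (Fin n)}
  {m : ℕ → ℕ} {A : Fin n → Prop} {L : Fin n → List (Fin n)} {τ : Fin n → ℕ}
  {p : List (Fin n) × ℕ} {w : Fin n} {D : ℕ}

open Classical in
theorem runs_row (hM : M.Spec K bd T N₀) (hN₀ : N₀ ≤ N) (hK : 64 ≤ K)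
    (hmat : ∀ x y : Fin n, inp.getD (3 + s + x * n + y) 0 = if G.Adj x y then 1 else 0)
    (hr : Regs K n e m) (he : K + 2 * n ≤ e) (hrow : ∀ w : Fin n, m (K + w) = 3 + s + w * n)
    (hp : Current e p m) (hp' : p.1.length ≤ D)
    {ls : List (Fin n)} {j : ℕ} (hj : j < ls.length) (hjD : j < D)
    (h36 : m 36 = ls[j]) (h34 : m 34 = j)
    (h32 : ∀ x, x ∈ bits (m 32) ↔ ∃ (i j' : ℕ) (hi : i < p.1.length) (hj' : j' < ls.length),
      j' < j ∧ G.Adj p.1[i] ls[j'] ∧ Nat.pair i j' = x)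
    (hbd : 2 ^ (D + 1) ^ 2 ≤ bd) (hN : e + 2 + D ≤ N) (hN' : 3 + s + n * n + n ≤ N)  :
    Runs inp N (rowCmd M) m (1 + (D * (7 + (T + 1 + 2) + 2) + 1)) fun m' =>
      (∀ x, x ∈ bits (m' 32) ↔ ∃ (i j' : ℕ) (hi : i < p.1.length) (hj' : j' < ls.length),
        j' < j + 1 ∧ G.Adj p.1[i] ls[j'] ∧ Nat.pair i j' = x) ∧
      ∀ a, (a < 32 ∨ (33 ≤ a ∧ a < 37) ∨ K ≤ a) → m' a = m a := by
  obtain ⟨h1, h2, h10, h11, h14⟩ := hr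
  obtain ⟨h22, h23, hlist⟩ := hp
  have hDbd : D ≤ bd := by
    have h1 : D + 1 ≤ (D + 1) ^ 2 := Nat.le_self_pow (by omega) _
    have h2 : (D + 1) ^ 2 < 2 ^ (D + 1) ^ 2 := Nat.lt_two_pow_self
    omega
  have hrowlt : ∀ x : Fin n, (x : ℕ) * n + n ≤ n * n := by
    intro x
    have := Nat.mul_le_mul_right n (Nat.succ_le_of_lt x.2)
    rwa [Nat.succ_mul] at this
  have hloop := runs_loop (inp := inp) (N := N) (r := 37) (T := 7 + (T + 1 + 2))
    (c := block [.sub 37 37 2, .add 38 14 37, .load 38 38, .add 38 10 38, .load 38 38,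
    .add 38 38 36, .read 38 38] ;; .ifz 38 (.op (.add 38 38 1)) M.insert)
    -- Rows are treated in descending order. For the current column `j` the rows from `k` on are
    -- done, and all earlier columns are complete.
    (I := fun k m' => k ≤ p.1.length ∧ m' 37 = k ∧
      (∀ x, x ∈ bits (m' 32) ↔ ∃ (i j' : ℕ) (hi : i < p.1.length) (hj' : j' < ls.length),
        (j' < j ∨ (j' = j ∧ k ≤ i)) ∧ G.Adj p.1[i] ls[j'] ∧ Nat.pair i j' = x) ∧
      ∀ a, (a < 32 ∨ (33 ≤ a ∧ a < 37) ∨ K ≤ a) → m' a = m a)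
    (fun m h => h.2.1) (fun k m h => by rw [h.2.1]; omega)
    (by
      rintro k m' ⟨hk, h37, hB, hfr⟩
      have e1 := hfr 1 (by omega)
      have e2 := hfr 2 (by omega)
      have e10 := hfr 10 (by omega)
      have e14 := hfr 14 (by omega)
      have e36 := hfr 36 (by omega)
      have e34 := hfr 34 (by omega)
      have ek := hfr (e + 2 + k) (by omega)
      have er := hfr (K + p.1[k]) (by omega)
      rw [h1] at e1; rw [h2] at e2; rw [h14] at e14; rw [h10] at e10; rw [h36] at e36
      rw [h34] at e34; rw [hlist k (by omega)] at ek; rw [hrow] at er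
      have hlt := (p.1[k]).2
      have hlt' := (ls[j]).2
      have hlt'' := hrowlt p.1[k]
      refine Runs.seq (runs_block (by simp) ?_)
      simp (disch := omega) only [pre_nil, pre_add, pre_sub, pre_load, pre_read,
        Function.update_self, Function.update_of_ne, h37, e2, e10, e14, e36, ek, er,
        Nat.add_sub_cancel, hmat]
      refine ⟨by omega, by omega, by omega, by omega, by omega, by omega, by omega, by omega,
        by omega, by omega, by omega, by omega, by split_ifs <;> omega, by omega,
        runs_ifz (fun h => ?_) fun h => ?_⟩
      · simp (disch := omega) only [Function.update_self] at h
        have hadj : ¬ G.Adj p.1[k] ls[j] := by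
          intro hadj
          simp [hadj] at h
        refine Runs.mono (runs_op rfl ?_ (by omega) ⟨by omega, ?_, fun x => ?_, fun a ha => ?_⟩)
          (T₁ := 1) (by omega) (fun _ h => h)
        · simp (disch := omega) only [Function.update_self, Function.update_of_ne, e1]
          omega
        · simp (disch := omega) only [Function.update_self, Function.update_of_ne]
        · simp (disch := omega) only [Function.update_of_ne]
          rw [hB]
          refine exists_congr fun i => exists_congr fun j' => exists_congr fun hi =>
            exists_congr fun hj' => ?_
          constructor
          · rintro ⟨h₁ | ⟨rfl, h₁⟩, h₂⟩
            · exact ⟨Or.inl h₁, h₂⟩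
            · exact ⟨Or.inr ⟨rfl, by omega⟩, h₂⟩
          · rintro ⟨h₁ | ⟨rfl, h₁⟩, h₂⟩
            · exact ⟨Or.inl h₁, h₂⟩
            · rcases h₁.eq_or_lt with rfl | h₁
              · exact absurd h₂.1 hadj
              · exact ⟨Or.inr ⟨rfl, h₁⟩, h₂⟩
        · simp (disch := omega) only [Function.update_of_ne]
          exact hfr a ha
      · simp (disch := omega) only [Function.update_self] at h
        have hadj : G.Adj p.1[k] ls[j] := by
          by_contra hadj
          simp [hadj] at h
        -- Pairs of positions below `D` have codes below `(D + 1) ^ 2`, which bounds the code of any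
        -- set of such pairs.
        have hB32 : m' 32 ≤ bd := by
          refine le_trans (lt_of_bits fun x hx => ?_).le hbd
          obtain ⟨i, j', hi, hj', hij, -, rfl⟩ := (hB x).1 hx
          exact (Nat.pair_lt_max_add_one_sq _ _).trans_le (Nat.pow_le_pow_left (by omega) 2)
        refine (hM.insert inp N _ hN₀ ?_ ?_ ?_).mono (by omega) fun m'' h'' =>
          ⟨by omega, ?_, fun x => ?_, fun a ha => ?_⟩
        · simp (disch := omega) only [Function.update_of_ne]
          exact hB32
        · simp (disch := omega) only [Function.update_self, Function.update_of_ne]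
          omega
        · simp (disch := omega) only [Function.update_of_ne]
          omega
        · rw [h''.2 37 (by omega) (by omega)]
          simp (disch := omega) only [Function.update_self, Function.update_of_ne]
        · rw [h''.1, mem_bits_insertPair]
          simp (disch := omega) only [Function.update_self, Function.update_of_ne, e34]
          rw [hB]
          constructor
          · rintro (rfl | ⟨i, j', hi, hj', h₁ | ⟨rfl, h₁⟩, h₂⟩)
            · exact ⟨k, j, by omega, hj, Or.inr ⟨rfl, le_rfl⟩, hadj, rfl⟩
            · exact ⟨i, j', hi, hj', Or.inl h₁, h₂⟩
            · exact ⟨i, j', hi, hj', Or.inr ⟨rfl, by omega⟩, h₂⟩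
          · rintro ⟨i, j', hi, hj', h₁ | ⟨rfl, h₁⟩, h₂⟩
            · exact Or.inr ⟨i, j', hi, hj', Or.inl h₁, h₂⟩
            · rcases h₁.eq_or_lt with rfl | h₁
              · exact Or.inl h₂.2.symm
              · exact Or.inr ⟨i, j', hi, hj', Or.inr ⟨rfl, h₁⟩, h₂⟩
        · rw [h''.2 a (by omega) (by omega)]
          simp (disch := omega) only [Function.update_of_ne]
          exact hfr a ha)
  refine Runs.seq (runs_op rfl ?_ (by omega) ?_)
  · rw [h23, h1]; omega
  refine (hloop p.1.length _ ⟨le_rfl, ?_, fun x => ?_, fun a ha => ?_⟩).mono ?_ fun m' h => ?_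
  · rw [Function.update_self, h23, h1, add_zero]
  · rw [Function.update_of_ne (by omega), h32]
    refine exists_congr fun i => exists_congr fun j' => exists_congr fun hi =>
      exists_congr fun hj' => and_congr_left fun _ => ?_
    constructor
    · exact Or.inl
    · rintro (h | ⟨-, h⟩)
      · exact h
      · omega
  · rw [Function.update_of_ne (by omega)]
  · gcongr
  · refine ⟨fun x => ?_, h.2.2.2⟩
    rw [h.2.2.1]
    refine exists_congr fun i => exists_congr fun j' => exists_congr fun hi =>
      exists_congr fun hj' => and_congr_left fun _ => ?_
    omega

end

end RAM

namespace RAM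

open TypeCode

section

variable {M : Routines} {K bd T N₀ n s e N : ℕ} {inp : List ℕ} {G : SimpleGraph (Fin n)}
  {m : ℕ → ℕ} {A : Fin n → Prop} {L : Fin n → List (Fin n)} {τ : Fin n → ℕ}
  {p : List (Fin n) × ℕ} {w : Fin n} {D : ℕ}

theorem le_of_two_pow_le (h : 2 ^ (D + 1) ^ 2 ≤ bd) : D ≤ bd := by
  have h1 : D + 1 ≤ (D + 1) ^ 2 := Nat.le_self_pow (by omega) _
  have h2 : (D + 1) ^ 2 < 2 ^ (D + 1) ^ 2 := Nat.lt_two_pow_self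
  omega

/-- A bound on the running time of `appendCmd`. -/
def appendTime (D T : ℕ) : ℕ :=
  9 + (D * (4 + (1 + (D * (7 + (T + 1 + 2) + 2) + 1) + 2) + 2) + 1 + (T + 1))

open Classical in
theorem runs_append (hM : M.Spec K bd T N₀) (hN₀ : N₀ ≤ N) (hK : 64 ≤ K)
    (hmat : ∀ x y : Fin n, inp.getD (3 + s + x * n + y) 0 = if G.Adj x y then 1 else 0)
    (hr : Regs K n e m) (he : K + 2 * n ≤ e) (hheap : Heap K s e A L τ m) (hp : Current e p m)
    (hw : A w) (h21 : m 21 = w) (hD : p.1.length + (L w).length ≤ D) (hpbd : p.2 ≤ bd)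
    (hτ : τ w ≤ bd) (hbd : 2 ^ (D + 1) ^ 2 ≤ bd) (hbdN : bd ≤ N) (hN : e + 2 + D + n ≤ N)
    (hN' : 3 + s + n * n + n ≤ N) :
    Runs inp N (appendCmd M) m (appendTime D T) fun m' =>
      Current e (p.1 ++ L w, unionN (blackCode G p.1 (L w)) p.1.length p.2 (τ w)) m' ∧
      ∀ a, (a < 22 ∨ (K ≤ a ∧ a < e + 2)) → m' a = m a := by
  have hDbd := le_of_two_pow_le hbd
  have hr' := hr
  obtain ⟨h1, h2, h10, h11, h14⟩ := hr
  have hp' := hp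
  obtain ⟨h22, h23, hlist⟩ := hp
  obtain ⟨R, hR, hRK, hRe, hRτ, hRl, hRL⟩ := hheap.record w hw
  have hwn := w.2
  have hloop := runs_loop (inp := inp) (N := N) (r := 33)
    (T := 4 + (1 + (D * (7 + (T + 1 + 2) + 2) + 1) + 2))
    (c := block [.add 29 29 2, .load 36 29, .store 35 36, .add 35 35 2] ;; rowCmd M ;;
      block [.add 34 34 2, .sub 33 33 2])
    -- After `j` rounds the read pointer is `R + 1 + j`, as it is advanced before each read. Writing
    -- happens only behind the current list, beyond the heap end `e`, so all records stay intact.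
    (I := fun k m' => ∃ j, j + k = (L w).length ∧ m' 33 = k ∧ m' 34 = j ∧ m' 29 = R + 1 + j ∧
      m' 35 = e + 2 + p.1.length + j ∧ m' 30 = τ w ∧ m' 31 = (L w).length ∧ m' 22 = p.2 ∧
      m' 23 = p.1.length ∧
      (∀ x, x ∈ bits (m' 32) ↔ ∃ (i j' : ℕ) (hi : i < p.1.length) (hj' : j' < (L w).length),
        j' < j ∧ G.Adj p.1[i] (L w)[j'] ∧ Nat.pair i j' = x) ∧
      (∀ i (hi : i < (L w).length), i < j → m' (e + 2 + p.1.length + i) = (L w)[i]) ∧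
      ∀ a, (a < 22 ∨ (K ≤ a ∧ a < e + 2 + p.1.length)) → m' a = m a)
    (fun m ⟨_, h⟩ => h.2.1) (fun k m ⟨_, h⟩ => by rw [h.2.1]; omega)
    (by
      rintro k m' ⟨j, hjk, h33', h34', h29', h35', h30', h31', h22', h23', h32', hls, hfr⟩
      have hj : j < (L w).length := by omega
      have hfr1 := hfr 1 (by omega)
      have hfr2 := hfr 2 (by omega)
      have e1 := hfr1.trans h1
      have e2 := hfr2.trans h2
      have ej := (hfr (R + 2 + j) (by omega)).trans (hRL j hj)
      have hlt := ((L w)[j]).2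
      refine Runs.seq (T₁ := 4) ((runs_block (Q := fun m₁ => m₁ 29 = R + 1 + (j + 1) ∧
        m₁ 36 = (L w)[j] ∧ m₁ 35 = e + 2 + p.1.length + (j + 1) ∧
        m₁ (e + 2 + p.1.length + j) = (L w)[j] ∧ ∀ a, a ≠ 29 → a ≠ 36 → a ≠ 35 →
          a ≠ e + 2 + p.1.length + j → m₁ a = m' a) (by simp) ?_).mono le_rfl ?_)
      · simp (disch := omega) only [pre_nil, pre_add, pre_load, pre_store,
          Function.update_self, Function.update_of_ne, h29', e2, h35']
        rw [show R + 1 + j + 1 = R + 2 + j by omega, ej]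
        refine ⟨by omega, by omega, by omega, by omega, by omega, by omega, by omega, by omega,
          by omega, rfl, by omega, rfl, fun a h29 h36 h35 ha => ?_⟩
        simp (disch := omega) only [Function.update_of_ne]
      rintro m₁ ⟨f29, f36, f35, fj, ffr⟩
      have ffr' : ∀ a, (a < 22 ∨ (K ≤ a ∧ a < e + 2 + p.1.length)) → m₁ a = m a := fun a ha => by
        rw [ffr a (by omega) (by omega) (by omega) (by omega), hfr a ha]
      refine Runs.seq ((runs_row (ls := L w) (j := j) (p := p) hM hN₀ hK hmat ⟨?_, ?_, ?_, ?_, ?_⟩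
        he (fun x => ?_) ⟨?_, ?_, fun i hi => ?_⟩ (by omega) hj (by omega) f36 ?_ ?_ hbd
        (by omega) hN').mono le_rfl ?_)
      · rw [ffr' 1 (by omega), h1]
      · rw [ffr' 2 (by omega), h2]
      · rw [ffr' 10 (by omega), h10]
      · rw [ffr' 11 (by omega), h11]
      · rw [ffr' 14 (by omega), h14]
      · rw [ffr' _ (by omega), hheap.row]
      · rw [ffr 22 (by omega) (by omega) (by omega) (by omega), h22']
      · rw [ffr 23 (by omega) (by omega) (by omega) (by omega), h23']
      · rw [ffr' _ (by omega), hlist i hi]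
      · rw [ffr 34 (by omega) (by omega) (by omega) (by omega), h34']
      · rw [ffr 32 (by omega) (by omega) (by omega) (by omega)]
        exact h32'
      rintro m₂ ⟨g32, gfr⟩
      have g1 := (gfr 2 (by omega)).trans ((ffr' 2 (by omega)).trans h2)
      have g33 := (gfr 33 (by omega)).trans
        ((ffr 33 (by omega) (by omega) (by omega) (by omega)).trans h33')
      have g34 := (gfr 34 (by omega)).trans
        ((ffr 34 (by omega) (by omega) (by omega) (by omega)).trans h34')
      refine runs_block (by simp) ?_
      simp (disch := omega) only [pre_nil, pre_add, pre_sub,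
          Function.update_self, Function.update_of_ne, g33, g34, g1, Nat.add_sub_cancel]
      refine ⟨by omega, by omega, by omega, by omega, j + 1, by omega, by trivial, by trivial, ?_,
        ?_, ?_,
        ?_, ?_, ?_, g32, fun i hi hij => ?_, fun a ha => ?_⟩
      · rw [gfr 29 (by omega), f29]
      · rw [gfr 35 (by omega), f35]
      · rw [gfr 30 (by omega), ffr 30 (by omega) (by omega) (by omega) (by omega), h30']
      · rw [gfr 31 (by omega), ffr 31 (by omega) (by omega) (by omega) (by omega), h31']
      · rw [gfr 22 (by omega), ffr 22 (by omega) (by omega) (by omega) (by omega), h22']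
      · rw [gfr 23 (by omega), ffr 23 (by omega) (by omega) (by omega) (by omega), h23']
      · rw [gfr _ (by omega)]
        rcases Nat.lt_succ_iff_lt_or_eq.1 hij with hij | rfl
        · rw [ffr _ (by omega) (by omega) (by omega) (by omega), hls i hi hij]
        · exact fj
      · simp (disch := omega) only [Function.update_of_ne]
        rw [gfr _ (by omega), ffr' a ha])
  unfold appendTime
  refine Runs.seq (T₁ := 9) ((runs_block (Q := fun m₁ => m₁ 29 = R + 1 ∧ m₁ 30 = τ w ∧
    m₁ 31 = (L w).length ∧ m₁ 32 = 0 ∧ m₁ 33 = (L w).length ∧ m₁ 34 = 0 ∧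
    m₁ 35 = e + 2 + p.1.length ∧ ∀ a, (a < 29 ∨ K ≤ a) → m₁ a = m a) (by simp) ?_).mono
      le_rfl ?_)
  · simp (disch := omega) only [pre_nil, pre_add, pre_load, pre_const, h1, h2, h21, h11, hR, hRτ,
      hRl, Function.update_self, Function.update_of_ne, h14, h23, add_zero]
    refine ⟨by omega, by omega, by omega, by omega, by omega, by omega, by omega, by omega,
      by omega, by omega, by omega, by omega, by omega, by omega, by omega, by omega, by omega,
      by omega, trivial, trivial, trivial, trivial, trivial, trivial, trivial, fun a ha => ?_⟩
    simp (disch := omega) only [Function.update_of_ne]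
  rintro m₁ ⟨f29, f30, f31, f32, f33, f34, f35, ffr⟩
  refine Runs.seq (((hloop (L w).length m₁ ⟨0, by omega, f33, f34, f29, f35, f30, f31, ?_, ?_,
    fun x => ?_, fun i hi h => by omega, fun a ha => ffr a (by omega)⟩)).mono
    (by gcongr; omega) ?_)
  · rw [ffr 22 (by omega), h22]
  · rw [ffr 23 (by omega), h23]
  · rw [f32]
    simp [bits]
  rintro m₂ ⟨j, hj, g33, g34, g29, g35, g30, g31, g22, g23, g32, gls, gfr⟩
  obtain rfl : j = (L w).length := by omega
  have hB : m₂ 32 = blackCode G p.1 (L w) := by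
    refine eq_of_bits fun x => ?_
    rw [g32, mem_bits_blackCode]
    refine exists_congr fun i => exists_congr fun j' => exists_congr fun hi =>
      exists_congr fun hj' => ?_
    simp [hj']
  have hB32 : m₂ 32 ≤ bd := by
    refine le_trans (lt_of_bits fun x hx => ?_).le hbd
    obtain ⟨i, j', hi, hj', hij, -, rfl⟩ := (g32 x).1 hx
    exact (Nat.pair_lt_max_add_one_sq _ _).trans_le (Nat.pow_le_pow_left (by omega) 2)
  refine Runs.seq ((hM.union inp N m₂ hN₀ hB32 (by omega) (by omega) (by omega)).mono le_rfl ?_)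
  rintro m₃ ⟨k22, kfr⟩
  have k23 := (kfr 23 (by omega) (by omega)).trans g23
  have k31 := (kfr 31 (by omega) (by omega)).trans g31
  refine runs_op rfl ?_ (by omega) ⟨⟨?_, ?_, fun i hi => ?_⟩, fun a ha => ?_⟩
  · rw [k23, k31]; omega
  · rw [Function.update_of_ne (by omega), k22, hB, g23, g22, g30]
  · rw [Function.update_self, k23, k31, List.length_append]
  · rw [Function.update_of_ne (by omega), kfr _ (by omega) (by omega)]
    simp only [List.length_append] at hi
    by_cases hi' : i < p.1.length
    · rw [gfr _ (by omega), hlist i hi']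
      simp [List.getElem_append_left hi']
    · obtain ⟨i', rfl⟩ := Nat.exists_eq_add_of_le (not_lt.1 hi')
      rw [← add_assoc, gls i' (by omega) (by omega)]
      simp [List.getElem_append_right]
  · rw [Function.update_of_ne (by omega), kfr _ (by omega) (by omega), gfr a (by omega)]

/-- A bound on the running time of `extendCmd`. -/
def extendTime (D T : ℕ) : ℕ := 2 + (D * 11 + 1) + (1 + (appendTime D T + 2))

open Classical in
theorem runs_extend (hM : M.Spec K bd T N₀) (hN₀ : N₀ ≤ N) (hK : 64 ≤ K)
    (hmat : ∀ x y : Fin n, inp.getD (3 + s + x * n + y) 0 = if G.Adj x y then 1 else 0)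
    (hr : Regs K n e m) (he : K + 2 * n ≤ e) (hheap : Heap K s e A L τ m) (hp : Current e p m)
    (hw : A w) (h21 : m 21 = w) (hD : p.1.length ≤ D)
    (hD' : (extend G L τ p w).1.length ≤ D) (hpbd : p.2 ≤ bd)
    (hτ : τ w ≤ bd) (hbd : 2 ^ (D + 1) ^ 2 ≤ bd) (hbdN : bd ≤ N) (hN : e + 2 + D + 2 * n ≤ N)
    (hN' : 3 + s + n * n + n ≤ N) :
    Runs inp N (extendCmd M) m (extendTime D T) fun m' => Current e (extend G L τ p w) m' ∧
      ∀ a, (a < 22 ∨ (K ≤ a ∧ a < e + 2)) → m' a = m a := by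
  unfold extendTime
  have h23 := hp.length
  refine Runs.seq ((runs_find (base := e + 2) (ns := p.1) (w := w) hr.zero hr.one hr.base
    (by omega) hp.length h21 hp.list (by omega)).mono (by gcongr) ?_)
  rintro m₁ ⟨f24, ffr⟩
  have f23 := (ffr 23 (by omega)).trans h23
  refine Runs.seq (runs_op rfl ?_ (by omega) (runs_ifz (fun h => ?_) fun h => ?_))
  · rw [f23]; omega
  · rw [Function.update_self, f23, f24] at h
    have hnot : w ∉ p.1 := by
      rw [← List.idxOf_lt_length_iff]
      omega
    rw [extend, if_neg hnot] at hD' ⊢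
    have hfr : ∀ a, (a < 24 ∨ 29 ≤ a) →
        Function.update m₁ 26 (m₁ 23 - m₁ 24) a = m a := fun a ha => by
      rw [Function.update_of_ne (by omega), ffr a ha]
    refine (runs_append hM hN₀ hK hmat ⟨?_, ?_, ?_, ?_, ?_⟩ he (hheap.congr he fun a ha _ =>
      hfr a (by omega)) ⟨?_, ?_, fun i hi => ?_⟩ hw ?_ (by simpa using hD') hpbd hτ hbd hbdN (by omega)
      hN').mono le_rfl fun m' h' => ⟨h'.1, fun a ha => ?_⟩
    · rw [hfr _ (by omega), hr.zero]
    · rw [hfr _ (by omega), hr.one]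
    · rw [hfr _ (by omega), hr.row]
    · rw [hfr _ (by omega), hr.ptr]
    · rw [hfr _ (by omega), hr.base]
    · rw [hfr _ (by omega), hp.type]
    · rw [hfr _ (by omega), hp.length]
    · rw [hfr _ (by omega), hp.list i hi]
    · rw [hfr _ (by omega), h21]
    · rw [h'.2 a ha, hfr a (by omega)]
  · rw [Function.update_self, f23, f24] at h
    have hmem : w ∈ p.1 := by
      rw [← List.idxOf_lt_length_iff]
      omega
    rw [extend, if_pos hmem]
    refine Runs.mono (runs_op rfl ?_ (by omega) ⟨⟨?_, ?_, fun i hi => ?_⟩, fun a ha => ?_⟩)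
      (T₁ := 1) (by unfold appendTime; omega) (fun _ h => h)
    · rw [Function.update_self, Function.update_of_ne (by omega), ffr 1 (by omega), hr.zero, f23]
      omega
    · rw [Function.update_of_ne (by omega), Function.update_of_ne (by omega), ffr 22 (by omega),
        hp.type]
    · rw [Function.update_of_ne (by omega), Function.update_of_ne (by omega), f23]
    · rw [Function.update_of_ne (by omega), Function.update_of_ne (by omega), ffr _ (by omega),
        hp.list i hi]
    · rw [Function.update_of_ne (by omega), Function.update_of_ne (by omega), ffr _ (by omega)]

end

end RAM

/-! ### Carrying out one contraction -/

namespace TypeCode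

/-- Remove the entry `j` from a list and move the last entry to its position. -/
def dropPart {α : Type*} (ns : List α) (j : ℕ) (v : α) : List α :=
  (ns.set j (ns.getD (ns.length - 1) v)).take (ns.length - 1)

theorem length_dropPart {α : Type*} (ns : List α) (j : ℕ) (v : α) :
    (dropPart ns j v).length = ns.length - 1 := by
  simp [dropPart]

theorem getElem_dropPart {α : Type*} (ns : List α) (j : ℕ) (v : α) (k : ℕ)
    (hk : k < (dropPart ns j v).length) :
    (dropPart ns j v)[k] = if j = k then ns[ns.length - 1]'(by
      rw [length_dropPart] at hk; omega) else ns[k]'(by rw [length_dropPart] at hk; omega) := by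
  have hk' := hk
  rw [length_dropPart] at hk'
  simp [dropPart, List.getElem_set, List.getD_eq_getElem?_getD, show ns.length - 1 < ns.length by omega]

/-- Merge a list of red components, given by the lists `L w` with the types `τ w`. -/
noncomputable def extendAll {n : ℕ} (G : SimpleGraph (Fin n)) (L : Fin n → List (Fin n))
    (τ : Fin n → ℕ) (l : List (Fin n)) : List (Fin n) × ℕ := l.foldl (extend G L τ) ([], 0)

theorem extendAll_append {n : ℕ} (G : SimpleGraph (Fin n)) (L : Fin n → List (Fin n))
    (τ : Fin n → ℕ) (l : List (Fin n)) (w : Fin n) :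
    extendAll G L τ (l ++ [w]) = extend G L τ (extendAll G L τ l) w := by
  simp [extendAll]

end TypeCode

namespace RAM

open TypeCode

/-- Carry out a contraction. -/
def stepCmd (M : Routines) : Cmd :=
  -- Cell `5` is the input position and cell `12` the end of the heap. The list is built two cells
  -- further on, so that the type and the length of the new record can be put in front of it. Cells
  -- `15`, `16` and `17` receive the kept part, the dropped part and the number of red neighbors.
  block [.const 22 0, .const 23 0, .const 8 2, .add 14 12 8, .read 15 5, .add 5 5 2, .read 16 5,
    .add 5 5 2, .read 17 5, .add 5 5 2, .add 21 15 1] ;;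
  extendCmd M ;; .op (.add 21 16 1) ;; extendCmd M ;;
  .loop 17 (block [.read 21 5, .add 5 5 2, .sub 17 17 2] ;; extendCmd M) ;;
  -- The position of the dropped part is saved in cell `18`; that of the kept part remains in cell
  -- `24`.
  .op (.add 21 16 1) ;; findCmd ;; block [.add 18 24 1, .add 21 15 1] ;; findCmd ;;
  -- The dropped part takes over the label of the kept one. Its position thereby becomes free and is
  -- given to the last part, so that the labels are again an initial segment. If the dropped part is
  -- itself the last one, the second relabeling changes nothing.
  M.relabel₁ ;; .op (.sub 23 23 2) ;; M.relabel₂ ;;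
  -- The last entry moves to the free position, and type and length are written in front of the
  -- list. The list is thus already in place as a record.
  block [.add 19 14 23, .load 20 19, .add 19 14 18, .store 19 20, .store 12 22, .add 19 12 2,
    .store 19 23, .add 24 23 1, .add 19 14 1] ;;
  -- All parts of the new component are redirected to the new record. Old records are never
  -- overwritten, so the other components need no attention.
  .loop 24 (block [.load 20 19, .add 20 20 11, .store 20 12, .add 19 19 2, .sub 24 24 2]) ;;
  .op (.add 12 19 1)

/-- A bound on the running time of `stepCmd`. -/
def stepTime (D T : ℕ) : ℕ :=
  11 + (extendTime D T + (1 + (extendTime D T + (D * (3 + extendTime D T + 2) + 1 +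
    (1 + (2 + (D * 11 + 1) + (2 + (2 + (D * 11 + 1) + (T + (1 + (T + (9 +
      (D * (5 + 2) + 1 + 1)))))))))))))

section

variable {M : Routines} {K bd T N₀ n s e N : ℕ} {inp : List ℕ} {G : SimpleGraph (Fin n)}
  {m : ℕ → ℕ} {A : Fin n → Prop} {L : Fin n → List (Fin n)} {τ : Fin n → ℕ} {D : ℕ}

/-- The pointers of the parts in a list are redirected. -/
theorem runs_redirect {ns : List (Fin n)} (h2 : m 2 = 1) (h11 : m 11 = K + n) (h12 : m 12 = e)
    (h19 : m 19 = e + 2) (h24 : m 24 = ns.length) (hK : 64 ≤ K) (he : K + 2 * n ≤ e)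
    (hns : ∀ i (h : i < ns.length), m (e + 2 + i) = ns[i]) (hN : e + 2 + ns.length + n ≤ N)
    (hD : ns.length ≤ D) :
    Runs inp N (.loop 24 (block [.load 20 19, .add 20 20 11, .store 20 12, .add 19 19 2,
      .sub 24 24 2])) m (D * (5 + 2) + 1) fun m' =>
        m' 19 = e + 2 + ns.length ∧ (∀ x ∈ ns, m' (K + n + x) = e) ∧
        ∀ a, a ≠ 19 → a ≠ 20 → a ≠ 24 → (∀ x ∈ ns, a ≠ K + n + x) → m' a = m a := by
  have hloop := runs_loop (inp := inp) (N := N) (r := 24) (T := 5)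
    (c := block [.load 20 19, .add 20 20 11, .store 20 12, .add 19 19 2, .sub 24 24 2])
    (I := fun k m' => ∃ j, j + k = ns.length ∧ m' 24 = k ∧ m' 19 = e + 2 + j ∧
      (∀ i (hi : i < ns.length), i < j → m' (K + n + ns[i]) = e) ∧
      ∀ a, a ≠ 19 → a ≠ 20 → a ≠ 24 → (∀ x ∈ ns, a ≠ K + n + x) → m' a = m a)
    (fun m ⟨_, h⟩ => h.2.1) (fun k m ⟨_, h⟩ => by rw [h.2.1]; omega)
    (by
      rintro k m' ⟨j, hjk, h24', h19', hptr, hfr⟩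
      have hne : ∀ a, a < K ∨ e ≤ a → ∀ x ∈ ns, a ≠ K + n + x := by
        intro a ha x _
        have := x.2
        omega
      have hj : j < ns.length := by omega
      have hlt := (ns[j]).2
      have e2 := (hfr 2 (by omega) (by omega) (by omega) (hne 2 (by omega))).trans h2
      have e11 := (hfr 11 (by omega) (by omega) (by omega) (hne 11 (by omega))).trans h11
      have e12 := (hfr 12 (by omega) (by omega) (by omega) (hne 12 (by omega))).trans h12
      have ej := (hfr (e + 2 + j) (by omega) (by omega) (by omega) (hne _ (by omega))).trans
        (hns j hj)
      refine runs_block (by simp) ?_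
      simp (disch := omega) only [pre_nil, pre_add, pre_sub, pre_load, pre_store,
        Function.update_self, Function.update_of_ne, h19', ej, e11, e12, e2, h24',
        Nat.add_sub_cancel]
      refine ⟨by omega, by omega, by omega, by omega, by omega, by omega, by omega, by omega,
        by omega, by omega, j + 1, by omega, by trivial, by omega, fun i hi hij => ?_,
        fun a h19 h20 h24 ha => ?_⟩
      · by_cases hv : (ns[i] : ℕ) = ns[j]
        · rw [hv, add_comm (ns[j] : ℕ), Function.update_self]
        · rw [Function.update_of_ne (by omega)]
          rcases Nat.lt_succ_iff_lt_or_eq.1 hij with hij | rfl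
          · rw [Function.update_of_ne (by omega), Function.update_of_ne (by omega), hptr i hi hij]
          · exact absurd rfl hv
      · have := ha ns[j] (List.getElem_mem hj)
        simp (disch := omega) only [Function.update_of_ne]
        exact hfr a h19 h20 h24 ha)
  refine (hloop ns.length m ⟨0, by omega, h24, h19, fun i hi h => by omega,
    fun a _ _ _ _ => rfl⟩).mono (by gcongr) ?_
  rintro m' ⟨j, hj, -, h19', hptr, hfr⟩
  obtain rfl : j = ns.length := by omega
  refine ⟨h19', fun x hx => ?_, hfr⟩
  obtain ⟨i, hi, rfl⟩ := List.getElem_of_mem hx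
  exact hptr i hi hi

open Classical in
/-- The loop over the red neighbors. -/
theorem runs_reds (hM : M.Spec K bd T N₀) (hN₀ : N₀ ≤ N) (hK : 64 ≤ K)
    (hmat : ∀ x y : Fin n, inp.getD (3 + s + x * n + y) 0 = if G.Adj x y then 1 else 0)
    (hr : Regs K n e m) (he : K + 2 * n ≤ e) (hheap : Heap K s e A L τ m)
    {l₀ reds : List (Fin n)} {pos : ℕ} (hp : Current e (extendAll G L τ l₀) m)
    (hA : ∀ w ∈ reds, A w) (hτ : ∀ w ∈ reds, τ w ≤ bd)
    (hb : ∀ l, l <+: l₀ ++ reds → (extendAll G L τ l).1.length ≤ D ∧ (extendAll G L τ l).2 ≤ bd)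
    (h17 : m 17 = reds.length) (h5 : m 5 = pos)
    (hinp : ∀ i (h : i < reds.length), inp.getD (pos + i) 0 = reds[i])
    (hredD : reds.length ≤ D) (hbd : 2 ^ (D + 1) ^ 2 ≤ bd) (hbdN : bd ≤ N)
    (hN : e + 2 + D + 2 * n ≤ N) (hN' : 3 + s + n * n + n ≤ N) (hN'' : pos + D + 1 ≤ N) :
    Runs inp N (.loop 17 (block [.read 21 5, .add 5 5 2, .sub 17 17 2] ;; extendCmd M)) m
      (D * (3 + extendTime D T + 2) + 1) fun m' => Current e (extendAll G L τ (l₀ ++ reds)) m' ∧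
        m' 5 = pos + reds.length ∧
        ∀ a, ((a < 22 ∧ a ≠ 5 ∧ a ≠ 17 ∧ a ≠ 21) ∨ (K ≤ a ∧ a < e + 2)) → m' a = m a := by
  have hloop := runs_loop (inp := inp) (N := N) (r := 17) (T := 3 + extendTime D T)
    (c := block [.read 21 5, .add 5 5 2, .sub 17 17 2] ;; extendCmd M)
    (I := fun k m' => ∃ j, j + k = reds.length ∧ m' 17 = k ∧ m' 5 = pos + j ∧
      Current e (extendAll G L τ (l₀ ++ reds.take j)) m' ∧
      ∀ a, ((a < 22 ∧ a ≠ 5 ∧ a ≠ 17 ∧ a ≠ 21) ∨ (K ≤ a ∧ a < e + 2)) → m' a = m a)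
    (fun m ⟨_, h⟩ => h.2.1) (fun k m ⟨_, h⟩ => by rw [h.2.1]; omega)
    (by
      rintro k m' ⟨j, hjk, h17', h5', hcur, hfr⟩
      have hj : j < reds.length := by omega
      have hlt := (reds[j]).2
      have e2 := (hfr 2 (by omega)).trans hr.one
      have htake : reds.take (j + 1) = reds.take j ++ [reds[j]] := List.take_succ_eq_append_getElem hj
      have hpre : ∀ i, l₀ ++ reds.take i <+: l₀ ++ reds := fun i =>
        (List.prefix_append_right_inj _).2 (List.take_prefix _ _)
      have hext : extendAll G L τ (l₀ ++ reds.take (j + 1)) =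
          extend G L τ (extendAll G L τ (l₀ ++ reds.take j)) reds[j] := by
        rw [htake, ← List.append_assoc, extendAll_append]
      refine Runs.seq (T₁ := 3) ((runs_block (Q := fun m₁ => m₁ 21 = reds[j] ∧
        m₁ 5 = pos + (j + 1) ∧ m₁ 17 = k ∧ ∀ a, a ≠ 21 → a ≠ 5 → a ≠ 17 → m₁ a = m' a)
        (by simp) ?_).mono le_rfl ?_)
      · simp (disch := omega) only [pre_nil, pre_add, pre_sub, pre_read, Function.update_self,
          Function.update_of_ne, h5', e2, h17', hinp j hj, Nat.add_sub_cancel]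
        refine ⟨by omega, by omega, by omega, by omega, by omega, by omega, by trivial, by omega,
          by trivial,
          fun a _ _ _ => ?_⟩
        simp (disch := omega) only [Function.update_of_ne]
      rintro m₁ ⟨f21, f5, f17, ffr⟩
      have ffr' : ∀ a, ((a < 22 ∧ a ≠ 5 ∧ a ≠ 17 ∧ a ≠ 21) ∨ (K ≤ a ∧ a < e + 2)) →
          m₁ a = m a := fun a ha => by
        rw [ffr a (by omega) (by omega) (by omega), hfr a ha]
      refine (runs_extend hM hN₀ hK hmat (w := reds[j])
        (p := extendAll G L τ (l₀ ++ reds.take j)) ⟨?_, ?_, ?_, ?_, ?_⟩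
        he (hheap.congr he fun a _ _ => ffr' a (by omega)) ⟨?_, ?_, fun i hi => ?_⟩
        (hA _ (List.getElem_mem hj)) f21 (hb _ (hpre j)).1 ?_ (hb _ (hpre j)).2
        (hτ _ (List.getElem_mem hj)) hbd hbdN hN hN').mono le_rfl ?_
      · rw [ffr' 1 (by omega), hr.zero]
      · rw [ffr' 2 (by omega), hr.one]
      · rw [ffr' 10 (by omega), hr.row]
      · rw [ffr' 11 (by omega), hr.ptr]
      · rw [ffr' 14 (by omega), hr.base]
      · rw [ffr 22 (by omega) (by omega) (by omega), hcur.type]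
      · rw [ffr 23 (by omega) (by omega) (by omega), hcur.length]
      · rw [ffr _ (by omega) (by omega) (by omega), hcur.list i hi]
      · rw [← hext]; exact (hb _ (hpre (j + 1))).1
      rintro m₂ ⟨g1, gfr⟩
      refine ⟨j + 1, by omega, ?_, ?_, ?_, fun a ha => ?_⟩
      · rw [gfr 17 (by omega), f17]
      · rw [gfr 5 (by omega), f5]
      · rw [hext]; exact g1
      · rw [gfr a (by omega), ffr' a ha])
  refine (hloop reds.length m ⟨0, by omega, h17, h5, by simpa using hp, fun _ _ => rfl⟩).mono
    (by gcongr) ?_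
  rintro m' ⟨j, hj, -, h5', hcur, hfr⟩
  obtain rfl : j = reds.length := by omega
  rw [List.take_length] at hcur
  exact ⟨hcur, h5', hfr⟩

-- The frame conditions of the pieces are chained: registers survive the routines because scratch
-- space is separate, and addresses below `e` change only in the redirected pointers. Only undropped
-- parts are promised a record afterwards; the pointer of `v` becomes stale.
open Classical in
set_option maxHeartbeats 1000000 in
theorem runs_step (hM : M.Spec K bd T N₀) (hN₀ : N₀ ≤ N) (hK : 64 ≤ K)
    (hmat : ∀ x y : Fin n, inp.getD (3 + s + x * n + y) 0 = if G.Adj x y then 1 else 0)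
    (h1 : m 1 = 0) (h2 : m 2 = 1) (h10 : m 10 = K) (h11 : m 11 = K + n) (h12 : m 12 = e)
    (he : K + 2 * n ≤ e) (hheap : Heap K s e A L τ m)
    {u v : Fin n} {reds : List (Fin n)} {pos : ℕ} (h5 : m 5 = pos)
    (hu : inp.getD pos 0 = u) (hv : inp.getD (pos + 1) 0 = v)
    (hl : inp.getD (pos + 2) 0 = reds.length)
    (hinp : ∀ i (h : i < reds.length), inp.getD (pos + 3 + i) 0 = reds[i])
    (hA : ∀ w ∈ u :: v :: reds, A w) (hτ : ∀ w ∈ u :: v :: reds, τ w ≤ bd)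
    (hb : ∀ l, l <+: u :: v :: reds →
      (extendAll G L τ l).1.length ≤ D ∧ (extendAll G L τ l).2 ≤ bd)
    {p : List (Fin n) × ℕ} (hp : extendAll G L τ (u :: v :: reds) = p)
    (hup : u ∈ p.1) (hvp : v ∈ p.1)
    (hrel : relabelT (p.1.idxOf v) (p.1.idxOf u) p.2 ≤ bd)
    (hrel' : relabelT (p.1.length - 1) (p.1.idxOf v)
      (relabelT (p.1.idxOf v) (p.1.idxOf u) p.2) ≤ bd)
    (hredD : reds.length ≤ D) (hbd : 2 ^ (D + 1) ^ 2 ≤ bd) (hbdN : bd ≤ N)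
    (hN : e + 2 + D + 2 * n ≤ N) (hN' : 3 + s + n * n + n ≤ N) (hN'' : pos + 4 + D ≤ N) :
    Runs inp N (stepCmd M) m (stepTime D T) fun m' =>
      Heap K s (e + 2 + (p.1.length - 1)) (fun w => A w ∧ w ≠ v)
        (fun w => if w ∈ dropPart p.1 (p.1.idxOf v) v then dropPart p.1 (p.1.idxOf v) v else L w)
        (fun w => if w ∈ dropPart p.1 (p.1.idxOf v) v then relabelT (p.1.length - 1) (p.1.idxOf v)
          (relabelT (p.1.idxOf v) (p.1.idxOf u) p.2) else τ w) m' ∧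
      m' 5 = pos + 3 + reds.length ∧ m' 12 = e + 2 + (p.1.length - 1) ∧
      m' 22 = relabelT (p.1.length - 1) (p.1.idxOf v)
        (relabelT (p.1.idxOf v) (p.1.idxOf u) p.2) ∧
      ∀ a, (a < 5 ∨ a = 6 ∨ a = 9 ∨ a = 10 ∨ a = 11 ∨ a = 13) → m' a = m a := by
  have hDbd := le_of_two_pow_le hbd
  have hun := u.2
  have hvn := v.2
  unfold stepTime
  refine Runs.seq (T₁ := 11) ((runs_block (Q := fun m₁ => m₁ 22 = 0 ∧ m₁ 23 = 0 ∧ m₁ 14 = e + 2 ∧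
    m₁ 15 = u ∧ m₁ 16 = v ∧ m₁ 17 = reds.length ∧ m₁ 5 = pos + 3 ∧ m₁ 21 = u ∧
    ∀ a, (a < 5 ∨ a = 6 ∨ (9 ≤ a ∧ a ≤ 13) ∨ K ≤ a) → m₁ a = m a) (by simp) ?_).mono le_rfl ?_)
  · simp (disch := omega) only [pre_nil, pre_add, pre_const, pre_read, Function.update_self,
      Function.update_of_ne, h1, h2, h5, h12, hu, hv, hl, add_assoc, Nat.reduceAdd, add_zero]
    refine ⟨by omega, by omega, by omega, by omega, by omega, by omega, by omega, by omega,
      by omega, by omega, by omega, by omega, by omega, by omega, by omega, by omega, by omega,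
      by omega, by omega, by omega, by omega, by omega, trivial, trivial, trivial, trivial,
      trivial, trivial, trivial, trivial, fun a ha => ?_⟩
    simp (disch := omega) only [Function.update_of_ne]
  rintro m₁ ⟨f22, f23, f14, f15, f16, f17, f5, f21, ffr⟩
  have fheap : Heap K s e A L τ m₁ := hheap.congr he fun a _ _ => ffr a (by omega)
  have fregs : Regs K n e m₁ := ⟨(ffr 1 (by omega)).trans h1, (ffr 2 (by omega)).trans h2,
    (ffr 10 (by omega)).trans h10, (ffr 11 (by omega)).trans h11, f14⟩
  have hb₀ := hb [] (List.nil_prefix)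
  have hb₁ := hb [u] ⟨v :: reds, rfl⟩
  have hb₂ := hb [u, v] ⟨reds, rfl⟩
  have regs_of : ∀ {m₂ : ℕ → ℕ}, (∀ a, (a < 5 ∨ (9 ≤ a ∧ a < 17)) → m₂ a = m₁ a) →
      Regs K n e m₂ := fun h => ⟨(h 1 (by omega)).trans fregs.zero, (h 2 (by omega)).trans fregs.one,
    (h 10 (by omega)).trans fregs.row, (h 11 (by omega)).trans fregs.ptr,
    (h 14 (by omega)).trans fregs.base⟩
  refine Runs.seq ((runs_extend hM hN₀ hK hmat (w := u) (p := extendAll G L τ [])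
    fregs he fheap ⟨f22, f23, fun i hi => by simp [extendAll] at hi⟩ (hA u (by simp)) f21 hb₀.1
    (by rw [← extendAll_append]; exact hb₁.1) hb₀.2 (hτ u (by simp)) hbd hbdN hN hN').mono le_rfl ?_)
  rintro m₂ ⟨gcur, gfr⟩
  rw [← extendAll_append] at gcur
  refine Runs.seq (runs_op rfl ?_ (by omega) ?_)
  · rw [gfr 16 (by omega), gfr 1 (by omega), f16, fregs.zero]; omega
  rw [gfr 16 (by omega), gfr 1 (by omega), f16, fregs.zero, add_zero]
  have gfr' : ∀ a, (a < 21 ∨ (K ≤ a ∧ a < e + 2)) →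
      Function.update m₂ 21 (v : ℕ) a = m₁ a := fun a ha => by
    rw [Function.update_of_ne (by omega), gfr a (by omega)]
  refine Runs.seq ((runs_extend hM hN₀ hK hmat (w := v) (p := extendAll G L τ [u])
    (regs_of fun a ha => gfr' a (by omega)) he (fheap.congr he fun a _ _ => gfr' a (by omega))
    ⟨?_, ?_, fun i hi => ?_⟩ (hA v (by simp)) (by rw [Function.update_self]) hb₁.1
    (by rw [← extendAll_append]; exact hb₂.1) hb₁.2 (hτ v (by simp)) hbd hbdN hN hN').mono le_rfl ?_)
  · rw [Function.update_of_ne (by omega)]; exact gcur.type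
  · rw [Function.update_of_ne (by omega)]; exact gcur.length
  · rw [Function.update_of_ne (by omega)]; exact gcur.list i hi
  rintro m₃ ⟨kcur, kfr⟩
  rw [← extendAll_append] at kcur
  have kfr' : ∀ a, (a < 21 ∨ (K ≤ a ∧ a < e + 2)) → m₃ a = m₁ a := fun a ha => by
    rw [kfr a (by omega), gfr' a ha]
  refine Runs.seq ((runs_reds hM hN₀ hK hmat (regs_of fun a ha => kfr' a (by omega)) he
    (fheap.congr he fun a _ _ => kfr' a (by omega)) (l₀ := [u, v]) (reds := reds) (pos := pos + 3)
    kcur (fun w hw => hA w (by simp [hw])) (fun w hw => hτ w (by simp [hw])) hb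
    ((kfr' 17 (by omega)).trans f17) ((kfr' 5 (by omega)).trans f5) hinp hredD hbd hbdN hN hN'
    (by omega)).mono le_rfl ?_)
  rintro m₄ ⟨lcur, l5, lfr⟩
  rw [show [u, v] ++ reds = u :: v :: reds from rfl, hp] at lcur
  have hlen : p.1.length ≤ D := by rw [← hp]; exact (hb _ List.prefix_rfl).1
  have hp2 : p.2 ≤ bd := by rw [← hp]; exact (hb _ List.prefix_rfl).2
  have lfr' : ∀ a, ((a < 5 ∨ (5 < a ∧ a < 17)) ∨ (K ≤ a ∧ a < e + 2)) → m₄ a = m₁ a :=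
    fun a ha => by rw [lfr a (by omega), kfr' a (by omega)]
  have lregs : Regs K n e m₄ := regs_of fun a ha => lfr' a (by omega)
  have hj : p.1.idxOf v < p.1.length := List.idxOf_lt_length_iff.2 hvp
  have hi : p.1.idxOf u < p.1.length := List.idxOf_lt_length_iff.2 hup
  refine Runs.seq (runs_op rfl ?_ (by omega) ?_)
  · rw [lfr' 16 (by omega), lregs.zero, f16]; omega
  rw [lfr' 16 (by omega), lregs.zero, f16, add_zero]
  have ofr : ∀ a, a ≠ 21 → Function.update m₄ 21 (v : ℕ) a = m₄ a := fun a ha => by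
    rw [Function.update_of_ne ha]
  refine Runs.seq ((runs_find (base := e + 2) (ns := p.1) (w := v) ?_ ?_ ?_ (by omega) ?_ ?_
    (fun i hi => ?_) (by omega)).mono (by gcongr) ?_)
  · rw [ofr 1 (by omega), lregs.zero]
  · rw [ofr 2 (by omega), lregs.one]
  · rw [ofr 14 (by omega), lregs.base]
  · rw [ofr 23 (by omega), lcur.length]
  · rw [Function.update_self]
  · rw [ofr _ (by omega), lcur.list i hi]
  rintro m₅ ⟨q24, qfr⟩
  have qfr' : ∀ a, a ≠ 21 → (a < 24 ∨ 29 ≤ a) → m₅ a = m₄ a := fun a ha ha' => by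
    rw [qfr a ha', ofr a ha]
  have q1 := (qfr' 1 (by omega) (by omega)).trans lregs.zero
  have q15 := (qfr' 15 (by omega) (by omega)).trans ((lfr' 15 (by omega)).trans f15)
  refine Runs.seq (T₁ := 2) ((runs_block (Q := fun m₆ => m₆ 18 = p.1.idxOf v ∧ m₆ 21 = u ∧
    ∀ a, a ≠ 18 → a ≠ 21 → (a < 24 ∨ 29 ≤ a) → m₆ a = m₄ a) (by simp) ?_).mono le_rfl ?_)
  · simp (disch := omega) only [pre_nil, pre_add, Function.update_self,
      Function.update_of_ne, q24, q1, q15, add_zero]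
    refine ⟨by omega, by omega, by omega, by omega, trivial, trivial, fun a _ _ ha => ?_⟩
    simp (disch := omega) only [Function.update_of_ne]
    exact qfr' a (by omega) ha
  rintro m₆ ⟨r18, r21, rfr⟩
  have r1 := (rfr 1 (by omega) (by omega) (by omega)).trans lregs.zero
  have r2 := (rfr 2 (by omega) (by omega) (by omega)).trans lregs.one
  refine Runs.seq ((runs_find (base := e + 2) (ns := p.1) (w := u) r1 r2 ?_ (by omega) ?_ r21
    (fun i hi => ?_) (by omega)).mono (by gcongr) ?_)
  · rw [rfr 14 (by omega) (by omega) (by omega), lregs.base]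
  · rw [rfr 23 (by omega) (by omega) (by omega), lcur.length]
  · rw [rfr _ (by omega) (by omega) (by omega), lcur.list i hi]
  rintro m₇ ⟨s24, sfr⟩
  have s18 := (sfr 18 (by omega)).trans r18
  have s22 := (sfr 22 (by omega)).trans
    ((rfr 22 (by omega) (by omega) (by omega)).trans lcur.type)
  refine Runs.seq ((hM.relabel₁ inp N m₇ hN₀ (by omega) (by omega) (by omega)).mono le_rfl ?_)
  rintro m₈ ⟨t22, tfr⟩
  rw [s18, s24, s22] at t22
  have tfr' : ∀ a, a ≠ 18 → a ≠ 21 → a ≠ 22 → (a < 24 ∨ K ≤ a) → m₈ a = m₄ a :=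
    fun a h18 h21 h22 ha => by
      rw [tfr a h22 (by omega), sfr a (by omega), rfr a h18 h21 (by omega)]
  have t23 := (tfr' 23 (by omega) (by omega) (by omega) (by omega)).trans lcur.length
  have t2 := (tfr' 2 (by omega) (by omega) (by omega) (by omega)).trans lregs.one
  have t18 := (tfr 18 (by omega) (by omega)).trans s18
  refine Runs.seq (runs_op rfl ?_ (by omega) ?_)
  · rw [t23]; omega
  rw [t23, t2]
  refine Runs.seq ((hM.relabel₂ inp N _ hN₀ ?_ ?_ ?_).mono le_rfl ?_)
  · rw [Function.update_self]; omega
  · rw [Function.update_of_ne (by omega), t18]; omega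
  · rw [Function.update_of_ne (by omega), t22]; exact hrel
  rintro m₉ ⟨u22, ufr⟩
  rw [Function.update_self, Function.update_of_ne (by omega), Function.update_of_ne (by omega), t18,
    t22] at u22
  have u23 : m₉ 23 = p.1.length - 1 := by
    rw [ufr 23 (by omega) (by omega), Function.update_self]
  have u18 : m₉ 18 = p.1.idxOf v := by
    rw [ufr 18 (by omega) (by omega), Function.update_of_ne (by omega), t18]
  have ufr' : ∀ a, a ≠ 18 → a ≠ 21 → (a < 22 ∨ K ≤ a) → m₉ a = m₄ a :=
    fun a h18 h21 ha => by
      rw [ufr a (by omega) (by omega), Function.update_of_ne (by omega),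
        tfr' a h18 h21 (by omega) (by omega)]
  have u1 := (ufr' 1 (by omega) (by omega) (by omega)).trans lregs.zero
  have u2 := (ufr' 2 (by omega) (by omega) (by omega)).trans lregs.one
  have u14 := (ufr' 14 (by omega) (by omega) (by omega)).trans lregs.base
  have u12 := (ufr' 12 (by omega) (by omega) (by omega)).trans ((lfr' 12 (by omega)).trans
    ((ffr 12 (by omega)).trans h12))
  have ulast := (ufr' (e + 2 + (p.1.length - 1)) (by omega) (by omega) (by omega)).trans
    (lcur.list (p.1.length - 1) (by omega))
  have hltl := (p.1[p.1.length - 1]).2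
  refine Runs.seq (T₁ := 9) ((runs_block (Q := fun m' => m' 19 = e + 2 ∧
    m' 24 = p.1.length - 1 ∧ m' 22 = m₉ 22 ∧ m' e = m₉ 22 ∧ m' (e + 1) = p.1.length - 1 ∧
    m' (e + 2 + p.1.idxOf v) = p.1[p.1.length - 1] ∧
    ∀ a, a ≠ 19 → a ≠ 20 → a ≠ 24 → a ≠ e → a ≠ e + 1 → a ≠ e + 2 + p.1.idxOf v → m' a = m₉ a)
    (by simp) ?_).mono le_rfl ?_)
  · simp (disch := omega) only [pre_nil, pre_add, pre_load, pre_store, Function.update_self,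
      Function.update_of_ne, u14, u23, ulast, u18, u12, u2, u1, add_zero]
    refine ⟨by omega, by omega, by omega, by omega, by omega, by omega, by omega, by omega,
      by omega, by omega, by omega, by omega, by omega, by omega, by omega, by omega, by omega,
      by omega, trivial, trivial, trivial, trivial, trivial, ?_, fun a _ _ _ _ _ _ => ?_⟩
    · trivial
    · simp (disch := omega) only [Function.update_of_ne]
  rintro m₁₀ ⟨v19, v24, v22, ve, ve1, vj, vfr⟩
  rw [u22] at ve v22
  set ns := dropPart p.1 (p.1.idxOf v) v with hns
  have hnsl : ns.length = p.1.length - 1 := length_dropPart _ _ _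
  have hnslist : ∀ i (h : i < ns.length), m₁₀ (e + 2 + i) = ns[i] := by
    intro i h
    simp only [hns]
    rw [getElem_dropPart]
    split_ifs with hij
    · rw [hij] at vj; exact vj
    · rw [vfr _ (by omega) (by omega) (by omega) (by omega) (by omega) (by omega),
        ufr' _ (by omega) (by omega) (by omega), lcur.list i (by omega)]
  have vlow : ∀ a, (a < 5 ∨ (5 < a ∧ a ≤ 13)) → m₁₀ a = m₁ a := fun a ha => by
    rw [vfr a (by omega) (by omega) (by omega) (by omega) (by omega) (by omega),
      ufr' a (by omega) (by omega) (by omega), lfr' a (by omega)]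
  have vheap : ∀ a, K ≤ a → a < e → m₁₀ a = m a := fun a ha ha' => by
    rw [vfr a (by omega) (by omega) (by omega) (by omega) (by omega) (by omega),
      ufr' a (by omega) (by omega) (by omega), lfr' a (by omega), ffr a (by omega)]
  refine Runs.seq ((runs_redirect (ns := ns) (K := K) (e := e)
    ((vlow 2 (by omega)).trans fregs.one) ((vlow 11 (by omega)).trans fregs.ptr)
    ((vlow 12 (by omega)).trans ((ffr 12 (by omega)).trans h12)) v19 (by rw [v24, hnsl]) hK he
    hnslist (by omega) (D := D) (by omega)).mono le_rfl ?_)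
  rintro m₁₁ ⟨w19, wptr, wfr⟩
  have hne : ∀ a, a < K + n ∨ K + 2 * n ≤ a → ∀ x ∈ ns, a ≠ K + n + x := by
    intro a ha x _
    have := x.2
    omega
  have w1 : m₁₁ 1 = 0 := by
    rw [wfr 1 (by omega) (by omega) (by omega) (hne _ (by omega)), vlow 1 (by omega), fregs.zero]
  have whigh : ∀ a, K + 2 * n ≤ a → m₁₁ a = m₁₀ a := fun a ha =>
    wfr a (by omega) (by omega) (by omega) (hne a (by omega))
  have wlow : ∀ a, K ≤ a → a < K + n → m₁₁ a = m₁₀ a := fun a ha ha' =>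
    wfr a (by omega) (by omega) (by omega) (hne a (by omega))
  refine runs_op rfl ?_ (by omega) ⟨⟨fun x => ?_, fun x hx => ?_⟩, ?_, ?_, ?_, fun a ha => ?_⟩
  · rw [w19, w1]; omega
  · have := x.2
    rw [Function.update_of_ne (by omega), wlow _ (by omega) (by omega), vheap _ (by omega)
      (by omega), hheap.row]
  · have := x.2
    by_cases hxn : x ∈ ns
    · refine ⟨e, ?_, he, ?_, ?_, ?_, fun i hi => ?_⟩
      · rw [Function.update_of_ne (by omega), wptr x hxn]
      · rw [if_pos hxn, hnsl]
      · rw [if_pos hxn, Function.update_of_ne (by omega), whigh _ (by omega), ve]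
      · rw [if_pos hxn, Function.update_of_ne (by omega), whigh _ (by omega), ve1, hnsl]
      · simp only [if_pos hxn] at hi ⊢
        rw [Function.update_of_ne (by omega), whigh _ (by omega), hnslist i hi]
    · obtain ⟨q, hq₁, hq₂, hq₃, hq₄, hq₅, hq₆⟩ := hheap.record x hx.1
      refine ⟨q, ?_, hq₂, ?_, ?_, ?_, fun i hi => ?_⟩
      · rw [Function.update_of_ne (by omega), wfr _ (by omega) (by omega) (by omega),
          vheap _ (by omega) (by omega), hq₁]
        intro y hy hxy
        exact hxn ((show x = y from Fin.ext (by omega)) ▸ hy)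
      · rw [if_neg hxn]; omega
      · rw [if_neg hxn, Function.update_of_ne (by omega), whigh _ (by omega),
          vheap _ (by omega) (by omega), hq₄]
      · rw [if_neg hxn, Function.update_of_ne (by omega), whigh _ (by omega),
          vheap _ (by omega) (by omega), hq₅]
      · simp only [if_neg hxn] at hi ⊢
        rw [Function.update_of_ne (by omega), whigh _ (by omega),
          vheap _ (by omega) (by omega), hq₆ i hi]
  · rw [Function.update_of_ne (by omega), wfr 5 (by omega) (by omega) (by omega) (hne _ (by omega)),
      vfr 5 (by omega) (by omega) (by omega) (by omega) (by omega) (by omega),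
      ufr' 5 (by omega) (by omega) (by omega), l5]
  · rw [Function.update_self, w19, w1, hnsl, add_zero]
  · rw [Function.update_of_ne (by omega), wfr 22 (by omega) (by omega) (by omega)
      (hne _ (by omega)), v22]
  · rw [Function.update_of_ne (by omega), wfr a (by omega) (by omega) (by omega)
      (hne _ (by omega)), vlow a (by omega), ffr a (by omega)]

end

end RAM

/-! ### Records of all red components and the complete program -/

namespace TypeCode

/-- The lists of parts of the red components and their types; `last` is the type of the
component that was changed last. -/
structure Records (n : ℕ) where
  list : Fin n → List (Fin n)
  type : Fin n → ℕ
  last : ℕ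

namespace Records

variable {n : ℕ}

/-- The red components of the edgeless trigraph of singletons. -/
def initial (n s : ℕ) : Records n := ⟨fun w => [w], fun _ => leafT s [], leafT s []⟩

/-- The merged component before the contraction. -/
noncomputable def merged (R : Records n) (G : SimpleGraph (Fin n)) (c : Contraction n) :
    List (Fin n) × ℕ :=
  extendAll G R.list R.type (c.keep :: c.drop :: c.red)

/-- The list of the merged component after the contraction. -/
noncomputable def newList (R : Records n) (G : SimpleGraph (Fin n)) (c : Contraction n) :
    List (Fin n) :=
  dropPart (R.merged G c).1 ((R.merged G c).1.idxOf c.drop) c.drop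

/-- The type of the merged component after the contraction. -/
noncomputable def newType (R : Records n) (G : SimpleGraph (Fin n)) (c : Contraction n) : ℕ :=
  relabelT ((R.merged G c).1.length - 1) ((R.merged G c).1.idxOf c.drop)
    (relabelT ((R.merged G c).1.idxOf c.drop) ((R.merged G c).1.idxOf c.keep) (R.merged G c).2)

/-- The effect of a contraction. -/
noncomputable def contract (G : SimpleGraph (Fin n)) (R : Records n) (c : Contraction n) :
    Records n where
  list w := if w ∈ R.newList G c then R.newList G c else R.list w
  type w := if w ∈ R.newList G c then R.newType G c else R.type w
  last := R.newType G c

/-- The data that come up in the processing of a contraction are bounded. -/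
structure Bounded (R : Records n) (G : SimpleGraph (Fin n)) (A : Fin n → Prop) (c : Contraction n)
    (D bd : ℕ) : Prop where
  alive : ∀ w ∈ c.keep :: c.drop :: c.red, A w
  type_le : ∀ w ∈ c.keep :: c.drop :: c.red, R.type w ≤ bd
  prefix_le : ∀ l, l <+: c.keep :: c.drop :: c.red →
    (extendAll G R.list R.type l).1.length ≤ D ∧ (extendAll G R.list R.type l).2 ≤ bd
  keep_mem : c.keep ∈ (R.merged G c).1
  drop_mem : c.drop ∈ (R.merged G c).1
  relabel_le : relabelT ((R.merged G c).1.idxOf c.drop) ((R.merged G c).1.idxOf c.keep)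
    (R.merged G c).2 ≤ bd
  newType_le : R.newType G c ≤ bd
  red_le : c.red.length ≤ D

/-- The records after a list of contractions. -/
noncomputable def after (G : SimpleGraph (Fin n)) (s : ℕ) (cs : List (Contraction n)) : Records n :=
  cs.foldl (contract G) (initial n s)

end Records

end TypeCode

namespace RAM

open TypeCode

/-- Read the sentence; set up the registers. -/
def readCmd (M : Routines) (K : ℕ) : Cmd :=
  block [.const 2 1, .read 3 2, .const 8 2, .read 4 8, .const 9 K, .add 5 8 4, .add 13 4 1,
    .const 6 0] ;;
  -- The sentence is read backwards, since the code of a list is built from its tail by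
  -- `encode_cons`.
  .loop 13 (block [.read 26 5, .sub 5 5 2, .sub 13 13 2] ;; M.cons) ;; M.leaf

/-- Set up the heap. -/
def heapCmd : Cmd :=
  -- Row offsets are obtained by repeated addition, as there is no multiplication; when all rows are
  -- done, cell `5` points to the first contraction. Cell `22` gets the type of a single vertex,
  -- which is the final type when `n = 1`.
  block [.add 22 7 1, .const 8 3, .add 5 8 4, .add 10 9 1, .add 11 9 3, .add 12 11 3, .add 13 3 1,
    .const 21 0, .add 19 10 1] ;;
  .loop 13 (block [.store 19 5, .add 5 5 3, .add 8 19 3, .store 8 12, .store 12 7, .add 12 12 2,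
    .store 12 2, .add 12 12 2, .store 12 21, .add 12 12 2, .add 21 21 2, .add 19 19 2,
    .sub 13 13 2])

/-- The model-checking program. -/
def mainCmd (M : Routines) (K : ℕ) : Cmd :=
  readCmd M K ;; heapCmd ;; .op (.sub 13 3 2) ;; .loop 13 (stepCmd M ;; .op (.sub 13 13 2)) ;;
  M.eval

section

variable {M : Routines} {K bd T N₀ n s e N : ℕ} {inp : List ℕ} {m : ℕ → ℕ}

theorem encode_cons (x : ℕ) (l : List ℕ) :
    Encodable.encode (x :: l) = Nat.succ (Nat.pair x (Encodable.encode l)) := rfl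

/-- The intermediate codes in `readCmd` are those of suffixes, so they stay below the code of the
whole sentence and `M.cons` applies to them. -/
theorem encode_suffix_le {l l' : List ℕ} (h : l <:+ l') : Encodable.encode l ≤ Encodable.encode l' := by
  obtain ⟨t, rfl⟩ := h
  induction t with
  | nil => rfl
  | cons x t ih =>
    rw [List.cons_append, encode_cons]
    exact ih.trans ((Nat.right_le_pair _ _).trans (Nat.le_succ _))

theorem runs_readCmd (hM : M.Spec K bd T N₀) (hN₀ : N₀ ≤ N) {toks : List ℕ}
    (hn : inp.getD 1 0 = n) (hs : inp.getD 2 0 = toks.length)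
    (htok : ∀ i (h : i < toks.length), inp.getD (3 + i) 0 = toks[i])
    (hcode : Encodable.encode toks ≤ bd) (hsbd : toks.length ≤ bd) (hbdN : bd ≤ N)
    (hN : K + n + 3 + toks.length ≤ N) :
    Runs inp N (readCmd M K) (fun _ => 0) (8 + (toks.length * (3 + T + 2) + 1 + T)) fun m' =>
      m' 1 = 0 ∧ m' 2 = 1 ∧ m' 3 = n ∧ m' 4 = toks.length ∧ m' 6 = Encodable.encode toks ∧
      m' 7 = leafT toks.length [] ∧ m' 9 = K := by
  refine Runs.seq (T₁ := 8) ((runs_block (Q := fun m₁ => m₁ 1 = 0 ∧ m₁ 2 = 1 ∧ m₁ 3 = n ∧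
    m₁ 4 = toks.length ∧ m₁ 9 = K ∧ m₁ 5 = 2 + toks.length ∧ m₁ 13 = toks.length ∧ m₁ 6 = 0)
    (by simp) ?_).mono le_rfl ?_)
  · simp (disch := omega) only [pre_nil, pre_add, pre_const, pre_read, Function.update_self,
      Function.update_of_ne, hn, hs, add_zero]
    refine ⟨by omega, by omega, by omega, by omega, by omega, by omega, by omega, by omega,
      by omega, by omega, by omega, by omega, by omega, by omega, by omega, by omega, ?_⟩
    trivial
  rintro m₁ ⟨f1, f2, f3, f4, f9, f5, f13, f6⟩
  have hloop := runs_loop (inp := inp) (N := N) (r := 13) (T := 3 + T)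
    (c := block [.read 26 5, .sub 5 5 2, .sub 13 13 2] ;; M.cons)
    (I := fun k m' => k ≤ toks.length ∧ m' 13 = k ∧ m' 5 = 2 + k ∧
      m' 6 = Encodable.encode (toks.drop k) ∧ m' 1 = 0 ∧ m' 2 = 1 ∧ m' 3 = n ∧
      m' 4 = toks.length ∧ m' 9 = K)
    (fun m h => h.2.1) (fun k m h => by rw [h.2.1]; omega)
    (by
      rintro k m' ⟨hk, h13, h5, h6, h1, h2, h3, h4, h9⟩
      have hdrop : toks.drop k = toks[k] :: toks.drop (k + 1) := List.drop_eq_getElem_cons hk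
      have hle := (encode_suffix_le (List.drop_suffix k toks)).trans hcode
      rw [hdrop, encode_cons] at hle
      have hl := Nat.left_le_pair toks[k] (Encodable.encode (toks.drop (k + 1)))
      have hr := Nat.right_le_pair toks[k] (Encodable.encode (toks.drop (k + 1)))
      have hread := htok k hk
      rw [show 3 + k = 2 + (k + 1) by omega] at hread
      refine Runs.seq (T₁ := 3) ((runs_block (Q := fun m₂ => m₂ 26 = toks[k] ∧ m₂ 13 = k ∧
        m₂ 5 = 2 + k ∧ m₂ 6 = m' 6 ∧ m₂ 1 = 0 ∧ m₂ 2 = 1 ∧ m₂ 3 = n ∧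
        m₂ 4 = toks.length ∧ m₂ 9 = K) (by simp) ?_).mono le_rfl ?_)
      · simp (disch := omega) only [pre_nil, pre_sub, pre_read, Function.update_self,
          Function.update_of_ne, h5, h13, h2, h1, h3, h4, h9, hread, Nat.add_sub_cancel]
        refine ⟨by omega, by omega, by omega, by omega, by omega, by omega, by trivial,
          by trivial, by omega, by trivial, by trivial, by trivial, by trivial, by trivial,
          by trivial⟩
      rintro m₂ ⟨g26, g13, g5, g6, g1, g2, g3, g4, g9⟩
      refine (hM.cons inp N m₂ hN₀ (by omega) (by omega)).mono le_rfl ?_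
      rintro m₃ ⟨k6, kfr⟩
      refine ⟨by omega, ?_, ?_, ?_, ?_, ?_, ?_, ?_, ?_⟩
      · rw [kfr 13 (by omega) (by omega), g13]
      · rw [kfr 5 (by omega) (by omega), g5]
      · rw [k6, g26, g6, h6, hdrop, encode_cons]
      · rw [kfr 1 (by omega) (by omega), g1]
      · rw [kfr 2 (by omega) (by omega), g2]
      · rw [kfr 3 (by omega) (by omega), g3]
      · rw [kfr 4 (by omega) (by omega), g4]
      · rw [kfr 9 (by omega) (by omega), g9])
  refine Runs.seq ((hloop toks.length m₁ ⟨le_rfl, f13, f5, ?_, f1, f2, f3, f4, f9⟩).mono le_rfl ?_)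
  · rw [List.drop_length, f6]; rfl
  rintro m₂ ⟨-, -, -, g6, g1, g2, g3, g4, g9⟩
  refine (hM.leaf inp N m₂ hN₀ (by omega)).mono le_rfl ?_
  rintro m₃ ⟨k7, kfr⟩
  refine ⟨?_, ?_, ?_, ?_, ?_, by rw [k7, g4], ?_⟩
  · rw [kfr 1 (by omega) (by omega), g1]
  · rw [kfr 2 (by omega) (by omega), g2]
  · rw [kfr 3 (by omega) (by omega), g3]
  · rw [kfr 4 (by omega) (by omega), g4]
  · rw [kfr 6 (by omega) (by omega), g6]; rfl
  · rw [kfr 9 (by omega) (by omega), g9]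

/-- One iteration of the loop of `heapCmd`. -/
theorem runs_heapBody {j k x y t : ℕ} (hK : 64 ≤ K) (hj : j < n) (h13 : m 13 = k + 1) (h5 : m 5 = x)
    (h19 : m 19 = K + j) (h21 : m 21 = j) (h12 : m 12 = y) (hy : K + 2 * n ≤ y) (h2 : m 2 = 1)
    (h3 : m 3 = n) (h7 : m 7 = t) (ht : t ≤ N) (hN : y + 3 ≤ N) (hk : k ≤ n) (hx : x + n ≤ N) :
    Runs inp N (block [.store 19 5, .add 5 5 3, .add 8 19 3, .store 8 12, .store 12 7, .add 12 12 2,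
      .store 12 2, .add 12 12 2, .store 12 21, .add 12 12 2, .add 21 21 2, .add 19 19 2,
      .sub 13 13 2]) m 13 fun m' => m' 13 = k ∧ m' 5 = x + n ∧ m' 19 = K + (j + 1) ∧
        m' 21 = j + 1 ∧ m' 12 = y + 3 ∧ m' (K + j) = x ∧ m' (K + n + j) = y ∧ m' y = t ∧
        m' (y + 1) = 1 ∧ m' (y + 2) = j ∧ ∀ a, (a < 5 ∨ a = 6 ∨ a = 7 ∨ a = 10 ∨ a = 11 ∨ a = 22 ∨
          (K ≤ a ∧ a ≠ K + j ∧ a ≠ K + n + j ∧ a < y)) → m' a = m a := by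
  refine runs_block (by simp) ?_
  simp (disch := omega) only [pre_nil, pre_add, pre_sub, pre_store, Function.update_self,
    Function.update_of_ne, h13, h5, h19, h21, h12, h2, h3, h7, Nat.add_sub_cancel]
  refine ⟨by omega, by omega, by omega, by omega, by omega, by omega, by omega, by omega,
    by omega, by omega, by omega, by omega, by omega, by omega, by omega, by omega, by omega,
    by omega, by omega, by omega, by omega, by omega, by omega, by omega, by omega, by omega,
    ?_⟩
  refine ⟨trivial, trivial, by omega, trivial, trivial, trivial, ?_, trivial, trivial, trivial,
    fun a ha => ?_⟩
  · rw [show K + n + j = K + j + n by omega, Function.update_self]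
  · simp (disch := omega) only [Function.update_of_ne]

set_option maxHeartbeats 1000000 in
theorem runs_heapCmd (hK : 64 ≤ K) (h1 : m 1 = 0) (h2 : m 2 = 1) (h3 : m 3 = n) (h4 : m 4 = s)
    (h7 : m 7 = leafT s []) (h9 : m 9 = K) (hbd : leafT s [] ≤ N) (hN : K + 5 * n + 3 ≤ N)
    (hN' : 3 + s + n * n + n ≤ N) :
    Runs inp N heapCmd m (9 + (n * (13 + 2) + 1)) fun m' =>
      Heap K s (K + 5 * n) (fun _ => True) (Records.initial n s).list (Records.initial n s).type m' ∧
      m' 1 = 0 ∧ m' 2 = 1 ∧ m' 3 = n ∧ m' 6 = m 6 ∧ m' 10 = K ∧ m' 11 = K + n ∧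
      m' 12 = K + 5 * n ∧ m' 22 = leafT s [] ∧ m' 5 = 3 + s + n * n := by
  refine Runs.seq (T₁ := 9) ((runs_block (Q := fun m₁ => m₁ 22 = leafT s [] ∧ m₁ 5 = 3 + s ∧
    m₁ 10 = K ∧ m₁ 11 = K + n ∧ m₁ 12 = K + n + n ∧ m₁ 13 = n ∧ m₁ 21 = 0 ∧ m₁ 19 = K ∧
    m₁ 1 = 0 ∧ m₁ 2 = 1 ∧ m₁ 3 = n ∧ m₁ 6 = m 6 ∧ m₁ 7 = leafT s [])
    (by simp) ?_).mono le_rfl ?_)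
  · simp (disch := omega) only [pre_nil, pre_add, pre_const, Function.update_self,
      Function.update_of_ne, h1, h2, h3, h4, h7, h9, add_zero]
    refine ⟨by omega, by omega, by omega, by omega, by omega, by omega, by omega, by omega,
      by omega, by omega, by omega, by omega, by omega, by omega, by omega, by omega, by omega,
      by omega, ?_⟩
    trivial
  rintro m₁ ⟨f22, f5, f10, f11, f12, f13, f21, f19, f1, f2, f3, f6, f7⟩
  have hloop := runs_loop (inp := inp) (N := N) (r := 13) (T := 13)
    (c := block [.store 19 5, .add 5 5 3, .add 8 19 3, .store 8 12, .store 12 7, .add 12 12 2,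
      .store 12 2, .add 12 12 2, .store 12 21, .add 12 12 2, .add 21 21 2, .add 19 19 2,
      .sub 13 13 2])
    -- A singleton record takes three cells: the type, the length `1` and the vertex. Together with
    -- `n` row offsets and `n` pointers this puts the heap end at `K + 5 * n`.
    (I := fun k m' => ∃ j, j + k = n ∧ m' 13 = k ∧ m' 5 = 3 + s + j * n ∧ m' 19 = K + j ∧
      m' 21 = j ∧ m' 12 = K + 2 * n + 3 * j ∧
      (∀ i, i < j → m' (K + i) = 3 + s + i * n ∧ m' (K + n + i) = K + 2 * n + 3 * i ∧
        m' (K + 2 * n + 3 * i) = leafT s [] ∧ m' (K + 2 * n + 3 * i + 1) = 1 ∧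
        m' (K + 2 * n + 3 * i + 2) = i) ∧
      ∀ a, (a < 5 ∨ a = 6 ∨ a = 7 ∨ a = 10 ∨ a = 11 ∨ a = 22) → m' a = m₁ a)
    (fun m ⟨_, h⟩ => h.2.1) (fun k m ⟨_, h⟩ => by rw [h.2.1]; omega)
    (by
      rintro k m' ⟨j, hjk, g13, g5, g19, g21, g12, grec, gfr⟩
      have e2 := (gfr 2 (by omega)).trans f2
      have e3 := (gfr 3 (by omega)).trans f3
      have e7 := (gfr 7 (by omega)).trans f7
      have hjn : j * n + n ≤ n * n := by
        have := Nat.mul_le_mul_right n (show j + 1 ≤ n by omega)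
        rwa [Nat.succ_mul] at this
      refine (runs_heapBody (inp := inp) (j := j) hK (by omega) g13 g5 g19 g21 g12 (by omega) e2 e3
        e7 hbd (by omega) (by omega) (by omega)).mono le_rfl ?_
      rintro m'' ⟨k13, k5, k19, k21, k12, k1, k2, k3, k4, k6, kfr⟩
      refine ⟨j + 1, by omega, k13, by rw [k5, Nat.succ_mul, add_assoc], k19, k21, by omega,
        fun i hi => ?_, fun a ha => ?_⟩
      · rcases Nat.lt_succ_iff_lt_or_eq.1 hi with hi | rfl
        · obtain ⟨r1, r2, r3, r4, r5⟩ := grec i hi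
          clear grec gfr hbd hN hN' e2 e3 e7
          exact ⟨(kfr _ (by omega)).trans r1, (kfr _ (by omega)).trans r2,
            (kfr _ (by omega)).trans r3, (kfr _ (by omega)).trans r4, (kfr _ (by omega)).trans r5⟩
        · exact ⟨k1, k2, k3, k4, k6⟩
      · rw [kfr a (by omega), gfr a ha])
  refine (hloop n m₁ ⟨0, by omega, f13, by omega, by omega, f21, by omega,
    fun i hi => by omega, fun _ _ => rfl⟩).mono le_rfl ?_
  rintro m' ⟨j, hj, -, g5, -, -, g12, grec, gfr⟩
  obtain rfl : j = n := by omega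
  refine ⟨⟨fun w => (grec w w.2).1, fun w _ => ⟨_, (grec w w.2).2.1, by omega, ?_,
    (grec w w.2).2.2.1, (grec w w.2).2.2.2.1, fun i hi => ?_⟩⟩, ?_, ?_, ?_, ?_, ?_, ?_, by omega,
    ?_, g5⟩
  · have := w.2
    simp only [Records.initial, List.length_singleton]
    omega
  · simp only [Records.initial, List.length_singleton, Nat.lt_one_iff] at hi ⊢
    subst hi
    rw [add_zero, (grec w w.2).2.2.2.2]
    rfl
  · rw [gfr 1 (by omega), f1]
  · rw [gfr 2 (by omega), f2]
  · rw [gfr 3 (by omega), f3]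
  · rw [gfr 6 (by omega), f6]
  · rw [gfr 10 (by omega), f10]
  · rw [gfr 11 (by omega), f11]
  · rw [gfr 22 (by omega), f22]

/-- The position of a contraction in the input. -/
def offset (s : ℕ) (cs : List (Contraction n)) : ℕ :=
  3 + s + n * n + (cs.flatMap Contraction.word).length

/-- A bound on the running time of `mainCmd`. -/
def mainTime (s D T n : ℕ) : ℕ :=
  8 + (s * (3 + T + 2) + 1 + T) + (9 + (n * (13 + 2) + 1) + (1 +
    ((n - 1) * (stepTime D T + 1 + 2) + 1 + T)))

set_option maxHeartbeats 1000000 in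
theorem runs_mainCmd (hM : M.Spec K bd T N₀) (hN₀ : N₀ ≤ N) (hK : 64 ≤ K) {toks : List ℕ}
    {G : SimpleGraph (Fin n)} [DecidableRel G.Adj] {cs : List (Contraction n)} {D : ℕ}
    (hn : inp.getD 1 0 = n) (hs : inp.getD 2 0 = toks.length)
    (htok : ∀ i (h : i < toks.length), inp.getD (3 + i) 0 = toks[i])
    (hmat : ∀ x y : Fin n, inp.getD (3 + toks.length + x * n + y) 0 = if G.Adj x y then 1 else 0)
    (hcs : ∀ t (h : t < cs.length) i (hi : i < cs[t].word.length),
      inp.getD (offset toks.length (cs.take t) + i) 0 = cs[t].word[i])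
    (hlen : cs.length + 1 = n) (hcode : Encodable.encode toks ≤ bd) (hsbd : toks.length ≤ bd)
    (hleaf : leafT toks.length [] ≤ bd) (hbd : 2 ^ (D + 1) ^ 2 ≤ bd)
    (hgood : ∀ t (h : t < cs.length), (Records.after G toks.length (cs.take t)).Bounded G
      (fun w => ∀ c ∈ cs.take t, w ≠ c.drop) cs[t] D bd)
    (hbdN : bd ≤ N) (hN : K + 8 + 7 * n + n * (D + 2) + D + toks.length ≤ N)
    (hN' : 7 + toks.length + n * n + n * (D + 3) + D + n ≤ N) :
    Runs inp N (mainCmd M K) (fun _ => 0) (mainTime toks.length D T n) fun m' =>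
      m' 0 = evalN (Encodable.encode toks) (Records.after G toks.length cs).last := by
  classical
  unfold mainTime
  refine Runs.seq ((runs_readCmd hM hN₀ hn hs htok hcode hsbd hbdN (by omega)).mono le_rfl ?_)
  rintro m₁ ⟨f1, f2, f3, f4, f6, f7, f9⟩
  refine Runs.seq ((runs_heapCmd hK f1 f2 f3 f4 f7 f9 (by omega) (by omega)
    (by omega)).mono le_rfl ?_)
  rintro m₂ ⟨gheap, g1, g2, g3, g6, g10, g11, g12, g22, g5⟩
  refine Runs.seq (runs_op rfl ?_ (by omega) ?_)
  · rw [g3]; omega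
  rw [g3, g2]
  have hloop := runs_loop (inp := inp) (N := N) (r := 13) (T := stepTime D T + 1)
    (c := stepCmd M ;; .op (.sub 13 13 2))
    -- After `t` contractions the heap stores `Records.after` for these contractions. A contraction
    -- adds at most `D + 2` cells to the heap and consumes at most `D + 3` numbers of the input,
    -- which keeps addresses linear in `n` and input positions within the allowed `n ^ 2`.
    (I := fun k m' => ∃ t e, t + k = cs.length ∧ m' 13 = k ∧
      K + 2 * n ≤ e ∧ e ≤ K + 5 * n + t * (D + 2) ∧
      offset toks.length (cs.take t) ≤ 3 + toks.length + n * n + t * (D + 3) ∧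
      Heap K toks.length e (fun w => ∀ c ∈ cs.take t, w ≠ c.drop)
        (Records.after G toks.length (cs.take t)).list
        (Records.after G toks.length (cs.take t)).type m' ∧
      m' 22 = (Records.after G toks.length (cs.take t)).last ∧
      (Records.after G toks.length (cs.take t)).last ≤ bd ∧
      m' 5 = offset toks.length (cs.take t) ∧ m' 12 = e ∧ m' 1 = 0 ∧ m' 2 = 1 ∧ m' 10 = K ∧
      m' 11 = K + n ∧ m' 6 = Encodable.encode toks)
    (fun m ⟨_, _, h⟩ => h.2.1) (fun k m ⟨_, _, h⟩ => by rw [h.2.1]; omega)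
    (by
      rintro k m' ⟨t, e, htk, h13, he, he', hoff, hheap, h22, hlast, h5, h12, h1, h2, h10, h11, h6⟩
      have ht : t < cs.length := by omega
      obtain ⟨b1, b2, b3, b4, b5, b6, b7, b8⟩ := hgood t ht
      have hw : cs[t].word.length = 3 + cs[t].red.length := by
        simp [Contraction.word]; omega
      have htD : t * (D + 2) + (D + 2) ≤ n * (D + 2) := by
        have := Nat.mul_le_mul_right (D + 2) (show t + 1 ≤ n by omega)
        rwa [Nat.succ_mul] at this
      have htD' : t * (D + 3) + (D + 3) ≤ n * (D + 3) := by
        have := Nat.mul_le_mul_right (D + 3) (show t + 1 ≤ n by omega)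
        rwa [Nat.succ_mul] at this
      have hplen : ((Records.after G toks.length (cs.take t)).merged G cs[t]).1.length ≤ D :=
        (b3 _ List.prefix_rfl).1
      have htake : cs.take (t + 1) = cs.take t ++ [cs[t]] := List.take_succ_eq_append_getElem ht
      have hafter : Records.after G toks.length (cs.take (t + 1)) =
          (Records.after G toks.length (cs.take t)).contract G cs[t] := by
        rw [htake, Records.after, List.foldl_append]; rfl
      have hoff' : offset toks.length (cs.take (t + 1)) =
          offset toks.length (cs.take t) + 3 + cs[t].red.length := by
        rw [htake, offset, offset, List.flatMap_append, List.length_append]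
        simp only [List.flatMap_cons, List.flatMap_nil, List.append_nil, hw]
        omega
      refine Runs.seq ((runs_step hM hN₀ hK (D := D) (fun x y => ?_) h1 h2 h10 h11 h12 he hheap h5
        (u := cs[t].keep) (v := cs[t].drop) (reds := cs[t].red) ?_ ?_ ?_ (fun i hi => ?_) b1 b2 b3
        rfl b4 b5 b6 b7 b8 hbd hbdN (by omega) (by omega) (by omega)).mono le_rfl ?_)
      · rw [hmat]
        by_cases h : G.Adj x y
        · rw [if_pos h, if_pos h]
        · rw [if_neg h, if_neg h]
      · exact hcs t ht 0 (by omega)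
      · exact hcs t ht 1 (by omega)
      · exact hcs t ht 2 (by omega)
      · rw [add_assoc, hcs t ht (3 + i) (by omega)]
        simp [Contraction.word, add_comm 3 i]
      rintro m₃ ⟨k1, k5, k12, k22, kfr⟩
      refine runs_op rfl ?_ (by omega) ⟨t + 1, e + 2 + (((Records.after G toks.length
        (cs.take t)).merged G cs[t]).1.length - 1), by omega, ?_, by omega, ?_, ?_, ?_, ?_, ?_, ?_,
        ?_, ?_, ?_, ?_, ?_, ?_⟩
      · rw [kfr 13 (by omega), h13]; omega
      · rw [Function.update_self, kfr 13 (by omega), kfr 2 (by omega), h13, h2]; omega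
      · rw [Nat.succ_mul t]; omega
      · rw [hoff', Nat.succ_mul t]; omega
      · have hrec := k1.congr (by omega) (m' := Function.update m₃ 13 (m₃ 13 - m₃ 2))
          fun a ha _ => by rw [Function.update_of_ne (by omega)]
        refine ⟨hrec.row, fun w hw => ?_⟩
        rw [hafter]
        refine hrec.record w ⟨fun c hc => hw c ?_, hw _ ?_⟩
        · rw [htake]; exact List.mem_append_left _ hc
        · rw [htake]; exact List.mem_append_right _ (List.mem_singleton_self _)
      · rw [Function.update_of_ne (by omega), k22, hafter]; rfl
      · rw [hafter]; exact b7
      · rw [Function.update_of_ne (by omega), k5, hoff']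
      · rw [Function.update_of_ne (by omega), k12]; rfl
      · rw [Function.update_of_ne (by omega), kfr 1 (by omega), h1]
      · rw [Function.update_of_ne (by omega), kfr 2 (by omega), h2]
      · rw [Function.update_of_ne (by omega), kfr 10 (by omega), h10]
      · rw [Function.update_of_ne (by omega), kfr 11 (by omega), h11]
      · rw [Function.update_of_ne (by omega), kfr 6 (by omega), h6])
  refine Runs.seq ((hloop (n - 1) _ ⟨0, K + 5 * n, by omega, ?_, by omega, by omega, ?_, ?_, ?_, ?_,
    ?_, ?_, ?_, ?_, ?_, ?_, ?_⟩).mono le_rfl ?_)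
  · rw [Function.update_self]
  · simp [offset]
  · have hrec := gheap.congr (by omega) (m' := Function.update m₂ 13 (n - 1))
      fun a ha _ => by rw [Function.update_of_ne (by omega)]
    exact ⟨hrec.row, fun w _ => hrec.record w trivial⟩
  · rw [Function.update_of_ne (by omega), g22]; rfl
  · exact hleaf
  · rw [Function.update_of_ne (by omega), g5]; simp [offset]
  · rw [Function.update_of_ne (by omega), g12]
  · rw [Function.update_of_ne (by omega), g1]
  · rw [Function.update_of_ne (by omega), g2]
  · rw [Function.update_of_ne (by omega), g10]
  · rw [Function.update_of_ne (by omega), g11]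
  · rw [Function.update_of_ne (by omega), g6, f6]
  rintro m₃ ⟨t, e, ht, -, -, -, -, -, k22, klast, -, -, -, -, -, -, k6⟩
  obtain rfl : t = cs.length := by omega
  rw [List.take_length] at k22 klast
  refine (hM.eval inp N m₃ hN₀ (by omega) (by omega)).mono le_rfl ?_
  rintro m₄ ⟨l0, -⟩
  rw [l0, k6, k22]

end

end RAM

/-! ### Parts named by vertices -/

theorem Homogeneous.symm {V : Type*} {G : SimpleGraph V} {X Y : Finset V}
    (h : Homogeneous G X Y) : Homogeneous G Y X := by
  rcases h with h | h
  · exact Or.inl fun x hx y hy => (h y hy x hx).symm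
  · exact Or.inr fun x hx y hy hxy => h y hy x hx hxy.symm

theorem RedAdj.symm {V : Type*} {G : SimpleGraph V} {X Y : Finset V}
    (h : RedAdj G X Y) : RedAdj G Y X :=
  ⟨h.1.symm, fun h' => h.2 (Homogeneous.symm h')⟩

theorem RedAdj.nonempty_left {V : Type*} {G : SimpleGraph V} {X Y : Finset V}
    (h : RedAdj G X Y) : X.Nonempty := by
  rw [Finset.nonempty_iff_ne_empty]
  rintro rfl
  exact h.2 (Or.inl fun x hx => absurd hx (Finset.notMem_empty x))

theorem RedAdj.nonempty_right {V : Type*} {G : SimpleGraph V} {X Y : Finset V}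
    (h : RedAdj G X Y) : Y.Nonempty := (RedAdj.symm h).nonempty_left

theorem Homogeneous.mono {V : Type*} {G : SimpleGraph V} {X Y X' Y' : Finset V}
    (h : Homogeneous G X' Y') (hX : X ⊆ X') (hY : Y ⊆ Y') : Homogeneous G X Y :=
  h.imp (fun h x hx y hy => h x (hX hx) y (hY hy)) fun h x hx y hy => h x (hX hx) y (hY hy)

namespace TypeCode

variable {n : ℕ} {G : SimpleGraph (Fin n)}

/-- The nonempty sets among the `B w` form the partition `P`, and each contains its name. -/
structure Named (P : Finpartition (Finset.univ : Finset (Fin n))) (B : Fin n → Finset (Fin n)) :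
    Prop where
  mem_parts : ∀ X, X ∈ P.parts ↔ ∃ w, (B w).Nonempty ∧ B w = X
  disjoint : ∀ x y, x ≠ y → Disjoint (B x) (B y)
  self_mem : ∀ w, (B w).Nonempty → w ∈ B w

theorem Named.ne {P : Finpartition (Finset.univ : Finset (Fin n))} {B : Fin n → Finset (Fin n)}
    (hB : Named P B) {x y : Fin n} (h : x ≠ y) (hx : (B x).Nonempty) : B x ≠ B y := by
  intro he
  have := hB.disjoint x y h
  rw [← he, disjoint_self] at this
  exact hx.ne_empty this

/-- Reachability between names by red edges. -/
abbrev RedReach (G : SimpleGraph (Fin n)) (B : Fin n → Finset (Fin n)) : Fin n → Fin n → Prop :=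
  Relation.ReflTransGen fun x y => RedAdj G (B x) (B y)

theorem RedReach.symm {B : Fin n → Finset (Fin n)} {x y : Fin n} (h : RedReach G B x y) :
    RedReach G B y x := by
  induction h with
  | refl => exact .refl
  | tail _ h ih => exact .head (RedAdj.symm h) ih

/-- Different names of nonempty parts name different parts, and red paths between names are red
paths in the quotient. The list therefore injects into one red component. -/
theorem length_le_of_redReach {P : Finpartition (Finset.univ : Finset (Fin n))}
    {B : Fin n → Finset (Fin n)} (hB : Named P B) {d : ℕ} (hd : ComponentWidthLE G P d) {w : Fin n}
    (hw : (B w).Nonempty) {l : List (Fin n)} (hl : l.Nodup) (h : ∀ x ∈ l, RedReach G B w x) :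
    l.length ≤ d := by
  have key : ∀ x, RedReach G B w x → (B x).Nonempty ∧ ∃ hx : B x ∈ P.parts,
      (redGraph G P).Reachable ⟨B w, (hB.mem_parts _).2 ⟨w, hw, rfl⟩⟩ ⟨B x, hx⟩ := by
    intro x hx
    induction hx with
    | refl => exact ⟨hw, _, .refl _⟩
    | @tail y z _ hyz ih =>
      obtain ⟨-, hy, hr⟩ := ih
      have hz := hyz.nonempty_right
      refine ⟨hz, (hB.mem_parts _).2 ⟨z, hz, rfl⟩, hr.trans (SimpleGraph.Adj.reachable ?_)⟩
      exact hyz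
  have hD := hd ((redGraph G P).connectedComponentMk ⟨B w, (hB.mem_parts _).2 ⟨w, hw, rfl⟩⟩)
  rw [← Set.ncard_image_of_injective _ Subtype.val_injective] at hD
  refine le_trans ?_ hD
  rw [← List.toFinset_card_of_nodup hl, ← Set.ncard_coe_finset, ← Set.InjOn.ncard_image (f := B)]
  · refine Set.ncard_le_ncard ?_ (Set.toFinite _)
    rintro _ ⟨x, hx, rfl⟩
    obtain ⟨-, hx', hr⟩ := key x (h x (by simpa using hx))
    exact ⟨⟨B x, hx'⟩, SimpleGraph.ConnectedComponent.eq.2 hr.symm, rfl⟩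
  · intro x hx y hy hxy
    by_contra hne
    exact hB.ne hne (key x (h x (by simpa using hx))).1 hxy

/-- The vertices in a list of parts. -/
def cover (B : Fin n → Finset (Fin n)) (l : List (Fin n)) : Finset (Fin n) := l.toFinset.biUnion B

theorem mem_cover {B : Fin n → Finset (Fin n)} {l : List (Fin n)} {z : Fin n} :
    z ∈ cover B l ↔ ∃ x ∈ l, z ∈ B x := by simp [cover]

theorem mem_cover_iff_getElem {B : Fin n → Finset (Fin n)} {l : List (Fin n)} {z : Fin n} :
    z ∈ cover B l ↔ ∃ (i : ℕ) (h : i < l.length), z ∈ B l[i] := by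
  rw [mem_cover]
  constructor
  · rintro ⟨x, hx, hz⟩
    obtain ⟨i, hi, rfl⟩ := List.getElem_of_mem hx
    exact ⟨i, hi, hz⟩
  · rintro ⟨i, hi, hz⟩
    exact ⟨_, List.getElem_mem hi, hz⟩

/-- `t` is the type of the subgraph formed by a list of parts, labeled by their positions. -/
def IsType (G : SimpleGraph (Fin n)) (s : ℕ) (B : Fin n → Finset (Fin n)) (l : List (Fin n))
    (t : ℕ) : Prop :=
  ∃ lab : Fin n → ℕ, (∀ i (h : i < l.length), ∀ z ∈ B l[i], lab z = i) ∧
    t = ty G (cover B l) lab s []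

theorem ty_cover_le {s D : ℕ} {C : Finset (Fin n)} {lab : Fin n → ℕ} (h : ∀ z ∈ C, lab z < D) :
    ty G C lab s [] ≤ tyBound (s + D) s :=
  ty_le fun v hv => by
    have := h v hv
    simp only [List.length_nil]
    omega

theorem IsType.le {s D : ℕ} {B : Fin n → Finset (Fin n)} {l : List (Fin n)} {t : ℕ}
    (h : IsType G s B l t) (hl : l.length ≤ D) : t ≤ tyBound (s + D) s := by
  obtain ⟨lab, h, rfl⟩ := h
  refine ty_cover_le fun z hz => ?_
  obtain ⟨i, hi, hz⟩ := mem_cover_iff_getElem.1 hz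
  rw [h i hi z hz]
  omega

/-! ### Merging red components -/

/-- The records describe the red components of the trigraph with the parts `B w`. -/
structure Records.Describes (R : Records n) (G : SimpleGraph (Fin n)) (s : ℕ)
    (B : Fin n → Finset (Fin n)) : Prop where
  self_mem : ∀ {w}, (B w).Nonempty → w ∈ R.list w
  nodup : ∀ {w}, (B w).Nonempty → (R.list w).Nodup
  alive : ∀ {w x}, (B w).Nonempty → x ∈ R.list w → (B x).Nonempty
  list_eq : ∀ {w x}, (B w).Nonempty → x ∈ R.list w → R.list x = R.list w
  type_eq : ∀ {w x}, (B w).Nonempty → x ∈ R.list w → R.type x = R.type w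
  closed : ∀ {w x y}, (B w).Nonempty → x ∈ R.list w → RedAdj G (B x) (B y) → y ∈ R.list w
  conn : ∀ {w x}, (B w).Nonempty → x ∈ R.list w → RedReach G B w x
  isType : ∀ {w}, (B w).Nonempty → IsType G s B (R.list w) (R.type w)

/-- Properties of the list obtained by merging the red components of the parts in `l`. -/
structure Merged (R : Records n) (G : SimpleGraph (Fin n)) (s : ℕ) (B : Fin n → Finset (Fin n))
    (Q : Fin n → Prop) (l : List (Fin n)) (p : List (Fin n) × ℕ) : Prop where
  nodup : p.1.Nodup
  alive : ∀ x ∈ p.1, (B x).Nonempty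
  inv : ∀ x ∈ p.1, Q x
  list_subset : ∀ x ∈ p.1, R.list x ⊆ p.1
  subset : l ⊆ p.1
  nil : p.1 = [] → p.2 = 0
  isType : p.1 ≠ [] → IsType G s B p.1 p.2

/-- The list `p.1` is a union of whole red components. If it misses `w`, it misses the entire
component of `w`, so all pairs across are homogeneous and the adjacencies of the names determine all
edges in between. -/
theorem Merged.extend {P : Finpartition (Finset.univ : Finset (Fin n))} {R : Records n} {s : ℕ}
    {B : Fin n → Finset (Fin n)} {Q : Fin n → Prop} {l : List (Fin n)} {p : List (Fin n) × ℕ}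
    (hB : Named P B) (hR : R.Describes G s B) (hp : Merged R G s B Q l p) {w : Fin n}
    (hw : (B w).Nonempty) (hQ : ∀ x ∈ R.list w, Q x) :
    Merged R G s B Q (l ++ [w]) (extend G R.list R.type p w) := by
  unfold TypeCode.extend
  split_ifs with hwp
  · exact ⟨hp.nodup, hp.alive, hp.inv, hp.list_subset,
      List.append_subset.2 ⟨hp.subset, by simpa using hwp⟩, hp.nil, hp.isType⟩
  have hdisj : ∀ x ∈ p.1, ∀ y ∈ R.list w, y ∉ R.list x := by
    intro x hx y hy hyx
    have h1 := hR.list_eq hw hy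
    have h2 := hR.list_eq (hp.alive x hx) hyx
    exact hwp (hp.list_subset x hx (by rw [← h2, h1]; exact hR.self_mem hw))
  have hne : ∀ x ∈ p.1, ∀ y ∈ R.list w, x ≠ y := by
    rintro x hx _ hy rfl
    exact hdisj x hx x hy (hR.self_mem (hp.alive x hx))
  have hhom : ∀ x ∈ p.1, ∀ y ∈ R.list w, Homogeneous G (B x) (B y) := by
    intro x hx y hy
    by_contra h
    exact hdisj x hx y hy (hR.closed (hp.alive x hx) (hR.self_mem (hp.alive x hx))
      ⟨hB.ne (hne x hx y hy) (hp.alive x hx), h⟩)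
  have hwne : R.list w ≠ [] := List.ne_nil_of_mem (hR.self_mem hw)
  refine ⟨List.nodup_append.2 ⟨hp.nodup, hR.nodup hw, fun a ha b hb => hne a ha b hb⟩, ?_, ?_, ?_,
    ?_, fun h => absurd (List.append_eq_nil_iff.1 h).2 hwne, fun _ => ?_⟩
  · intro x hx
    rcases List.mem_append.1 hx with hx | hx
    · exact hp.alive x hx
    · exact hR.alive hw hx
  · intro x hx
    rcases List.mem_append.1 hx with hx | hx
    · exact hp.inv x hx
    · exact hQ x hx
  · intro x hx
    rcases List.mem_append.1 hx with hx | hx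
    · exact List.Subset.trans (hp.list_subset x hx) (List.subset_append_left _ _)
    · rw [hR.list_eq hw hx]
      exact List.subset_append_right _ _
  · exact List.append_subset.2 ⟨List.Subset.trans hp.subset (List.subset_append_left _ _), by
      simpa using Or.inr (hR.self_mem hw)⟩
  · obtain ⟨lab₂, h₂, e₂⟩ := hR.isType hw
    -- An empty list carries the dummy type `0`, which is not the type of an empty graph; `unionN`
    -- ignores it.
    by_cases hnil : p.1 = []
    · simpa [hnil, unionN] using ⟨lab₂, h₂, e₂⟩
    obtain ⟨lab₁, h₁, e₁⟩ := hp.isType hnil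
    have hC : Disjoint (cover B p.1) (cover B (R.list w)) := by
      rw [Finset.disjoint_left]
      intro z hz hz'
      obtain ⟨x, hx, hz⟩ := mem_cover.1 hz
      obtain ⟨y, hy, hz'⟩ := mem_cover.1 hz'
      exact Finset.disjoint_left.1 (hB.disjoint x y (hne x hx y hy)) hz hz'
    have hcov : cover B (p.1 ++ R.list w) = cover B p.1 ∪ cover B (R.list w) := by
      ext z
      simp [mem_cover, or_and_right, exists_or]
    refine ⟨fun z => if z ∈ cover B p.1 then lab₁ z else lab₂ z + p.1.length, ?_, ?_⟩
    · intro i hi z hz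
      dsimp only at hi hz ⊢
      rw [List.getElem_append] at hz
      split_ifs at hz with hip
      · rw [if_pos (mem_cover_iff_getElem.2 ⟨i, hip, hz⟩), h₁ i hip z hz]
      · have hi' : i - p.1.length < (R.list w).length := by
          rw [List.length_append] at hi; omega
        rw [if_neg (Finset.disjoint_right.1 hC (mem_cover_iff_getElem.2 ⟨_, hi', hz⟩)),
          h₂ _ hi' z hz]
        omega
    · rw [unionN, if_neg (by simpa using hnil), e₁, e₂, hcov]
      refine unionT_ty ?_ hC ?_ ?_ s []
      · intro x hx y hy
        obtain ⟨i, hi, hx⟩ := mem_cover_iff_getElem.1 hx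
        obtain ⟨j, hj, hy⟩ := mem_cover_iff_getElem.1 hy
        rw [h₁ i hi x hx, h₂ j hj y hy, mem_bits_blackCode]
        have hi' := List.getElem_mem hi
        have hj' := List.getElem_mem hj
        have hxi := hB.self_mem _ (hp.alive _ hi')
        have hyj := hB.self_mem _ (hR.alive hw hj')
        -- Every part contains its own name, so homogeneity transfers the adjacency from the names
        -- to all vertices of the two parts.
        have : G.Adj x y ↔ G.Adj p.1[i] (R.list w)[j] := by
          rcases hhom _ hi' _ hj' with h | h
          · exact iff_of_true (h x hx y hy) (h _ hxi _ hyj)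
          · exact iff_of_false (h x hx y hy) (h _ hxi _ hyj)
        rw [this]
        constructor
        · exact fun h => ⟨i, j, hi, hj, h, rfl⟩
        · rintro ⟨i', j', hi', hj', h, he⟩
          obtain ⟨rfl, rfl⟩ := Nat.pair_eq_pair.1 he
          exact h
      · intro z hz
        exact if_pos hz
      · intro z hz
        exact if_neg (Finset.disjoint_right.1 hC hz)

theorem merged_extendAll {P : Finpartition (Finset.univ : Finset (Fin n))} {R : Records n} {s : ℕ}
    {B : Fin n → Finset (Fin n)} {Q : Fin n → Prop} (hB : Named P B) (hR : R.Describes G s B)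
    (l : List (Fin n)) (hl : ∀ w ∈ l, (B w).Nonempty ∧ ∀ x ∈ R.list w, Q x) :
    Merged R G s B Q l (extendAll G R.list R.type l) := by
  induction l using List.reverseRecOn with
  | nil => exact ⟨List.nodup_nil, by simp [extendAll], by simp [extendAll], by simp [extendAll],
      by simp, fun _ => rfl, fun h => absurd rfl h⟩
  | append_singleton l w ih =>
    rw [extendAll_append]
    exact (ih fun x hx => hl x (by simp [hx])).extend hB hR (hl w (by simp)).1 (hl w (by simp)).2

/-! ### The effect of a contraction -/

/-- The parts after the contraction of `v` into `u`. -/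
def contractParts (B : Fin n → Finset (Fin n)) (u v : Fin n) (w : Fin n) : Finset (Fin n) :=
  if w = u then B u ∪ B v else if w = v then ∅ else B w

section Contraction

variable {B : Fin n → Finset (Fin n)} {u v : Fin n}

theorem contractParts_keep : contractParts B u v u = B u ∪ B v := if_pos rfl

theorem contractParts_drop (h : u ≠ v) : contractParts B u v v = ∅ := by
  rw [contractParts, if_neg h.symm, if_pos rfl]

theorem contractParts_of_ne {w : Fin n} (hu : w ≠ u) (hv : w ≠ v) :
    contractParts B u v w = B w := by
  rw [contractParts, if_neg hu, if_neg hv]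

theorem Named.contract {P P' : Finpartition (Finset.univ : Finset (Fin n))} (hB : Named P B)
    (h : Merges P P' (B u) (B v)) : Named P' (contractParts B u v) ∧ u ≠ v ∧
      (B u).Nonempty ∧ (B v).Nonempty := by
  obtain ⟨hu, hv, hne, hP'⟩ := h
  have huv : u ≠ v := fun h => hne (by rw [h])
  have hu' := P.nonempty_of_mem_parts hu
  have hv' := P.nonempty_of_mem_parts hv
  refine ⟨⟨fun X => ?_, fun x y hxy => ?_, fun w hw => ?_⟩, huv, hu', hv'⟩
  · rw [hP', Finset.mem_insert, Finset.mem_sdiff, hB.mem_parts]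
    simp only [Finset.mem_insert, Finset.mem_singleton, not_or]
    constructor
    · rintro (rfl | ⟨⟨w, hw, rfl⟩, h₁, h₂⟩)
      · exact ⟨u, by rw [contractParts_keep]; exact hu'.mono Finset.subset_union_left,
          contractParts_keep⟩
      · have : contractParts B u v w = B w :=
          contractParts_of_ne (fun h => h₁ (by rw [h])) (fun h => h₂ (by rw [h]))
        exact ⟨w, by rwa [this], this⟩
    · rintro ⟨w, hw, rfl⟩
      by_cases hwu : w = u
      · exact Or.inl (by rw [hwu, contractParts_keep])
      by_cases hwv : w = v
      · rw [hwv, contractParts_drop huv] at hw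
        exact absurd hw Finset.not_nonempty_empty
      rw [contractParts_of_ne hwu hwv] at hw ⊢
      exact Or.inr ⟨⟨w, hw, rfl⟩, hB.ne hwu hw, hB.ne hwv hw⟩
  · have key : ∀ z w : Fin n, z ∈ contractParts B u v w → ∃ w', z ∈ B w' ∧
        (w' = w ∨ (w = u ∧ w' = v)) ∧ w ≠ v := by
      intro z w hz
      unfold contractParts at hz
      split_ifs at hz with h₁ h₂
      · rcases Finset.mem_union.1 hz with hz | hz
        · exact ⟨u, hz, Or.inl h₁.symm, h₁ ▸ huv⟩
        · exact ⟨v, hz, Or.inr ⟨h₁, rfl⟩, h₁ ▸ huv⟩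
      · exact absurd hz (Finset.notMem_empty z)
      · exact ⟨w, hz, Or.inl rfl, h₂⟩
    rw [Finset.disjoint_left]
    intro z hx hy
    obtain ⟨x', hzx, hx', hxv⟩ := key z x hx
    obtain ⟨y', hzy, hy', hyv⟩ := key z y hy
    have : x' = y' := by
      by_contra h
      exact Finset.disjoint_left.1 (hB.disjoint x' y' h) hzx hzy
    subst this
    rcases hx' with rfl | ⟨rfl, rfl⟩ <;> rcases hy' with rfl | ⟨rfl, hy'⟩
    · exact hxy rfl
    · exact hxv hy'
    · exact hyv rfl
    · exact hxy rfl
  · by_cases hwu : w = u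
    · rw [hwu, contractParts_keep]
      exact Finset.mem_union_left _ (hB.self_mem u hu')
    by_cases hwv : w = v
    · rw [hwv, contractParts_drop huv] at hw
      exact absurd hw Finset.not_nonempty_empty
    rw [contractParts_of_ne hwu hwv] at hw ⊢
    exact hB.self_mem w hw

/-- The part that contains the old part `x` after the contraction. -/
def rename (u v x : Fin n) : Fin n := if x = v then u else x

theorem rename_of_ne {x : Fin n} (h : x ≠ v) : rename u v x = x := if_neg h

theorem subset_contractParts (x : Fin n) : B x ⊆ contractParts B u v (rename u v x) := by
  by_cases hv : x = v
  · rw [rename, if_pos hv, contractParts_keep, hv]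
    exact Finset.subset_union_right
  rw [rename_of_ne hv]
  by_cases hu : x = u
  · rw [hu, contractParts_keep]
    exact Finset.subset_union_left
  · rw [contractParts_of_ne hu hv]

/-- Parts only grow, and supersets of an inhomogeneous pair are inhomogeneous. So a red edge stays
red unless its two ends become the same part. -/
theorem RedReach.contract {P' : Finpartition (Finset.univ : Finset (Fin n))}
    (hB' : Named P' (contractParts B u v)) {x y : Fin n} (h : RedReach G B x y) :
    RedReach G (contractParts B u v) (rename u v x) (rename u v y) := by
  induction h with
  | refl => exact .refl
  | @tail y z _ h ih =>
    by_cases hyz : rename u v y = rename u v z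
    · rwa [← hyz]
    · exact ih.tail ⟨hB'.ne hyz (h.nonempty_left.mono (subset_contractParts y)),
        fun h' => h.2 (h'.mono (subset_contractParts y) (subset_contractParts z))⟩

end Contraction

theorem mem_dropPart {l : List (Fin n)} (hl : l.Nodup) {v : Fin n} (hv : v ∈ l) {x : Fin n} :
    x ∈ dropPart l (l.idxOf v) v ↔ x ∈ l ∧ x ≠ v := by
  have hj : l.idxOf v < l.length := List.idxOf_lt_length_iff.2 hv
  have hvj : l[l.idxOf v] = v := List.getElem_idxOf hj
  constructor
  · intro hx
    obtain ⟨k, hk, rfl⟩ := List.getElem_of_mem hx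
    have hk' := hk
    rw [length_dropPart] at hk'
    rw [getElem_dropPart]
    split_ifs with h
    · refine ⟨List.getElem_mem _, fun he => ?_⟩
      have := hl.getElem_inj_iff.1 (he.trans hvj.symm)
      omega
    · exact ⟨List.getElem_mem _, fun he => h (hl.getElem_inj_iff.1 (he.trans hvj.symm)).symm⟩
  · rintro ⟨hx, hxv⟩
    obtain ⟨k, hk, rfl⟩ := List.getElem_of_mem hx
    have hkj : k ≠ l.idxOf v := fun h => hxv (by simp only [h]; exact hvj)
    by_cases hlast : k = l.length - 1
    · have h : l.idxOf v < (dropPart l (l.idxOf v) v).length := by rw [length_dropPart]; omega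
      have := getElem_dropPart l (l.idxOf v) v _ h
      rw [if_pos rfl] at this
      simp only [hlast, ← this]
      exact List.getElem_mem _
    · have h : k < (dropPart l (l.idxOf v) v).length := by rw [length_dropPart]; omega
      have := getElem_dropPart l (l.idxOf v) v _ h
      rw [if_neg (Ne.symm hkj)] at this
      rw [← this]
      exact List.getElem_mem _

theorem nodup_dropPart {l : List (Fin n)} (hl : l.Nodup) (j : ℕ) (v : Fin n) :
    (dropPart l j v).Nodup := by
  rw [List.nodup_iff_pairwise_ne, List.pairwise_iff_getElem]
  intro a b ha hb hab he
  rw [length_dropPart] at ha hb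
  rw [getElem_dropPart, getElem_dropPart] at he
  split_ifs at he <;> rw [hl.getElem_inj_iff] at he <;> omega

/-- The type after a contraction. -/
theorem IsType.contract {s D : ℕ} {B : Fin n → Finset (Fin n)} {u v : Fin n} {l : List (Fin n)}
    {t : ℕ} (h : IsType G s B l t) (hl : l.Nodup) (hu : u ∈ l) (hv : v ∈ l) (huv : u ≠ v)
    (hD : l.length ≤ D) :
    relabelT (l.idxOf v) (l.idxOf u) t ≤ tyBound (s + D) s ∧
    IsType G s (contractParts B u v) (dropPart l (l.idxOf v) v)
      (relabelT (l.length - 1) (l.idxOf v) (relabelT (l.idxOf v) (l.idxOf u) t)) := by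
  obtain ⟨lab, hlab, rfl⟩ := h
  have hj : l.idxOf v < l.length := List.idxOf_lt_length_iff.2 hv
  have hvj : l[l.idxOf v] = v := List.getElem_idxOf hj
  have hi : l.idxOf u < l.length := List.idxOf_lt_length_iff.2 hu
  have hui : l[l.idxOf u] = u := List.getElem_idxOf hi
  have hij : l.idxOf u ≠ l.idxOf v := fun h => huv (by
    rw [← hui, ← hvj]; simp only [h])
  rw [relabelT_ty]
  constructor
  · refine ty_cover_le fun z hz => ?_
    obtain ⟨k, hk, hz⟩ := mem_cover_iff_getElem.1 hz
    simp only [hlab k hk z hz]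
    split_ifs <;> omega
  · rw [relabelT_ty]
    -- After the first relabeling all vertices of the contracted part at position `k` have label
    -- `k`; the label of `v` is not used any more.
    have hlab' : ∀ k (hk : k < l.length), l[k] ≠ v → ∀ z ∈ contractParts B u v l[k],
        (if lab z = l.idxOf v then l.idxOf u else lab z) = k := by
      intro k hk hkv z hz
      by_cases hku : l[k] = u
      · obtain rfl : k = l.idxOf u := hl.getElem_inj_iff.1 (hku.trans hui.symm)
        rw [hku, contractParts_keep] at hz
        rcases Finset.mem_union.1 hz with hz | hz
        · rw [hlab _ hi z (by rwa [hui]), if_neg hij]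
        · rw [hlab _ hj z (by rwa [hvj]), if_pos rfl]
      · rw [contractParts_of_ne hku hkv] at hz
        rw [hlab k hk z hz, if_neg]
        intro h
        exact hkv (by simp only [h]; exact hvj)
    -- Only the part moved from the last position changes its label. Every other surviving part has
    -- a position below `l.length - 1`, so the second relabeling does not touch it.
    refine ⟨_, fun k hk z hz => ?_, congrArg (fun C => ty G C _ s []) ?_⟩
    · have hk' := hk
      rw [length_dropPart] at hk'
      have hkm := (mem_dropPart hl hv).1 (List.getElem_mem hk)
      rw [getElem_dropPart] at hz hkm
      split_ifs at hz hkm with h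
      · have := hlab' _ _ hkm.2 z hz
        rw [if_pos this, h]
      · have := hlab' _ _ hkm.2 z hz
        simp only [this]
        rw [if_neg (by omega)]
    · ext z
      simp only [mem_cover, mem_dropPart hl hv]
      constructor
      · rintro ⟨x, hx, hz⟩
        refine ⟨rename u v x, ?_, subset_contractParts x hz⟩
        by_cases hxv : x = v
        · rw [rename, if_pos hxv]
          exact ⟨hu, huv⟩
        · rw [rename_of_ne hxv]
          exact ⟨hx, hxv⟩
      · rintro ⟨x, ⟨hx, hxv⟩, hz⟩
        by_cases hxu : x = u
        · rw [hxu, contractParts_keep] at hz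
          rcases Finset.mem_union.1 hz with hz | hz
          · exact ⟨u, hu, hz⟩
          · exact ⟨v, hv, hz⟩
        · exact ⟨x, hx, by rwa [contractParts_of_ne hxu hxv] at hz⟩

end TypeCode

/-! ### Invariance of the records under contractions -/

namespace TypeCode

variable {n : ℕ} {G : SimpleGraph (Fin n)}

/-- All parts in the united list are red-reachable from the new part after the contraction, which
bounds the list by the component width. Conversely, the list without `v` is closed under red edges:
those at the new part lead to listed red neighbors, and any other red edge is an old one and lies in
an old component that is contained in the list as a whole. Components disjoint from the list are not
affected. -/
theorem Records.Describes.contract {P P' : Finpartition (Finset.univ : Finset (Fin n))}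
    {R : Records n} {s d bd : ℕ} {B : Fin n → Finset (Fin n)} {c : Contraction n}
    (hB : Named P B) (hR : R.Describes G s B) (hm : Merges P P' (B c.keep) (B c.drop))
    (hd : ComponentWidthLE G P' d) (hnd : c.red.Nodup)
    (hred : ∀ w, w ∈ c.red ↔ RedAdj G (contractParts B c.keep c.drop c.keep)
      (contractParts B c.keep c.drop w))
    (hbd : tyBound (s + (d + 1)) s ≤ bd) :
    (R.contract G c).Describes G s (contractParts B c.keep c.drop) ∧
      R.Bounded G (fun w => (B w).Nonempty) c (d + 1) bd ∧
      (R.contract G c).last = (R.contract G c).type c.keep := by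
  classical
  obtain ⟨hB', huv, hu, hv⟩ := hB.contract hm
  obtain ⟨u, v, reds⟩ := c
  dsimp only at *
  set B' := contractParts B u v with hB'def
  have hu' : (B' u).Nonempty := by
    rw [hB'def, contractParts_keep]; exact hu.mono Finset.subset_union_left
  have hv' : ¬ (B' v).Nonempty := by
    rw [hB'def, contractParts_drop huv]; exact Finset.not_nonempty_empty
  have hB'ne : ∀ {w}, w ≠ u → w ≠ v → B' w = B w := fun h₁ h₂ => contractParts_of_ne h₁ h₂
  have halive : ∀ {w}, (B' w).Nonempty → w ≠ v ∧ (B w).Nonempty := by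
    intro w hw
    have hwv : w ≠ v := by
      rintro rfl
      exact hv' hw
    refine ⟨hwv, ?_⟩
    by_cases hwu : w = u
    · rwa [hwu]
    · rwa [hB'ne hwu hwv] at hw
  have hredne : ∀ {w}, w ∈ reds → w ≠ u ∧ w ≠ v ∧ (B w).Nonempty := by
    intro w hw
    have h := (hred w).1 hw
    exact ⟨fun he => h.1 (by rw [he]), halive h.nonempty_right⟩
  have hl : ∀ w ∈ u :: v :: reds, (B w).Nonempty ∧ RedReach G B' u (rename u v w) := by
    intro w hw
    rcases List.mem_cons.1 hw with rfl | hw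
    · exact ⟨hu, by rw [rename_of_ne huv]⟩
    rcases List.mem_cons.1 hw with rfl | hw
    · exact ⟨hv, by rw [rename, if_pos rfl]⟩
    obtain ⟨-, hwv, hw'⟩ := hredne hw
    refine ⟨hw', ?_⟩
    rw [rename_of_ne hwv]
    exact .single ((hred w).1 hw)
  have hmerged : ∀ l, l <+: u :: v :: reds → Merged R G s B
      (fun x => RedReach G B' u (rename u v x)) l (extendAll G R.list R.type l) := fun l hpre =>
    merged_extendAll hB hR l fun w hw => by
      obtain ⟨h₁, h₂⟩ := hl w (hpre.subset hw)
      exact ⟨h₁, fun x hx => h₂.trans ((hR.conn h₁ hx).contract hB')⟩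
  have hlen : ∀ l, l <+: u :: v :: reds → (extendAll G R.list R.type l).1.length ≤ d + 1 ∧
      (extendAll G R.list R.type l).2 ≤ bd := by
    intro l hpre
    have hp := hmerged l hpre
    -- Without `v`, the names lie in one red component after the contraction, so there are at most
    -- `d` of them; `v` itself accounts for the one additional entry.
    have h1 : (extendAll G R.list R.type l).1.length ≤ d + 1 := by
      have := length_le_of_redReach hB' hd hu' (hp.nodup.erase v) fun x hx => by
        obtain ⟨hxv, hx⟩ := hp.nodup.mem_erase_iff.1 hx
        have := hp.inv x hx
        rwa [rename_of_ne hxv] at this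
      have h2 := List.length_erase_le (a := v) (l := (extendAll G R.list R.type l).1)
      have h3 := List.le_length_erase (a := v) (l := (extendAll G R.list R.type l).1)
      omega
    refine ⟨h1, ?_⟩
    by_cases hnil : (extendAll G R.list R.type l).1 = []
    · rw [hp.nil hnil]; exact Nat.zero_le _
    · exact ((hp.isType hnil).le h1).trans hbd
  have hp := hmerged _ List.prefix_rfl
  have hplen := (hlen _ List.prefix_rfl).1
  have hpdef : R.merged G ⟨u, v, reds⟩ = extendAll G R.list R.type (u :: v :: reds) := rfl
  rw [← hpdef] at hp hplen
  set p := R.merged G ⟨u, v, reds⟩ with hpset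
  have hup : u ∈ p.1 := hp.subset (by simp)
  have hvp : v ∈ p.1 := hp.subset (by simp)
  have hredp : ∀ w ∈ reds, w ∈ p.1 := fun w hw => hp.subset (by simp [hw])
  have hpne : p.1 ≠ [] := List.ne_nil_of_mem hup
  obtain ⟨hrel, htype⟩ := (hp.isType hpne).contract hp.nodup hup hvp huv hplen
  have hq : ∀ {x}, x ∈ R.newList G ⟨u, v, reds⟩ ↔ x ∈ p.1 ∧ x ≠ v := mem_dropPart hp.nodup hvp
  have hqnd : (R.newList G ⟨u, v, reds⟩).Nodup := nodup_dropPart hp.nodup _ _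
  have hqlen : (R.newList G ⟨u, v, reds⟩).length ≤ d + 1 := by
    rw [Records.newList, length_dropPart]; exact (Nat.sub_le _ _).trans hplen
  have hqu : u ∈ R.newList G ⟨u, v, reds⟩ := hq.2 ⟨hup, huv⟩
  have hpos : ∀ {w}, w ∈ R.newList G ⟨u, v, reds⟩ →
      (R.contract G ⟨u, v, reds⟩).list w = R.newList G ⟨u, v, reds⟩ := fun h => if_pos h
  have hneg : ∀ {w}, w ∉ R.newList G ⟨u, v, reds⟩ →
      (R.contract G ⟨u, v, reds⟩).list w = R.list w := fun h => if_neg h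
  have tpos : ∀ {w}, w ∈ R.newList G ⟨u, v, reds⟩ →
      (R.contract G ⟨u, v, reds⟩).type w = R.newType G ⟨u, v, reds⟩ := fun h => if_pos h
  have tneg : ∀ {w}, w ∉ R.newList G ⟨u, v, reds⟩ →
      (R.contract G ⟨u, v, reds⟩).type w = R.type w := fun h => if_neg h
  have hreach : ∀ {x}, x ∈ R.newList G ⟨u, v, reds⟩ → RedReach G B' u x := by
    intro x hx
    obtain ⟨hx, hxv⟩ := hq.1 hx
    have := hp.inv x hx
    rwa [rename_of_ne hxv] at this
  -- The united list consists of whole old components, so a component with a part outside of it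
  -- avoids it completely.
  have hout : ∀ {w}, (B' w).Nonempty → w ∉ R.newList G ⟨u, v, reds⟩ → ∀ {x}, x ∈ R.list w →
      x ∉ p.1 ∧ x ≠ u ∧ x ≠ v ∧ x ∉ R.newList G ⟨u, v, reds⟩ := by
    intro w hw hwq x hx
    obtain ⟨hwv, hw'⟩ := halive hw
    have hxp : x ∉ p.1 := by
      intro hxp
      refine hwq (hq.2 ⟨hp.list_subset x hxp ?_, hwv⟩)
      rw [hR.list_eq hw' hx]
      exact hR.self_mem hw'
    exact ⟨hxp, fun h => hxp (h ▸ hup), fun h => hxp (h ▸ hvp), fun h => hxp (hq.1 h).1⟩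
  refine ⟨⟨?_, ?_, ?_, ?_, ?_, ?_, ?_, ?_⟩, ⟨fun w hw => (hl w hw).1, fun w hw => ?_, hlen, hup, hvp,
    hrel.trans hbd, (htype.le hqlen).trans hbd, ?_⟩, (tpos hqu).symm⟩
  · intro w hw
    by_cases hwq : w ∈ R.newList G ⟨u, v, reds⟩
    · rwa [hpos hwq]
    · rw [hneg hwq]
      exact hR.self_mem (halive hw).2
  · intro w hw
    by_cases hwq : w ∈ R.newList G ⟨u, v, reds⟩
    · rwa [hpos hwq]
    · rw [hneg hwq]
      exact hR.nodup (halive hw).2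
  · intro w x hw hx
    by_cases hwq : w ∈ R.newList G ⟨u, v, reds⟩
    · rw [hpos hwq] at hx
      obtain ⟨hx, hxv⟩ := hq.1 hx
      have := (hp.alive x hx).mono (subset_contractParts (u := u) (v := v) x)
      rwa [rename_of_ne hxv] at this
    · rw [hneg hwq] at hx
      obtain ⟨-, hxu, hxv, -⟩ := hout hw hwq hx
      rw [hB'ne hxu hxv]
      exact hR.alive (halive hw).2 hx
  · intro w x hw hx
    by_cases hwq : w ∈ R.newList G ⟨u, v, reds⟩
    · rw [hpos hwq] at hx ⊢
      rw [hpos hx]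
    · rw [hneg hwq] at hx ⊢
      rw [hneg (hout hw hwq hx).2.2.2]
      exact hR.list_eq (halive hw).2 hx
  · intro w x hw hx
    by_cases hwq : w ∈ R.newList G ⟨u, v, reds⟩
    · rw [hpos hwq] at hx
      rw [tpos hwq, tpos hx]
    · rw [hneg hwq] at hx
      rw [tneg hwq, tneg (hout hw hwq hx).2.2.2]
      exact hR.type_eq (halive hw).2 hx
  -- The red edge `xy` after the contraction is either incident to `u`, where the given red
  -- neighbors decide, or it was red before.
  · intro w x y hw hx hxy
    obtain ⟨hyv, hy⟩ := halive hxy.nonempty_right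
    by_cases hwq : w ∈ R.newList G ⟨u, v, reds⟩
    · rw [hpos hwq] at hx ⊢
      obtain ⟨hxp, hxv⟩ := hq.1 hx
      refine hq.2 ⟨?_, hyv⟩
      by_cases hxu : x = u
      · rw [hxu] at hxy
        exact hredp y ((hred y).2 hxy)
      by_cases hyu : y = u
      · rwa [hyu]
      rw [hB'ne hxu hxv, hB'ne hyu hyv] at hxy
      exact hp.list_subset x hxp (hR.closed (hp.alive x hxp) (hR.self_mem (hp.alive x hxp)) hxy)
    · rw [hneg hwq] at hx ⊢
      obtain ⟨hxp, hxu, hxv, -⟩ := hout hw hwq hx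
      by_cases hyu : y = u
      · rw [hyu] at hxy
        exact absurd (hredp x ((hred x).2 hxy.symm)) hxp
      rw [hB'ne hxu hxv, hB'ne hyu hyv] at hxy
      exact hR.closed (halive hw).2 hx hxy
  · intro w x hw hx
    by_cases hwq : w ∈ R.newList G ⟨u, v, reds⟩
    · rw [hpos hwq] at hx
      exact (hreach hwq).symm.trans (hreach hx)
    · rw [hneg hwq] at hx
      obtain ⟨-, hxu, hxv, -⟩ := hout hw hwq hx
      have := (hR.conn (halive hw).2 hx).contract hB'
      rwa [rename_of_ne (halive hw).1, rename_of_ne hxv] at this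
  · intro w hw
    by_cases hwq : w ∈ R.newList G ⟨u, v, reds⟩
    · rw [hpos hwq, tpos hwq]
      exact htype
    · rw [hneg hwq, tneg hwq]
      obtain ⟨lab, h, he⟩ := hR.isType (halive hw).2
      have hBe : ∀ x ∈ R.list w, B' x = B x := fun x hx => by
        obtain ⟨-, hxu, hxv, -⟩ := hout hw hwq hx
        exact hB'ne hxu hxv
      refine ⟨lab, fun i hi z hz => h i hi z ?_, ?_⟩
      · rwa [hBe _ (List.getElem_mem hi)] at hz
      · rw [he]
        congr 1
        ext z
        simp only [mem_cover]
        exact exists_congr fun x => and_congr_right fun hx => by rw [hBe x hx]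
  · have hw' := (hl w hw).1
    refine ((hR.isType hw').le ?_).trans hbd
    have hp₁ := hp.list_subset w (hp.subset hw)
    rw [← List.toFinset_card_of_nodup (hR.nodup hw')]
    refine le_trans (Finset.card_le_card fun x hx => ?_) ((List.toFinset_card_le p.1).trans hplen)
    rw [List.mem_toFinset] at hx ⊢
    exact hp₁ hx
  · refine le_trans (length_le_of_redReach hB' hd hu' hnd fun x hx => ?_) (Nat.le_succ d)
    exact .single ((hred x).1 hx)

/-- Two singletons are always homogeneous, so there are no red edges and every component is a single
vertex. -/
theorem Records.describes_initial (s : ℕ) :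
    (Records.initial n s).Describes G s fun w => {w} where
  self_mem _ := List.mem_singleton_self _
  nodup _ := List.nodup_singleton _
  alive _ _ := Finset.singleton_nonempty _
  list_eq _ hx := by rw [List.mem_singleton.1 hx]
  type_eq _ _ := rfl
  closed {w x y} _ _ h := by
    refine absurd ?_ h.2
    by_cases hxy : G.Adj x y
    · exact Or.inl fun a ha b hb => by
        rwa [Finset.mem_singleton.1 ha, Finset.mem_singleton.1 hb]
    · exact Or.inr fun a ha b hb => by
        rwa [Finset.mem_singleton.1 ha, Finset.mem_singleton.1 hb]
  conn _ hx := by rw [List.mem_singleton.1 hx]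
  isType {w} _ := by
    refine ⟨fun _ => 0, fun i hi z _ => ?_, ?_⟩
    · simp only [Records.initial, List.length_singleton] at hi
      exact (Nat.lt_one_iff.1 hi).symm
    · have : cover (fun w : Fin n => {w}) ((Records.initial n s).list w) = {w} := by
        ext z
        simp [mem_cover, Records.initial]
      rw [this]
      exact leafT_eq_ty (G := G) (lab := fun _ => 0) (u := w) rfl s [] [] (by simp)

theorem block_append (cs : List (Contraction n)) (c : Contraction n) :
    block (cs ++ [c]) = contractParts (block cs) c.keep c.drop := by
  rw [block, List.foldl_append]
  rfl

/-- The state after `t` contractions. -/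
theorem describes_after {P : ℕ → Finpartition (Finset.univ : Finset (Fin n))}
    {cs : List (Contraction n)} {s d bd : ℕ} (hn : 0 < n) (hP : IsPartitionSequence P)
    (hd : ∀ i, 1 ≤ i → i ≤ n → ComponentWidthLE G (P i) d) (hcs : Describes G P cs)
    (hbd : tyBound (s + (d + 1)) s ≤ bd) (t : ℕ) (ht : t ≤ cs.length) :
    Named (P (n - t)) (block (cs.take t)) ∧
    (Records.after G s (cs.take t)).Describes G s (block (cs.take t)) ∧
    (∃ w, (block (cs.take t) w).Nonempty ∧
      (Records.after G s (cs.take t)).last = (Records.after G s (cs.take t)).type w) ∧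
    (∀ c ∈ cs.take t, block (cs.take t) c.drop = ∅) ∧
    ∀ h : t < cs.length, (Records.after G s (cs.take t)).Bounded G
      (fun w => ∀ c ∈ cs.take t, w ≠ c.drop) cs[t] (d + 1) bd := by
  have step : ∀ t (h : t < cs.length), Named (P (n - t)) (block (cs.take t)) →
      (Records.after G s (cs.take t)).Describes G s (block (cs.take t)) → _ := fun t h hB hR =>
    hR.contract (c := cs[t]) (d := d) (bd := bd) hB (hcs.2 t h).1
      (hd (n - (t + 1)) (by have := hcs.1; omega) (by omega))
      (hcs.2 t h).2.1 (by
        have := (hcs.2 t h).2.2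
        rwa [List.take_succ_eq_append_getElem h, block_append] at this) hbd
  -- The heap guarantees pointers for names that have not been dropped, whereas
  -- `Records.Describes.contract` speaks of nonempty parts. Dropped names have empty parts, which
  -- links the two.
  have bound : ∀ t (h : t < cs.length), Named (P (n - t)) (block (cs.take t)) →
      (Records.after G s (cs.take t)).Describes G s (block (cs.take t)) →
      (∀ c ∈ cs.take t, block (cs.take t) c.drop = ∅) →
      (Records.after G s (cs.take t)).Bounded G
        (fun w => ∀ c ∈ cs.take t, w ≠ c.drop) cs[t] (d + 1) bd := by
    intro t h hB hR hdead
    obtain ⟨-, hbdd, -⟩ := step t h hB hR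
    exact { hbdd with
      alive := fun w hw c hc he => by
        have := hbdd.alive w hw
        rw [he, hdead c hc] at this
        exact Finset.not_nonempty_empty this }
  induction t with
  | zero =>
    have hB : Named (P (n - 0)) (block (cs.take 0)) := by
      rw [List.take_zero, Nat.sub_zero]
      refine ⟨fun X => ?_, fun x y hxy => Finset.disjoint_singleton.2 hxy,
        fun w _ => Finset.mem_singleton_self w⟩
      have := hP.1
      rw [Fintype.card_fin] at this
      rw [this]
      simp [block]
    have hR : (Records.after G s (cs.take 0)).Describes G s (block (cs.take 0)) := by
      rw [List.take_zero]
      exact Records.describes_initial s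
    exact ⟨hB, hR, ⟨⟨0, hn⟩, Finset.singleton_nonempty _, rfl⟩, by simp,
      fun h => bound 0 h hB hR (by simp)⟩
  | succ t ih =>
    have h : t < cs.length := ht
    obtain ⟨hB, hR, -, hdead, -⟩ := ih h.le
    obtain ⟨hR', hbdd, hlast⟩ := step t h hB hR
    obtain ⟨hB', huv, hu, hv⟩ := hB.contract (hcs.2 t h).1
    have htake : cs.take (t + 1) = cs.take t ++ [cs[t]] := List.take_succ_eq_append_getElem h
    have hafter : Records.after G s (cs.take (t + 1)) =
        (Records.after G s (cs.take t)).contract G cs[t] := by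
      rw [htake, Records.after, List.foldl_append]; rfl
    have hblock : block (cs.take (t + 1)) =
        contractParts (block (cs.take t)) cs[t].keep cs[t].drop := by
      rw [htake, block_append]
    rw [← hblock] at hB' hR'
    rw [← hafter] at hR' hlast
    -- A dropped name never comes back: its part is empty, but the part of `keep` in a contraction
    -- is nonempty.
    have hdead' : ∀ c ∈ cs.take (t + 1), block (cs.take (t + 1)) c.drop = ∅ := by
      intro c hc
      rw [hblock]
      by_cases hcd : c.drop = cs[t].drop
      · rw [hcd, contractParts_drop huv]
      · rw [htake] at hc
        rcases List.mem_append.1 hc with hc | hc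
        · rw [contractParts_of_ne _ hcd, hdead c hc]
          intro he
          rw [← he, hdead c hc] at hu
          exact Finset.not_nonempty_empty hu
        · exact absurd (by rw [List.mem_singleton.1 hc]) hcd
    refine ⟨hB', hR', ⟨cs[t].keep, ?_, hlast⟩, hdead', fun h' => bound _ h' hB' hR' hdead'⟩
    rw [hblock, contractParts_keep]
    exact hu.mono Finset.subset_union_left

/-- After `n - 1` contractions the only part is the whole vertex set, so the component changed last
covers all of `G`. Its labels are irrelevant for sentences over `{E}`. -/
theorem last_after {P : ℕ → Finpartition (Finset.univ : Finset (Fin n))}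
    {cs : List (Contraction n)} {d : ℕ} (s : ℕ) (hn : 0 < n) (hP : IsPartitionSequence P)
    (hd : ∀ i, 1 ≤ i → i ≤ n → ComponentWidthLE G (P i) d) (hcs : Describes G P cs) :
    ∃ lab, (Records.after G s cs).last = ty G Finset.univ lab s [] := by
  obtain ⟨hB, hR, ⟨w, hw, hlast⟩, -⟩ := describes_after (s := s) hn hP hd hcs le_rfl _ le_rfl
  rw [List.take_length] at hB hR hw hlast
  obtain ⟨lab, -, he⟩ := hR.isType hw
  refine ⟨lab, ?_⟩
  rw [hlast, he]
  congr 1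
  have hpart : block cs w ∈ (P (n - cs.length)).parts := (hB.mem_parts _).2 ⟨w, hw, rfl⟩
  rw [show n - cs.length = 1 by have := hcs.1; omega, hP.2.1, Finset.mem_singleton] at hpart
  rw [Finset.eq_univ_iff_forall]
  intro z
  exact mem_cover.2 ⟨w, hR.self_mem hw, by rw [hpart]; exact Finset.mem_univ z⟩

end TypeCode

namespace RAM

open TypeCode

/-! ### The input word -/

section Input

variable {n : ℕ} {φ : MSO Empty 0 0} {d : ℕ} {G : SimpleGraph (Fin n)} [DecidableRel G.Adj]
  {cs : List (Contraction n)}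

theorem getD_flatMap {α : Type*} {f : α → List ℕ} {n : ℕ} (hf : ∀ a, (f a).length = n) :
    ∀ (l : List α) (i : ℕ) (hi : i < l.length) (j : ℕ), j < n →
      (l.flatMap f).getD (i * n + j) 0 = (f l[i]).getD j 0
  | a :: l, 0, _, j, hj => by
    rw [List.flatMap_cons, Nat.zero_mul, Nat.zero_add, List.getD_append _ _ _ _ (by rwa [hf])]
    rfl
  | a :: l, i + 1, hi, j, hj => by
    rw [List.flatMap_cons, List.getD_append_right _ _ _ _ (by rw [hf, Nat.succ_mul]; omega), hf,
      show (i + 1) * n + j - n = i * n + j by rw [Nat.succ_mul]; omega,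
      getD_flatMap hf l i (by simpa using hi) j hj]
    rfl

theorem length_adjacencyWord : (adjacencyWord G).length = n * n := by
  simp [adjacencyWord, List.length_flatMap]

theorem getD_inputWord (i : ℕ) : (inputWord φ d G cs).getD (3 + i) 0 =
    (φ.encode ++ (adjacencyWord G ++ cs.flatMap Contraction.word)).getD i 0 := by
  rw [add_comm, ← List.append_assoc]
  rfl

theorem getD_inputWord_encode {i : ℕ} (hi : i < φ.encode.length) :
    (inputWord φ d G cs).getD (3 + i) 0 = φ.encode[i] := by
  rw [getD_inputWord, List.getD_append _ _ _ _ hi, List.getD_eq_getElem _ _ hi]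

theorem getD_inputWord_adj (x y : Fin n) :
    (inputWord φ d G cs).getD (3 + φ.encode.length + x * n + y) 0 = if G.Adj x y then 1 else 0 := by
  have hlt : (x : ℕ) * n + y < n * n := by
    have := Nat.mul_le_mul_right n (Nat.succ_le_of_lt x.2)
    rw [Nat.succ_mul] at this
    have := y.2
    omega
  rw [show 3 + φ.encode.length + x * n + y = 3 + (φ.encode.length + (x * n + y)) by omega,
    getD_inputWord, List.getD_append_right _ _ _ _ (by omega), Nat.add_sub_cancel_left,
    List.getD_append _ _ _ _ (by rwa [length_adjacencyWord]), adjacencyWord,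
    getD_flatMap (by simp) _ _ (by simp) _ y.2]
  rw [List.getD_eq_getElem _ _ (by simp)]
  simp

theorem getD_inputWord_contraction {t : ℕ} (ht : t < cs.length) {i : ℕ}
    (hi : i < cs[t].word.length) :
    (inputWord φ d G cs).getD (offset φ.encode.length (cs.take t) + i) 0 = cs[t].word[i] := by
  rw [offset, show 3 + φ.encode.length + n * n + ((cs.take t).flatMap Contraction.word).length + i =
    3 + (φ.encode.length + (n * n + (((cs.take t).flatMap Contraction.word).length + i))) by omega,
    getD_inputWord, List.getD_append_right _ _ _ _ (by omega), Nat.add_sub_cancel_left,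
    List.getD_append_right _ _ _ _ (by rw [length_adjacencyWord]; omega), length_adjacencyWord,
    Nat.add_sub_cancel_left]
  conv_lhs =>
    rw [← List.take_append_drop t cs, List.drop_eq_getElem_cons ht, List.flatMap_append,
      List.flatMap_cons]
  rw [List.getD_append_right _ _ _ _ (by simp), List.take_append_of_le_length (by simp; omega),
    List.take_take, min_self, Nat.add_sub_cancel_left, List.getD_append _ _ _ _ hi,
    List.getD_eq_getElem _ _ hi]

end Input

/-- A bound on the codes of lists of length `k` with entries at most `b`. -/
def codeBound (b : ℕ) : ℕ → ℕ
  | 0 => 0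
  | k + 1 => Nat.succ (Nat.pair b (codeBound b k))

theorem encode_le_codeBound {b : ℕ} : ∀ l : List ℕ, (∀ x ∈ l, x ≤ b) →
    Encodable.encode l ≤ codeBound b l.length
  | [], _ => le_rfl
  | x :: l, h => by
    rw [encode_cons, List.length_cons, codeBound]
    exact Nat.succ_le_succ (pair_le_pair (h x (by simp))
      (encode_le_codeBound l fun y hy => h y (by simp [hy])))

theorem evalN_encode {n : ℕ} (G : SimpleGraph (Fin n)) (φ : MSO Empty 0 0) (lab : Fin n → ℕ) :
    (G.toStructure.Models φ →
      evalN (Encodable.encode φ.encode) (ty G Finset.univ lab φ.size []) = 1) ∧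
    (¬ G.toStructure.Models φ →
      evalN (Encodable.encode φ.encode) (ty G Finset.univ lab φ.size []) = 0) := by
  have h := evalT_ty_sentence (G := G) (lab := lab) φ
  rw [evalN, Encodable.encodek, Option.getD_some]
  constructor
  · intro hm
    rw [h.2 hm]; rfl
  · intro hm
    rw [Bool.eq_false_iff.2 fun he => hm (h.1 he)]; rfl

/-- The program is fixed before `φ` and `d`. These enter only through the bound `bd` on the numbers
passed to the routines, and `f` is a generous sum of all constants depending on it. -/
theorem exists_modelChecker : ∃ (prog : List Instr) (f : ℕ → ℕ → ℕ),
    ∀ (φ : MSO Empty 0 0) (d n : ℕ) (G : SimpleGraph (Fin n)) [DecidableRel G.Adj]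
      (P : ℕ → Finpartition (Finset.univ : Finset (Fin n))) (cs : List (Contraction n)),
      0 < n → IsPartitionSequence P →
      (∀ i, 1 ≤ i → i ≤ n → ComponentWidthLE G (P i) d) →
      Describes G P cs →
      (G.toStructure.Models φ →
        RAM.Outputs prog (inputWord φ d G cs) (f φ.size d * n) (f φ.size d * n ^ 2) 1) ∧
      (¬ G.toStructure.Models φ →
        RAM.Outputs prog (inputWord φ d G cs) (f φ.size d * n) (f φ.size d * n ^ 2) 0) := by
  obtain ⟨M, K, hK, hM⟩ := exists_routines
  choose T N₀ hM using hM
  -- The summands bound the types with up to `d + 1` parts, the code of the sentence, the depth of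
  -- the trees, and the coded sets of black pairs. The extra part is the dropped one, which is still
  -- present while components are being united.
  let bd : ℕ → ℕ → ℕ := fun s d =>
    tyBound (s + (d + 1)) s + codeBound (s + 7) s + s + 2 ^ (d + 1 + 1) ^ 2
  let f : ℕ → ℕ → ℕ := fun s d => N₀ (bd s d) + bd s d + K + 100 + 10 * d + 10 * s +
    s * (3 + T (bd s d) + 2) + 2 * T (bd s d) + stepTime (d + 1) (T (bd s d))
  refine ⟨(mainCmd M K).compile 0, f, fun φ d n G _ P cs hn hP hd hcs => ?_⟩
  obtain ⟨lab, hlab⟩ := last_after φ.size hn hP hd hcs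
  obtain ⟨hb₁, hb₂, hb₃, hb₄⟩ : tyBound (φ.size + (d + 1)) φ.size ≤ bd φ.size d ∧
      codeBound (φ.size + 7) φ.size ≤ bd φ.size d ∧ φ.size ≤ bd φ.size d ∧
      2 ^ (d + 1 + 1) ^ 2 ≤ bd φ.size d := by
    simp only [bd]
    generalize 2 ^ (d + 1 + 1) ^ 2 = x
    omega
  have hbd : ∀ {t : ℕ}, t ≤ cs.length → _ := fun {t} ht =>
    describes_after (s := φ.size) (bd := bd φ.size d) hn hP hd hcs hb₁ t ht
  have hcode : Encodable.encode φ.encode ≤ bd φ.size d := by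
    have h : ∀ x ∈ φ.encode, x ≤ φ.size + 7 := fun x hx => by
      have := encode_le φ x hx
      omega
    exact (encode_le_codeBound _ h).trans hb₂
  have hleaf : leafT φ.size [] ≤ bd φ.size d := by
    have h := (Records.describes_initial (G := G) φ.size).isType (w := ⟨0, hn⟩)
      (Finset.singleton_nonempty _)
    exact (h.le (D := d + 1) (by simp [Records.initial])).trans hb₁
  have hsq : n ^ 2 = n * n := sq n
  have hnn : n ≤ n * n := Nat.le_mul_of_pos_left n hn
  -- As `n > 0`, constants can be absorbed into multiples of `n ^ 2`.
  have hf : ∀ a b, a + b ≤ f φ.size d → a + b * (n * n) ≤ f φ.size d * n ^ 2 := by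
    intro a b hab
    rw [hsq]
    have h1 : a ≤ a * (n * n) := Nat.le_mul_of_pos_right a (by positivity)
    have h2 := Nat.mul_le_mul_right (n * n) hab
    rw [add_mul] at h2
    omega
  have hrun := runs_mainCmd (hM (bd φ.size d)) (N := f φ.size d * n ^ 2) (D := d + 1)
    (inp := inputWord φ d G cs) (toks := φ.encode) (G := G) (cs := cs) (n := n)
    (by
      have := hf (N₀ (bd φ.size d)) 0 (by simp only [f]; omega)
      omega)
    hK rfl rfl (fun i hi => getD_inputWord_encode hi) getD_inputWord_adj
    (fun t ht i hi => getD_inputWord_contraction ht hi) hcs.1 hcode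
    hb₃ hleaf hb₄
    (fun t ht => (hbd ht.le).2.2.2.2 ht)
    (by
      have := hf (bd φ.size d) 0 (by simp only [f]; omega)
      omega)
    (by
      change K + 8 + 7 * n + n * (d + 1 + 2) + (d + 1) + φ.size ≤ _
      have h := hf (K + 8 + (d + 1) + φ.size) (7 + (d + 1 + 2)) (by simp only [f]; omega)
      have h' := Nat.mul_le_mul_left (7 + (d + 1 + 2)) hnn
      rw [add_mul 7, mul_comm (d + 1 + 2) n] at h'
      omega)
    (by
      change 7 + φ.size + n * n + n * (d + 1 + 3) + (d + 1) + n ≤ _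
      have h := hf (7 + φ.size + (d + 1)) (2 + (d + 1 + 3)) (by simp only [f]; omega)
      have h' := Nat.mul_le_mul_left (d + 1 + 3) hnn
      rw [mul_comm (d + 1 + 3) n] at h'
      rw [add_mul 2] at h
      omega)
  obtain ⟨m', t, ht, hbig, hm'⟩ := hrun
  have htime : t ≤ f φ.size d * n := by
    refine ht.trans ?_
    change mainTime φ.size (d + 1) (T (bd φ.size d)) n ≤ _
    have h1 : ∀ a, a ≤ a * n := fun a => Nat.le_mul_of_pos_right a hn
    have h2 := h1 (8 + (φ.size * (3 + T (bd φ.size d) + 2) + 1 + T (bd φ.size d)) + 9 + 1 + 1 + 1 +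
      T (bd φ.size d))
    have h3 : (n - 1) * (stepTime (d + 1) (T (bd φ.size d)) + 1 + 2) ≤
        (stepTime (d + 1) (T (bd φ.size d)) + 1 + 2) * n := by
      rw [mul_comm]
      exact Nat.mul_le_mul_left _ (Nat.sub_le _ _)
    have h4 : (8 + (φ.size * (3 + T (bd φ.size d) + 2) + 1 + T (bd φ.size d)) + 9 + 1 + 1 + 1 +
      T (bd φ.size d)) + (stepTime (d + 1) (T (bd φ.size d)) + 1 + 2) + 15 ≤ f φ.size d := by
      simp only [f]; omega
    have h5 := Nat.mul_le_mul_right n h4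
    rw [add_mul _ 15, add_mul _ (stepTime (d + 1) (T (bd φ.size d)) + 1 + 2)] at h5
    rw [mainTime]
    omega
  have hout : ∀ b, m' 0 = b → Outputs ((mainCmd M K).compile 0) (inputWord φ d G cs)
      (f φ.size d * n) (f φ.size d * n ^ 2) b := fun b hb => hb ▸ hbig.outputs htime
  obtain ⟨hpos, hneg⟩ := evalN_encode G φ lab
  rw [← hlab] at hpos hneg
  exact ⟨fun h => hout 1 (hm'.trans (hpos h)), fun h => hout 0 (hm'.trans (hneg h))⟩

end RAM

/-! ### Ehrenfeucht-Fraïssé games and types -/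

section Games

variable {κ V W : Type*} {A : LabeledGraph κ V} {B : LabeledGraph κ W}

/-- Duplicator can survive one round less. -/
theorem DuplicatorSurvives.of_succ : ∀ (q : ℕ) {e s : ℕ} {a : Fin e → V} {S : Fin s → Set V}
    {b : Fin e → W} {T : Fin s → Set W}, DuplicatorSurvives A B (q + 1) a S b T →
      DuplicatorSurvives A B q a S b T
  | 0, _, _, _, _, _, _, h => by
    -- The superfluous round is spent on the empty set; forgetting that set leaves a partial
    -- isomorphism.
    obtain ⟨Y, h₁, h₂, h₃, h₄⟩ := h.2.2.1 ∅
    exact ⟨h₁, h₂, h₃, fun X i => h₄ X.succ i⟩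
  | q + 1, _, _, _, _, _, _, h =>
    ⟨fun v => (h.1 v).imp fun _ h => of_succ q h, fun w => (h.2.1 w).imp fun _ h => of_succ q h,
      fun X => (h.2.2.1 X).imp fun _ h => of_succ q h,
      fun Y => (h.2.2.2 Y).imp fun _ h => of_succ q h⟩

theorem DuplicatorSurvives.partialIso : ∀ (q : ℕ) {e s : ℕ} {a : Fin e → V} {S : Fin s → Set V}
    {b : Fin e → W} {T : Fin s → Set W}, DuplicatorSurvives A B q a S b T → PartialIso A B a S b T
  | 0, _, _, _, _, _, _, h => h
  | q + 1, _, _, _, _, _, _, h => partialIso q (of_succ q h)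

theorem DuplicatorSurvives.sat_iff {e s : ℕ} (φ : MSO κ e s) : ∀ {q : ℕ} {a : Fin e → V}
    {S : Fin s → Set V} {b : Fin e → W} {T : Fin s → Set W}, DuplicatorSurvives A B q a S b T →
      φ.rank ≤ q → (φ.Sat A a S ↔ φ.Sat B b T) := by
  induction φ with
  | falsum => exact fun _ _ => Iff.rfl
  | eq x y => exact fun h _ => (h.partialIso _).1 x y
  | edge x y => exact fun h _ => (h.partialIso _).2.1 x y
  | lab c x => exact fun h _ => (h.partialIso _).2.2.1 c x
  | mem x X => exact fun h _ => (h.partialIso _).2.2.2 X x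
  | neg φ ih => exact fun h hq => not_congr (ih h hq)
  | conj φ ψ ih₁ ih₂ =>
    intro q a S b T h hq
    exact and_congr (ih₁ h ((le_max_left _ _).trans hq)) (ih₂ h ((le_max_right _ _).trans hq))
  | exVertex φ ih =>
    intro q a S b T h hq
    cases q with
    | zero => exact absurd hq (Nat.not_succ_le_zero _)
    | succ q =>
      constructor
      · rintro ⟨v, hv⟩
        obtain ⟨w, hw⟩ := h.1 v
        exact ⟨w, (ih hw (Nat.le_of_succ_le_succ hq)).1 hv⟩
      · rintro ⟨w, hw⟩
        obtain ⟨v, hv⟩ := h.2.1 w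
        exact ⟨v, (ih hv (Nat.le_of_succ_le_succ hq)).2 hw⟩
  | exSet φ ih =>
    intro q a S b T h hq
    cases q with
    | zero => exact absurd hq (Nat.not_succ_le_zero _)
    | succ q =>
      constructor
      · rintro ⟨X, hX⟩
        obtain ⟨Y, hY⟩ := h.2.2.1 X
        exact ⟨Y, (ih hY (Nat.le_of_succ_le_succ hq)).1 hX⟩
      · rintro ⟨Y, hY⟩
        obtain ⟨X, hX⟩ := h.2.2.2 Y
        exact ⟨X, (ih hX (Nat.le_of_succ_le_succ hq)).2 hY⟩

theorem MSOEquiv.rankType_eq {q : ℕ} (h : MSOEquiv q A B) : A.rankType q = B.rankType q := by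
  ext φ
  exact and_congr_right fun hq => h.sat_iff φ hq

/-- One formula must act as the conjunction in both structures, so `A` and `B` are treated together.
The empty conjunction is the negation of `falsum`. -/
theorem MSO.exists_conj (A : LabeledGraph κ V) (B : LabeledGraph κ W) {ι : Type*} [Finite ι]
    {e s q : ℕ} (φ : ι → MSO κ e s) (hφ : ∀ i, (φ i).rank ≤ q) :
    ∃ ψ : MSO κ e s, ψ.rank ≤ q ∧ (∀ a S, ψ.Sat A a S ↔ ∀ i, (φ i).Sat A a S) ∧
      ∀ b T, ψ.Sat B b T ↔ ∀ i, (φ i).Sat B b T := by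
  suffices H : ∀ l : List ι, ∃ ψ : MSO κ e s, ψ.rank ≤ q ∧
      (∀ a S, ψ.Sat A a S ↔ ∀ i ∈ l, (φ i).Sat A a S) ∧
      ∀ b T, ψ.Sat B b T ↔ ∀ i ∈ l, (φ i).Sat B b T by
    have := Fintype.ofFinite ι
    simpa using H Finset.univ.toList
  intro l
  induction l with
  | nil => exact ⟨.neg .falsum, Nat.zero_le _, fun a S => by simp [MSO.Sat],
      fun b T => by simp [MSO.Sat]⟩
  | cons i l ih =>
    obtain ⟨ψ, h₁, h₂, h₃⟩ := ih
    exact ⟨.conj (φ i) ψ, max_le (hφ i) h₁, fun a S => by simp [MSO.Sat, h₂],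
      fun b T => by simp [MSO.Sat, h₃]⟩

/-- If every `i` is distinguished from a fixed position by some formula, then some formula
distinguishes all of them. -/
theorem MSO.exists_separating {ι : Type*} [Finite ι] {e s q : ℕ} {a : Fin e → V}
    {S : Fin s → Set V} {b : ι → Fin e → W} {T : ι → Fin s → Set W}
    (h : ∀ i, ¬ ∀ φ : MSO κ e s, φ.rank ≤ q → (φ.Sat A a S ↔ φ.Sat B (b i) (T i))) :
    ∃ ψ : MSO κ e s, ψ.rank ≤ q ∧ ψ.Sat A a S ∧ ∀ i, ¬ ψ.Sat B (b i) (T i) := by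
  have h' : ∀ i, ∃ φ : MSO κ e s, φ.rank ≤ q ∧ φ.Sat A a S ∧ ¬ φ.Sat B (b i) (T i) := by
    intro i
    have := h i
    push Not at this
    obtain ⟨φ, hq, ⟨h₁, h₂⟩ | ⟨h₁, h₂⟩⟩ := this
    · exact ⟨φ, hq, h₁, h₂⟩
    · exact ⟨.neg φ, hq, h₁, fun h => h h₂⟩
  choose φ hq h₁ h₂ using h'
  obtain ⟨ψ, hψ, hA, hB⟩ := MSO.exists_conj A B φ hq
  exact ⟨ψ, hψ, (hA a S).2 h₁, fun i hi => h₂ i ((hB _ _).1 hi i)⟩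

/-- If every `w` were a wrong answer, each would be separated by a formula; the conjunction over the
finitely many `w`, preceded by an existential quantifier, would separate the two positions at rank
`q + 1`. Finiteness of `W` replaces the usual argument that there are finitely many formulas up to
equivalence, so the set of labels may be infinite. -/
theorem MSO.exists_vertex [Finite W] {e s q : ℕ} {a : Fin e → V} {S : Fin s → Set V}
    {b : Fin e → W} {T : Fin s → Set W}
    (h : ∀ φ : MSO κ e s, φ.rank ≤ q + 1 → (φ.Sat A a S ↔ φ.Sat B b T)) (v : V) :
    ∃ w : W, ∀ φ : MSO κ (e + 1) s, φ.rank ≤ q →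
      (φ.Sat A (Fin.cons v a) S ↔ φ.Sat B (Fin.cons w b) T) := by
  by_contra hc
  obtain ⟨ψ, hψ, hA, hB⟩ := MSO.exists_separating (not_exists.1 hc)
  obtain ⟨w, hw⟩ := (h (.exVertex ψ) (Nat.succ_le_succ hψ)).1 ⟨v, hA⟩
  exact hB w hw

theorem MSO.exists_set [Finite W] {e s q : ℕ} {a : Fin e → V} {S : Fin s → Set V}
    {b : Fin e → W} {T : Fin s → Set W}
    (h : ∀ φ : MSO κ e s, φ.rank ≤ q + 1 → (φ.Sat A a S ↔ φ.Sat B b T)) (X : Set V) :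
    ∃ Y : Set W, ∀ φ : MSO κ e (s + 1), φ.rank ≤ q →
      (φ.Sat A a (Fin.cons X S) ↔ φ.Sat B b (Fin.cons Y T)) := by
  by_contra hc
  obtain ⟨ψ, hψ, hA, hB⟩ := MSO.exists_separating (not_exists.1 hc)
  obtain ⟨Y, hY⟩ := (h (.exSet ψ) (Nat.succ_le_succ hψ)).1 ⟨X, hA⟩
  exact hB Y hY

theorem duplicatorSurvives_of_sat_iff [Finite V] [Finite W] : ∀ (q : ℕ) {e s : ℕ} {a : Fin e → V}
    {S : Fin s → Set V} {b : Fin e → W} {T : Fin s → Set W},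
    (∀ φ : MSO κ e s, φ.rank ≤ q → (φ.Sat A a S ↔ φ.Sat B b T)) →
      DuplicatorSurvives A B q a S b T
  | 0, _, _, _, _, _, _, h => ⟨fun i j => h (.eq i j) le_rfl, fun i j => h (.edge i j) le_rfl,
      fun c i => h (.lab c i) le_rfl, fun X i => h (.mem i X) le_rfl⟩
  | q + 1, _, _, _, _, _, _, h =>
    have h' := fun φ hφ => (h φ hφ).symm
    ⟨fun v => (MSO.exists_vertex h v).imp fun _ h => duplicatorSurvives_of_sat_iff q h,
      fun w => (MSO.exists_vertex h' w).imp fun _ h =>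
        duplicatorSurvives_of_sat_iff q fun φ hφ => (h φ hφ).symm,
      fun X => (MSO.exists_set h X).imp fun _ h => duplicatorSurvives_of_sat_iff q h,
      fun Y => (MSO.exists_set h' Y).imp fun _ h =>
        duplicatorSurvives_of_sat_iff q fun φ hφ => (h φ hφ).symm⟩

theorem msoEquiv_of_rankType_eq [Finite V] [Finite W] {q : ℕ} (h : A.rankType q = B.rankType q) :
    MSOEquiv q A B :=
  duplicatorSurvives_of_sat_iff q fun φ hφ =>
    ⟨fun hA => ((Set.ext_iff.1 h φ).1 ⟨hφ, hA⟩).2, fun hB => ((Set.ext_iff.1 h φ).2 ⟨hφ, hB⟩).2⟩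

end Games

/-! ### Composition of games -/

section Composition

/-- Two vertices have the same labels. -/
def SameLabels {κ V W : Type*} (A : LabeledGraph κ V) (B : LabeledGraph κ W) (x : V) (y : W) :
    Prop :=
  ∀ c, x ∈ A.label c ↔ y ∈ B.label c

variable {J : Type*} {κ : J → Type*} {V W : J → Type*} {A : ∀ j, LabeledGraph (κ j) (V j)}
  {B : ∀ j, LabeledGraph (κ j) (W j)} {κ' V' W' : Type*} {A' : LabeledGraph κ' V'}
  {B' : LabeledGraph κ' W'} {F : (Σ j, V j) ≃ V'} {F' : (Σ j, W j) ≃ W'}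

theorem preimage_cons {α β : Type*} (f : α → β) {s : ℕ} (X : Set β) (S : Fin s → Set β) :
    (fun i => f ⁻¹' (Fin.cons X S : Fin (s + 1) → Set β) i) =
      (Fin.cons (f ⁻¹' X) fun i => f ⁻¹' S i : Fin (s + 1) → Set α) := by
  funext i
  refine Fin.cases ?_ (fun i => ?_) i <;> simp

/-- If Duplicator wins on the components then she wins on structures composed in the same way from
the components. -/
theorem duplicatorSurvives_of_components
    (hlab : ∀ j x y, SameLabels (A j) (B j) x y → SameLabels A' B' (F ⟨j, x⟩) (F' ⟨j, y⟩))
    (hsame : ∀ j x x' y y', SameLabels (A j) (B j) x y → SameLabels (A j) (B j) x' y' →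
      ((A j).graph.Adj x x' ↔ (B j).graph.Adj y y') →
      (A'.graph.Adj (F ⟨j, x⟩) (F ⟨j, x'⟩) ↔ B'.graph.Adj (F' ⟨j, y⟩) (F' ⟨j, y'⟩)))
    (hdiff : ∀ j j' x x' y y', j ≠ j' → SameLabels (A j) (B j) x y →
      SameLabels (A j') (B j') x' y' →
      (A'.graph.Adj (F ⟨j, x⟩) (F ⟨j', x'⟩) ↔ B'.graph.Adj (F' ⟨j, y⟩) (F' ⟨j', y'⟩))) :
    ∀ (q : ℕ) {e s : ℕ} {a : Fin e → V'} {S : Fin s → Set V'} {b : Fin e → W'}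
      {T : Fin s → Set W'},
      -- The invariant: in each component there is a local position still winning for `q` rounds.
      -- Its sets are the traces of the played sets, and its elements include all played elements in
      -- this component, with matching answers. The number of elements may differ between
      -- components.
      (∀ j, ∃ (k : ℕ) (α : Fin k → V j) (β : Fin k → W j),
        DuplicatorSurvives (A j) (B j) q α (fun i => (fun x => F ⟨j, x⟩) ⁻¹' S i) β
          (fun i => (fun x => F' ⟨j, x⟩) ⁻¹' T i) ∧
        ∀ i x, a i = F ⟨j, x⟩ → ∃ k, α k = x ∧ b i = F' ⟨j, β k⟩) →
      DuplicatorSurvives A' B' q a S b T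
  | 0, e, s, a, S, b, T, h => by
    have hloc : ∀ i, ∃ j x, a i = F ⟨j, x⟩ := fun i =>
      ⟨(F.symm (a i)).1, (F.symm (a i)).2, (F.apply_symm_apply _).symm⟩
    have hF : ∀ {j j' x x'}, j ≠ j' → F ⟨j, x⟩ ≠ F ⟨j', x'⟩ := fun hj h =>
      hj (congrArg Sigma.fst (F.injective h))
    have hF' : ∀ {j j' x x'}, j ≠ j' → F' ⟨j, x⟩ ≠ F' ⟨j', x'⟩ := fun hj h =>
      hj (congrArg Sigma.fst (F'.injective h))
    refine ⟨fun i i' => ?_, fun i i' => ?_, fun c i => ?_, fun X i => ?_⟩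
    · obtain ⟨j, x, hx⟩ := hloc i
      obtain ⟨j', x', hx'⟩ := hloc i'
      obtain ⟨k, α, β, hp, hk⟩ := h j
      obtain ⟨m, rfl, hb⟩ := hk i x hx
      by_cases hj : j = j'
      · subst hj
        obtain ⟨m', rfl, hb'⟩ := hk i' x' hx'
        rw [hx, hx', hb, hb']
        simpa using hp.1 m m'
      · obtain ⟨k', α', β', hp', hk'⟩ := h j'
        obtain ⟨m', rfl, hb'⟩ := hk' i' x' hx'
        rw [hx, hx', hb, hb']
        exact iff_of_false (hF hj) (hF' hj)
    · obtain ⟨j, x, hx⟩ := hloc i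
      obtain ⟨j', x', hx'⟩ := hloc i'
      obtain ⟨k, α, β, hp, hk⟩ := h j
      obtain ⟨m, rfl, hb⟩ := hk i x hx
      by_cases hj : j = j'
      · subst hj
        obtain ⟨m', rfl, hb'⟩ := hk i' x' hx'
        rw [hx, hx', hb, hb']
        exact hsame j _ _ _ _ (fun c => hp.2.2.1 c m) (fun c => hp.2.2.1 c m') (hp.2.1 m m')
      · obtain ⟨k', α', β', hp', hk'⟩ := h j'
        obtain ⟨m', rfl, hb'⟩ := hk' i' x' hx'
        rw [hx, hx', hb, hb']
        exact hdiff j j' _ _ _ _ hj (fun c => hp.2.2.1 c m) (fun c => hp'.2.2.1 c m')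
    · obtain ⟨j, x, hx⟩ := hloc i
      obtain ⟨k, α, β, hp, hk⟩ := h j
      obtain ⟨m, rfl, hb⟩ := hk i x hx
      rw [hx, hb]
      exact hlab j _ _ (fun c => hp.2.2.1 c m) c
    · obtain ⟨j, x, hx⟩ := hloc i
      obtain ⟨k, α, β, hp, hk⟩ := h j
      obtain ⟨m, rfl, hb⟩ := hk i x hx
      rw [hx, hb]
      exact hp.2.2.2 X m
  | q + 1, e, s, a, S, b, T, h => by
    have move : ∀ j (x : V j) (y : W j), (∃ (k : ℕ) (α : Fin k → V j) (β : Fin k → W j),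
        DuplicatorSurvives (A j) (B j) q (Fin.cons x α) (fun i => (fun x => F ⟨j, x⟩) ⁻¹' S i)
          (Fin.cons y β) (fun i => (fun x => F' ⟨j, x⟩) ⁻¹' T i) ∧
        ∀ i x, a i = F ⟨j, x⟩ → ∃ k, α k = x ∧ b i = F' ⟨j, β k⟩) →
        DuplicatorSurvives A' B' q (Fin.cons (F ⟨j, x⟩) a) S (Fin.cons (F' ⟨j, y⟩) b) T := by
      rintro j x y ⟨k, α, β, hs, hk⟩
      refine duplicatorSurvives_of_components hlab hsame hdiff q fun j' => ?_
      by_cases hj : j' = j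
      · subst hj
        refine ⟨k + 1, Fin.cons x α, Fin.cons y β, hs, fun i => ?_⟩
        refine Fin.cases (fun x' hx' => ⟨0, ?_, rfl⟩) (fun i x' hx' => ?_) i
        · simpa using hx'
        · obtain ⟨m, hm, hb⟩ := hk i x' hx'
          exact ⟨m.succ, hm, hb⟩
      -- A vertex move does not concern the other components; their local games just give up one
      -- round.
      · obtain ⟨k', α', β', hs', hk'⟩ := h j'
        refine ⟨k', α', β', hs'.of_succ, fun i => ?_⟩
        refine Fin.cases (fun x' hx' => ?_) (fun i x' hx' => hk' i x' hx') i
        exact absurd (congrArg Sigma.fst (F.injective hx')).symm hj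
    refine ⟨fun v => ?_, fun w => ?_, fun X => ?_, fun Y => ?_⟩
    · obtain ⟨⟨j, x⟩, rfl⟩ := F.surjective v
      obtain ⟨k, α, β, hs, hk⟩ := h j
      obtain ⟨y, hy⟩ := hs.1 x
      exact ⟨F' ⟨j, y⟩, move j x y ⟨k, α, β, hy, hk⟩⟩
    · obtain ⟨⟨j, y⟩, rfl⟩ := F'.surjective w
      obtain ⟨k, α, β, hs, hk⟩ := h j
      obtain ⟨x, hx⟩ := hs.2.1 y
      exact ⟨F ⟨j, x⟩, move j x y ⟨k, α, β, hx, hk⟩⟩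
    · choose k α β hs hk using h
      choose Y hY using fun j => (hs j).2.2.1 ((fun x => F ⟨j, x⟩) ⁻¹' X)
      -- Duplicator answers with the union of her answers in the local games.
      refine ⟨{w | (F'.symm w).2 ∈ Y (F'.symm w).1},
        duplicatorSurvives_of_components hlab hsame hdiff q fun j => ⟨k j, α j, β j, ?_, hk j⟩⟩
      rw [preimage_cons, preimage_cons]
      convert hY j using 2
      ext y
      change (fun p : Σ j, W j => p.2 ∈ Y p.1) (F'.symm (F' ⟨j, y⟩)) ↔ _
      rw [F'.symm_apply_apply]
    · choose k α β hs hk using h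
      choose X hX using fun j => (hs j).2.2.2 ((fun x => F' ⟨j, x⟩) ⁻¹' Y)
      refine ⟨{v | (F.symm v).2 ∈ X (F.symm v).1},
        duplicatorSurvives_of_components hlab hsame hdiff q fun j => ⟨k j, α j, β j, ?_, hk j⟩⟩
      rw [preimage_cons, preimage_cons]
      convert hX j using 2
      ext x
      change (fun p : Σ j, V j => p.2 ∈ X p.1) (F.symm (F ⟨j, x⟩)) ↔ _
      rw [F.symm_apply_apply]

theorem msoEquiv_of_components {q : ℕ} (h : ∀ j, MSOEquiv q (A j) (B j))
    (hlab : ∀ j x y, SameLabels (A j) (B j) x y → SameLabels A' B' (F ⟨j, x⟩) (F' ⟨j, y⟩))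
    (hsame : ∀ j x x' y y', SameLabels (A j) (B j) x y → SameLabels (A j) (B j) x' y' →
      ((A j).graph.Adj x x' ↔ (B j).graph.Adj y y') →
      (A'.graph.Adj (F ⟨j, x⟩) (F ⟨j, x'⟩) ↔ B'.graph.Adj (F' ⟨j, y⟩) (F' ⟨j, y'⟩)))
    (hdiff : ∀ j j' x x' y y', j ≠ j' → SameLabels (A j) (B j) x y →
      SameLabels (A j') (B j') x' y' →
      (A'.graph.Adj (F ⟨j, x⟩) (F ⟨j', x'⟩) ↔ B'.graph.Adj (F' ⟨j, y⟩) (F' ⟨j', y'⟩))) :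
    MSOEquiv q A' B' :=
  duplicatorSurvives_of_components hlab hsame hdiff q fun j =>
    ⟨0, Fin.elim0, Fin.elim0, by
      have := h j
      unfold MSOEquiv at this
      convert this, fun i => i.elim0⟩

end Composition

theorem glue_adj_same {k : ℕ} {ℓ : Fin k → ℕ} {V : Fin k → Type*} {G : ∀ j, SimpleGraph (V j)}
    {π : ∀ j, V j → Fin (ℓ j)} {B : SimpleGraph (Σ j, Fin (ℓ j))} {j : Fin k} {x y : V j} :
    (glue G π B).Adj ⟨j, x⟩ ⟨j, y⟩ ↔ (G j).Adj x y ∨ B.Adj ⟨j, π j x⟩ ⟨j, π j y⟩ := by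
  refine or_congr_left ⟨?_, fun h => ⟨j, x, y, rfl, rfl, h⟩⟩
  rintro ⟨j', v, w, hx, hy, h⟩
  cases hx
  cases hy
  exact h

theorem glue_adj_of_ne {k : ℕ} {ℓ : Fin k → ℕ} {V : Fin k → Type*} {G : ∀ j, SimpleGraph (V j)}
    {π : ∀ j, V j → Fin (ℓ j)} {B : SimpleGraph (Σ j, Fin (ℓ j))} {j j' : Fin k} (hj : j ≠ j')
    {x : V j} {y : V j'} :
    (glue G π B).Adj ⟨j, x⟩ ⟨j', y⟩ ↔ B.Adj ⟨j, π j x⟩ ⟨j', π j' y⟩ := by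
  refine or_iff_right ?_
  rintro ⟨i, v, w, hx, hy, h⟩
  exact hj ((congrArg Sigma.fst hx).trans (congrArg Sigma.fst hy).symm)

/-- In a partitioned structure, vertices with the same labels lie in parts with the same index, and
adjacency in `B` depends on these indices only. -/
theorem msoEquiv_glued {q k : ℕ} {ℓ : Fin k → ℕ} {V W : Fin k → Type*}
    {G : ∀ j, SimpleGraph (V j)} {H : ∀ j, SimpleGraph (W j)} {π : ∀ j, V j → Fin (ℓ j)}
    {ρ : ∀ j, W j → Fin (ℓ j)} {B : SimpleGraph (Σ j, Fin (ℓ j))} {X X' : Σ j, Fin (ℓ j)}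
    (h : ∀ j, MSOEquiv q (partitioned (G j) (π j)) (partitioned (H j) (ρ j))) :
    MSOEquiv q (gluedStructure G π B X X') (gluedStructure H ρ B X X') := by
  have key : ∀ {j x y}, SameLabels (partitioned (G j) (π j)) (partitioned (H j) (ρ j)) x y →
      π j x = ρ j y := fun {j x y} hxy => ((hxy (π j x)).1 rfl).symm
  refine msoEquiv_of_components (F := Equiv.refl _) (F' := Equiv.refl _) h ?_ ?_ ?_
  · intro j x y hxy c
    have hp := key hxy
    rcases c with c | c
    · simp [gluedStructure, hp]
    · fin_cases c <;> simp [gluedStructure, hp]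
  · intro j x x' y y' hxy hxy' hadj
    simp only [gluedStructure, Equiv.refl_apply]
    rw [glue_adj_same, glue_adj_same, key hxy, key hxy']
    exact or_congr_left hadj
  · intro j j' x x' y y' hj hxy hxy'
    simp only [gluedStructure, Equiv.refl_apply]
    rw [glue_adj_of_ne hj, glue_adj_of_ne hj, key hxy, key hxy']

/-! ### Types of merged red components -/

section PartOf

variable {V : Type*} [Fintype V] [DecidableEq V] {G : SimpleGraph V}
  {P : Finpartition (Finset.univ : Finset V)} {d : ℕ}

/-- The part that contains a vertex. -/
def partOf (P : Finpartition (Finset.univ : Finset V)) (v : V) : {A : Finset V // A ∈ P.parts} :=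
  ⟨P.part v, P.part_mem.2 (Finset.mem_univ v)⟩

theorem mem_partOf (v : V) : v ∈ (partOf P v).1 := P.mem_part (Finset.mem_univ v)

theorem partOf_eq {v : V} {A : {A : Finset V // A ∈ P.parts}} (h : v ∈ A.1) : partOf P v = A :=
  Subtype.ext (P.eq_of_mem_parts (partOf P v).2 A.2 (mem_partOf v) h)

theorem mem_componentVertices {D : (redGraph G P).ConnectedComponent} {v : V} :
    v ∈ componentVertices D ↔ (redGraph G P).connectedComponentMk (partOf P v) = D := by
  constructor
  · rintro ⟨A, hA, hv⟩
    rw [partOf_eq hv]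
    exact hA
  · exact fun h => ⟨partOf P v, h, mem_partOf v⟩

theorem mem_label_componentStructure {l : {X : Finset V // X ∈ P.parts} → Fin d}
    {D : (redGraph G P).ConnectedComponent} {v : componentVertices D} {c : Fin d} :
    v ∈ (componentStructure l D).label c ↔ l (partOf P v.1) = c := by
  constructor
  · rintro ⟨A, -, hc, hv⟩
    rw [partOf_eq hv, hc]
  · exact fun h => ⟨partOf P v.1, mem_componentVertices.1 v.2, h, mem_partOf _⟩

theorem componentStructure_adj {l : {X : Finset V // X ∈ P.parts} → Fin d}
    {D : (redGraph G P).ConnectedComponent} {v w : componentVertices D} :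
    (componentStructure l D).graph.Adj v w ↔ G.Adj v.1 w.1 := Iff.rfl

/-- Parts in different red components are not joined by a red edge, hence homogeneous, so a single
edge forces all of them. -/
theorem adj_iff_blackAdj {v w : V} (h : (redGraph G P).connectedComponentMk (partOf P v) ≠
    (redGraph G P).connectedComponentMk (partOf P w)) :
    G.Adj v w ↔ BlackAdj G (partOf P v).1 (partOf P w).1 := by
  have hne : (partOf P v).1 ≠ (partOf P w).1 := fun he => h (by rw [Subtype.ext he])
  have hhom : Homogeneous G (partOf P v).1 (partOf P w).1 := by
    by_contra hc
    exact h (SimpleGraph.ConnectedComponent.eq.2 (SimpleGraph.Adj.reachable ⟨hne, hc⟩))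
  constructor
  · intro hvw
    refine ⟨hne, hhom.resolve_right fun h' => h' v (mem_partOf v) w (mem_partOf w) hvw⟩
  · exact fun h' => h'.2 v (mem_partOf v) w (mem_partOf w)

end PartOf

namespace MergeStep

variable {V W : Type*} [Fintype V] [DecidableEq V] [Fintype W] [DecidableEq W] {d q : ℕ}
  (M : MergeStep V d) (N : MergeStep W d)

theorem subset_newPart (A : {A : Finset V // A ∈ M.P.parts}) : A.1 ⊆ (M.newPart A).1 := by
  unfold newPart
  split_ifs with h
  · rcases h with rfl | rfl
    · exact Finset.subset_union_left
    · exact Finset.subset_union_right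
  · exact subset_rfl

theorem partOf_newPart (v : V) : partOf M.P' v = M.newPart (partOf M.P v) :=
  partOf_eq (M.subset_newPart _ (mem_partOf v))

/-- Merging enlarges parts and thus preserves inhomogeneity: a red edge remains red or is collapsed.
Consequently the new component absorbs old components only as a whole. -/
theorem newPart_reachable {A B : {A : Finset V // A ∈ M.P.parts}}
    (h : (redGraph M.G M.P).Reachable A B) :
    (redGraph M.G M.P').Reachable (M.newPart A) (M.newPart B) := by
  rw [SimpleGraph.reachable_iff_reflTransGen] at h
  induction h with
  | refl => exact .refl _
  | @tail B C _ h ih =>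
    refine ih.trans ?_
    by_cases hBC : M.newPart B = M.newPart C
    · rw [hBC]
    · exact SimpleGraph.Adj.reachable ⟨fun he => hBC (Subtype.ext he),
        fun h' => h.2 (h'.mono (M.subset_newPart B) (M.subset_newPart C))⟩

theorem newPart_mem_of_oldComponent_eq {A B : {A : Finset V // A ∈ M.P.parts}}
    (hA : M.newPart A ∈ M.newComponent.supp) (h : M.oldComponent A = M.oldComponent B) :
    M.newPart B ∈ M.newComponent.supp := by
  have hr := M.newPart_reachable (SimpleGraph.ConnectedComponent.eq.1 h)
  exact (SimpleGraph.ConnectedComponent.eq.2 hr.symm).trans hA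

theorem mem_newComponent {v : V} : v ∈ componentVertices M.newComponent ↔
    M.newPart (partOf M.P v) ∈ M.newComponent.supp := by
  rw [mem_componentVertices, partOf_newPart]
  rfl

variable {M N}

/-- The vertices of the components of `M.Involved` parts, indexed by representatives. -/
theorem bijective_components {J : Type*} (r : J → M.Involved)
    (hr : ∀ j j', M.oldComponent (r j).1 = M.oldComponent (r j').1 → j = j')
    (hr' : ∀ A : M.Involved, ∃ j, M.oldComponent (r j).1 = M.oldComponent A.1) :
    ∃ F : (Σ j, componentVertices (M.oldComponent (r j).1)) ≃ componentVertices M.newComponent,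
      ∀ p, (F p).1 = p.2.1 := by
  have hmem : ∀ p : Σ j, componentVertices (M.oldComponent (r j).1),
      p.2.1 ∈ componentVertices M.newComponent := fun p => M.mem_newComponent.2
    (M.newPart_mem_of_oldComponent_eq (r p.1).2 (mem_componentVertices.1 p.2.2).symm)
  refine ⟨Equiv.ofBijective (fun p => ⟨p.2.1, hmem p⟩) ⟨?_, ?_⟩, fun p => rfl⟩
  · rintro ⟨j, v, hv⟩ ⟨j', v', hv'⟩ h
    obtain rfl : v = v' := congrArg Subtype.val h
    obtain rfl := hr j j' ((mem_componentVertices.1 hv).symm.trans (mem_componentVertices.1 hv'))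
    rfl
  · rintro ⟨v, hv⟩
    obtain ⟨j, hj⟩ := hr' ⟨partOf M.P v, M.mem_newComponent.1 hv⟩
    exact ⟨⟨j, v, mem_componentVertices.2 hj.symm⟩, rfl⟩

/-- Equal types give winning strategies on matched old components; these are composed along the
black edges to a strategy on the new components, and types are read off again. -/
theorem localType_eq_of_matching {ι : M.Involved ≃ N.Involved} (h : Matching q M N ι) :
    localType q M.l' M.newComponent = localType q N.l' N.newComponent := by
  obtain ⟨-, -, hcomp, hl, hl', hblack, htype⟩ := h
  -- The composition is indexed by the old components absorbed by the new one. A chosen part `r j`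
  -- represents each of them and carries it over to the other graph by `ι`.
  let J := Set.range fun A : M.Involved => M.oldComponent A.1
  let r : J → M.Involved := fun j => j.2.choose
  have hrj : ∀ j : J, M.oldComponent (r j).1 = j := fun j => j.2.choose_spec
  have hr : ∀ j j', M.oldComponent (r j).1 = M.oldComponent (r j').1 → j = j' := fun j j' h => by
    rw [hrj, hrj] at h
    exact Subtype.ext h
  have hr' : ∀ A : M.Involved, ∃ j, M.oldComponent (r j).1 = M.oldComponent A.1 := fun A =>
    ⟨⟨_, A, rfl⟩, hrj _⟩
  obtain ⟨F, hF⟩ := bijective_components r hr hr'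
  obtain ⟨F', hF'⟩ := bijective_components (fun j => ι (r j))
    (fun j j' h => hr j j' ((hcomp _ _).2 h)) fun A => by
      obtain ⟨j, hj⟩ := hr' (ι.symm A)
      refine ⟨j, ?_⟩
      have := (hcomp _ _).1 hj
      rwa [ι.apply_symm_apply] at this
  have inv : ∀ {j} (x : componentVertices (M.oldComponent (r j).1)),
      M.newPart (partOf M.P x.1) ∈ M.newComponent.supp := fun {j} x =>
    M.newPart_mem_of_oldComponent_eq (r j).2 (mem_componentVertices.1 x.2).symm
  -- Within a red component a part is determined by its label, so vertices with the same labels in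
  -- matched components lie in parts matched by `ι`.
  have key : ∀ {j} (x : componentVertices (M.oldComponent (r j).1))
      (y : componentVertices (N.oldComponent (ι (r j)).1)),
      SameLabels (componentStructure M.l (M.oldComponent (r j).1))
        (componentStructure N.l (N.oldComponent (ι (r j)).1)) x y →
      (ι ⟨partOf M.P x.1, inv x⟩).1 = partOf N.P y.1 := by
    intro j x y hxy
    have h₁ := (hxy (M.l (partOf M.P x.1))).1 (mem_label_componentStructure.2 rfl)
    rw [mem_label_componentStructure] at h₁
    refine N.isLabeling _ _ (SimpleGraph.ConnectedComponent.eq.1 ?_) ?_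
    · refine ((hcomp ⟨partOf M.P x.1, inv x⟩ (r j)).1 (mem_componentVertices.1 x.2)).trans
        (mem_componentVertices.1 y.2).symm
    · rw [h₁]
      exact (hl ⟨partOf M.P x.1, inv x⟩).symm
  refine MSOEquiv.rankType_eq (msoEquiv_of_components (F := F) (F' := F')
    (A := fun j => componentStructure M.l (M.oldComponent (r j).1))
    (B := fun j => componentStructure N.l (N.oldComponent (ι (r j)).1))
    (fun j => msoEquiv_of_rankType_eq (htype (r j))) ?_ ?_ ?_)
  · intro j x y hxy c
    rw [mem_label_componentStructure, mem_label_componentStructure, hF, hF', partOf_newPart,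
      partOf_newPart, ← key x y hxy]
    exact (hl' ⟨partOf M.P x.1, inv x⟩) ▸ Iff.rfl
  · intro j x x' y y' _ _ h
    rw [componentStructure_adj, componentStructure_adj, hF, hF, hF', hF']
    exact h
  · intro j j' x x' y y' hj hxy hxy'
    rw [componentStructure_adj, componentStructure_adj, hF, hF, hF', hF']
    have hx := mem_componentVertices.1 x.2
    have hx' := mem_componentVertices.1 x'.2
    have hy := mem_componentVertices.1 y.2
    have hy' := mem_componentVertices.1 y'.2
    have hne : M.oldComponent (r j).1 ≠ M.oldComponent (r j').1 := fun h => hj (hr j j' h)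
    rw [adj_iff_blackAdj (P := M.P) (by rw [hx, hx']; exact hne),
      adj_iff_blackAdj (P := N.P) (by rw [hy, hy']; exact fun h => hne ((hcomp _ _).2 h)),
      ← key x y hxy, ← key x' y' hxy']
    exact hblack ⟨partOf M.P x.1, inv x⟩ ⟨partOf M.P x'.1, inv x'⟩ (by
      change (redGraph M.G M.P).connectedComponentMk _ ≠ (redGraph M.G M.P).connectedComponentMk _
      rw [hx, hx']
      exact hne)

end MergeStep

theorem mainTheorem3 :
    -- MSO-EF equivalence is preserved under disjoint union plus prescribed bicliques
    (∀ (q k : ℕ) (ℓ : Fin k → ℕ) (V : Fin k → Type u) (W : Fin k → Type v)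
      (G : ∀ j, SimpleGraph (V j)) (H : ∀ j, SimpleGraph (W j))
      (π : ∀ j, V j → Fin (ℓ j)) (ρ : ∀ j, W j → Fin (ℓ j))
      (B : SimpleGraph (Σ j, Fin (ℓ j))) (X X' : Σ j, Fin (ℓ j)),
      (∀ j, MSOEquiv q (partitioned (G j) (π j)) (partitioned (H j) (ρ j))) →
        MSOEquiv q (gluedStructure G π B X X') (gluedStructure H ρ B X X')) ∧
    -- the local types before a merge, the black edges and the contracted pair determine the
    -- local type of the merged red component
    (∀ (q d : ℕ) (V : Type u) (W : Type v) [Fintype V] [DecidableEq V] [Fintype W] [DecidableEq W]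
      (M : MergeStep V d) (N : MergeStep W d) (ι : M.Involved ≃ N.Involved),
      MergeStep.Matching q M N ι →
        localType q M.l' M.newComponent = localType q N.l' N.newComponent) ∧
    -- one program decides MSO₁ model checking in time `f(|φ|, d) · n`
    (∃ (prog : List Instr) (f : ℕ → ℕ → ℕ),
      ∀ (φ : MSO Empty 0 0) (d n : ℕ) (G : SimpleGraph (Fin n)) [DecidableRel G.Adj]
        (P : ℕ → Finpartition (Finset.univ : Finset (Fin n))) (cs : List (Contraction n)),
        0 < n → IsPartitionSequence P →
        (∀ i, 1 ≤ i → i ≤ n → ComponentWidthLE G (P i) d) →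
        Describes G P cs →
        (G.toStructure.Models φ →
          RAM.Outputs prog (inputWord φ d G cs) (f φ.size d * n) (f φ.size d * n ^ 2) 1) ∧
        (¬ G.toStructure.Models φ →
          RAM.Outputs prog (inputWord φ d G cs) (f φ.size d * n) (f φ.size d * n ^ 2) 0)) := by
  refine ⟨fun q k ℓ V W G H π ρ B X X' h => msoEquiv_glued h, fun q d V W => ?_,
    RAM.exists_modelChecker⟩
  intro _ _ _ _ M N ι h
  exact MergeStep.localType_eq_of_matching h
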